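/- **Setting.** Write $z=x+\mathrm iy=\rho\,\mathrm e^{\mathrm i\theta}$ and, for $0<\alpha<\pi$, let $\mathfrak S_\alpha=\{-\alpha<\theta<0\}$ be the infinite sector of angle $\alpha$, with sides $I_{\rm in}=\{\theta=-\alpha\}$, $I_{\rm out}=\{\theta=0\}$. Consider the Robin problem $$\Delta\Phi=0\ \text{ in }\mathfrak S_\alpha,\qquad \frac{\partial\Phi}{\partial n}=\Phi\ \text{ on }\partial\mathfrak S_\alpha\setminus\{0\}\qquad(1)$$ ($n$ is the exterior unit normal). A solution is a complex-valued function $\Phi$, continuous on the closed sector and continuously differentiable up to the two open sides, which satisfies (1) classically. On $\mathbb C^2$ let $u\cdot v=u_1\overline{v_1}+u_2\overline{v_2}$. For $\mathbf h=(h_1,h_2)\in\mathbb C^2$ define the outgoing and incoming plane waves $$W^{\mathbf h}_{\rm out}(z)=\mathrm e^{y}\left(h_1\mathrm e^{\mathrm ix}+h_2\mathrm e^{-\mathrm ix}\right),\qquad W^{\mathbf h}_{\rm in}(z)=W^{(h_2,h_1)}_{\rm out}(\mathcal M_\alpha z),$$ where $\mathcal M_\alpha:(\rho,\theta)\mapsto(\rho,-\alpha-\theta)$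 is the reflection across the bisector. Let $\mathcal E=\{\pi/(2k): k=1,2,\dots\}$ be the set of exceptional angles. For $\alpha\notin\mathcal E$ put $$\mathtt A(\alpha)=\begin{pmatrix}\csc\frac{\pi^2}{2\alpha}&-\mathrm i\cot\frac{\pi^2}{2\alpha}\\ \mathrm i\cot\frac{\pi^2}{2\alpha}&\csc\frac{\pi^2}{2\alpha}\end{pmatrix}.$$ Put $\mathbf X_{\rm even}=\frac1{\sqrt2}(\mathrm e^{-\mathrm i\pi/4},\mathrm e^{\mathrm i\pi/4})$, $\mathbf X_{\rm odd}=\frac1{\sqrt2}(\mathrm e^{\mathrm i\pi/4},\mathrm e^{-\mathrm i\pi/4})$ and, for $\alpha=\pi/(2k)$, let $(\mathbf X(\alpha),\mathbf X^\perp(\alpha))$ be $(\mathbf X_{\rm even},\mathbf X_{\rm odd})$ if $k$ is even and $(\mathbf X_{\rm odd},\mathbf X_{\rm even})$ if $k$ is odd. **Theorem.** Let $0<\alpha<\pi$. (a) If $\alpha\notin\mathcal E$, there are constants $C_\alpha,\rho_\alpha>0$ depending only on $\alpha$ such that for every $\mathbf h_{\rm in}\in\mathbb C^2$ there exist $\mathbf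 h_{\rm out}\in\mathbb C^2$, namely $\mathbf h_{\rm out}=\mathtt A(\alpha)\mathbf h_{\rm in}$, and a solution $\Phi$ of (1) of the form $$\Phi=W^{\mathbf h_{\rm out}}_{\rm out}+W^{\mathbf h_{\rm in}}_{\rm in}+R\qquad(2)$$ with $$|R(z)|+\rho\,\|\nabla_{(x,y)}R(z)\|\le C\rho^{-\pi/\alpha}\quad\text{for all }z\in\mathfrak S_\alpha,\ \rho=|z|\ge\rho_\alpha,\qquad(3)$$ where $C=C_\alpha\|\mathbf h_{\rm in}\|$. (b) If $\alpha=\pi/(2k)$ with $k\in\{1,2,\dots\}$, there are constants $C_\alpha,\rho_\alpha>0$ depending only on $\alpha$ such that for any $\mathbf h_{\rm in},\mathbf h_{\rm out}\in\mathbb C^2$ with $$\mathbf h_{\rm in}\cdot\mathbf X(\alpha)=\mathbf h_{\rm out}\cdot\mathbf X^\perp(\alpha)=0$$ there is a solution $\Phi$ of (1) of the form (2) that satisfies (3) with $C=C_\alpha(\|\mathbf h_{\rm in}\|+\|\mathbf h_{\rm out}\|)$. -/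

import Mathlib

open scoped ComplexConjugate

/-- Exceptional angles: `π / (2k)` with `k = 1, 2, 3, …`. -/
def exceptionalAngles : Set ℝ :=
  {α | ∃ k : ℕ, 1 ≤ k ∧ α = Real.pi / (2 * k)}

/-- The parity of an angle; it equals `(-1)^k` at the exceptional angle `π / (2k)`. -/
noncomputable def angleParity (α : ℝ) : ℝ := Real.cos (Real.pi ^ 2 / (2 * α))

/-- The dot product of `ℂ²`, conjugate-linear in the second argument. -/
noncomputable def cdot (u v : EuclideanSpace ℂ (Fin 2)) : ℂ :=
  u 0 * conj (v 0) + u 1 * conj (v 1)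

/-- The vector `𝐞(t) = (e^{-it}, e^{it})`. -/
noncomputable def expVec (t : ℝ) : EuclideanSpace ℂ (Fin 2) :=
  !₂[Complex.exp (-(Complex.I * t)), Complex.exp (Complex.I * t)]

noncomputable def XEven : EuclideanSpace ℂ (Fin 2) :=
  !₂[(1 / (Real.sqrt 2 : ℂ)) * Complex.exp (-(Complex.I * (Real.pi / 4))),
     (1 / (Real.sqrt 2 : ℂ)) * Complex.exp (Complex.I * (Real.pi / 4))]

noncomputable def XOdd : EuclideanSpace ℂ (Fin 2) :=
  !₂[(1 / (Real.sqrt 2 : ℂ)) * Complex.exp (Complex.I * (Real.pi / 4)),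
     (1 / (Real.sqrt 2 : ℂ)) * Complex.exp (-(Complex.I * (Real.pi / 4)))]

open Classical in
/-- `𝐗(α)` for an exceptional angle `α` (so that the parity of `α` is `1` or `-1`). -/
noncomputable def XVec (α : ℝ) : EuclideanSpace ℂ (Fin 2) :=
  if angleParity α = 1 then XEven else XOdd

open Classical in
/-- `𝐗^⊥(α)` for an exceptional angle `α`. -/
noncomputable def XPerp (α : ℝ) : EuclideanSpace ℂ (Fin 2) :=
  if angleParity α = 1 then XOdd else XEven

/-- The vertex transfer matrix, with entries the cosecant and the cotangent of `π² / (2α)`;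
meaningful for non-exceptional `α`. -/
noncomputable def vertexTransfer (α : ℝ) : Matrix (Fin 2) (Fin 2) ℂ :=
  let a₁ : ℂ := ((1 / Real.sin (Real.pi ^ 2 / (2 * α)) : ℝ) : ℂ)
  let a₂ : ℂ :=
    ((Real.cos (Real.pi ^ 2 / (2 * α)) / Real.sin (Real.pi ^ 2 / (2 * α)) : ℝ) : ℂ)
  !![a₁, -Complex.I * a₂; Complex.I * a₂, a₁]

/-- The open sector `-α < θ < 0` (for `0 < α ≤ π`); the origin has argument `0` and so does not
belong to it. -/
def sector (α : ℝ) : Set ℂ := {z | -α < z.arg ∧ z.arg < 0}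

/-- The open side `θ = 0` of the sector, without the vertex. -/
def sideOut : Set ℂ := {z | ∃ t : ℝ, 0 < t ∧ z = t}

/-- The open side `θ = -α` of the sector, without the vertex. -/
def sideIn (α : ℝ) : Set ℂ := {z | ∃ t : ℝ, 0 < t ∧ z = t * Complex.exp (-(α * Complex.I))}

/-- The reflection `(ρ, θ) ↦ (ρ, -α - θ)` across the bisector `θ = -α/2`. -/
noncomputable def reflect (α : ℝ) (z : ℂ) : ℂ := Complex.exp (-(α * Complex.I)) * conj z

/-- The outgoing plane wave `e^y (h · 𝐞(x)) = e^y (h₁ e^{ix} + h₂ e^{-ix})`. -/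
noncomputable def waveOut (h : EuclideanSpace ℂ (Fin 2)) (z : ℂ) : ℂ :=
  (Real.exp z.im : ℂ) * cdot h (expVec z.re)

/-- The incoming plane wave: the reflection of the outgoing one with swapped amplitudes. -/
noncomputable def waveIn (α : ℝ) (h : EuclideanSpace ℂ (Fin 2)) (z : ℂ) : ℂ :=
  waveOut !₂[h 1, h 0] (reflect α z)

/-- Classical solutions of `ΔΦ = 0` in the sector, `∂Φ/∂n = Φ` on its two sides: harmonic inside,
continuous on the closed sector (vertex included), continuously differentiable up to the open
sides. The derivative on the sides is taken within the closed sector; the exterior unit normals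
are `i` on `θ = 0` and `-i e^{-iα}` on `θ = -α`. -/
structure IsRobinSolution (α : ℝ) (Φ : ℂ → ℂ) : Prop where
  harmonic : InnerProductSpace.HarmonicOnNhd Φ (sector α)
  continuousOn : ContinuousOn Φ (closure (sector α))
  contDiffOn : ContDiffOn ℝ 1 Φ (closure (sector α) \ {0})
  robin_out : ∀ z ∈ sideOut, fderivWithin ℝ Φ (closure (sector α)) z Complex.I = Φ z
  robin_in : ∀ z ∈ sideIn α, fderivWithin ℝ Φ (closure (sector α)) z
    (-Complex.I * Complex.exp (-(α * Complex.I))) = Φ z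

/-- The Euclidean norm of the gradient `(∂R/∂x, ∂R/∂y)` of a complex-valued function. -/
noncomputable def gradNorm (R : ℂ → ℂ) (z : ℂ) : ℝ :=
  Real.sqrt (‖fderiv ℝ R z 1‖ ^ 2 + ‖fderiv ℝ R z Complex.I‖ ^ 2)

/-- The part of `Φ` left after removing the outgoing and the incoming plane wave. -/
noncomputable def remainder (α : ℝ) (hIn hOut : EuclideanSpace ℂ (Fin 2)) (Φ : ℂ → ℂ) (z : ℂ) : ℂ :=
  Φ z - waveOut hOut z - waveIn α hIn z

/-- `|R(z)| + |z| |∇R(z)| ≤ C |z|^{-r}` for the points of the sector with `|z| ≥ ρ₀`. -/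
def RemainderBound (α : ℝ) (R : ℂ → ℂ) (r C ρ₀ : ℝ) : Prop :=
  ∀ z ∈ sector α, ρ₀ ≤ ‖z‖ → ‖R z‖ + ‖z‖ * gradNorm R z ≤ C * ‖z‖ ^ (-r)

/-! Put α = 2β and w = z e^{iβ}, so that the bisector becomes the positive axis and the sides the
rays arg w = ±β. For f holomorphic and ε = ±1, the function f(w) + ε f(conj w) is harmonic and
symmetric or antisymmetric about the bisector. The Robin condition is then needed on one ray only,
where it reads `robinDefect β ε t f = 0`.

Following Sommerfeld and Malyuzhinets, f is sought as a superposition of exponentials e^{-w e^u}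
with amplitudes A(u). On the rays these become e^{-t e^{u ± iβ}}. If (1 + i e^v) A(v - iβ) = -ε (1 -
i e^v) A(v + iβ), the defect of A(u) e^{-w e^u} is T(u - iβ) - T(u + iβ) for a single function T
(`edgeUpper_eq_edgeLower`). Taking logarithms reduces this equation to e(v + iβ) - e(v - iβ) = i gd
v, with gd' = 1/cosh, up to a linear term p (π/β) u where p = 1 - ε/4. The Fourier transform of the
hyperbolic secant turns gd, and then e, into explicit integrals (`integral_exp_div_cosh`,
`malyuzhinetsLog_add_sub`).

Such defects are controlled in two ways. Along a ladder u, u - 2iβ, u - 4iβ, … they telescope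
(`sum_edgeAmp_mul_robinDefect`), and the end terms at ±iπ/2 vanish; these belong to the exponents u
= ±i(π/2 - β) of the plane waves. Integrated over the real axis against a 2iβ-periodic weight, they
reduce by a contour shift to residues of the weight (`integral_edgeUpper_strip`). If π/(2β) is an
odd integer, one ladder joins the two waves. Otherwise one ladder descends from the upper wave and
one ends at the lower wave; they leave terms T(is) and T(-is) with |s| < β, and a Laplace integral
whose weight has its poles at ±is cancels them (`hasEdgeProfile`). Rungs strictly between the waves
decay exponentially, and the Laplace density is O(e^{-π|x|/(2β)}), whence the order ρ^{-π/α}. The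
two waves come out with amplitudes e^{∓iεσ}, σ = `edgePhase β`.

Symmetric solutions with coefficient a and antisymmetric ones with coefficient b give incoming and
outgoing amplitudes linear in (a, b) (`exists_robinSolution_family`). The determinant of (a, b) ↦
h_in is e^{2iσ} + e^{-2iσ} = 2 sin(π²/(2α)). Off the exceptional angles it is nonzero, and
eliminating (a, b) gives the transfer matrix. At an exceptional angle h_in and h_out each run
through a line, independently, and (a, b) parametrises the pairs. -/

/-! ### Residue calculus on horizontal strips. -/

open Filter Topology MeasureTheory in
/-- The symmetric integrals of `1 / (x + c)` over a horizontal line in the upper half-plane. -/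
theorem tendsto_intervalIntegral_inv_add {c : ℂ} (hc : 0 < c.im) :
    Tendsto (fun R : ℝ => ∫ x in (-R)..R, ((x : ℂ) + c)⁻¹) atTop (𝓝 (-(Real.pi * Complex.I))) := by
  have key : ∀ R : ℝ, 0 < R → ∫ x in (-R)..R, ((x : ℂ) + c)⁻¹ =
      Complex.log (-Complex.I * (1 + c / R)) - Complex.log (Complex.I * (1 - c / R)) := by
    intro R hR
    have hRc : (R : ℂ) ≠ 0 := by exact_mod_cast hR.ne'
    -- The factor -i turns the upper half-plane into the right half-plane, away from the branch cut,
    -- so the logarithm is a primitive along the whole line.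
    have hd : ∀ x ∈ Set.uIcc (-R) R,
        HasDerivAt (fun x : ℝ => Complex.log (-Complex.I * ((x : ℂ) + c))) ((x : ℂ) + c)⁻¹ x := by
      intro x _
      have hne : (x : ℂ) + c ≠ 0 := fun h => by
        have := congrArg Complex.im h; simp at this; linarith
      have h1 : HasDerivAt (fun x : ℝ => -Complex.I * ((x : ℂ) + c)) (-Complex.I * 1) x :=
        ((Complex.ofRealCLM.hasDerivAt (x := x)).add_const c).const_mul _
      have h2 := h1.clog_real (by left; simpa using hc)
      convert h2 using 1
      field_simp
    rw [intervalIntegral.integral_eq_sub_of_hasDerivAt hd]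
    · have e1 : -Complex.I * ((R : ℂ) + c) = (R : ℂ) * (-Complex.I * (1 + c / R)) := by
        field_simp
      have e2 : -Complex.I * (((-R : ℝ) : ℂ) + c) = (R : ℂ) * (Complex.I * (1 - c / R)) := by
        push_cast; field_simp; ring
      have n1 : -Complex.I * (1 + c / R) ≠ 0 := by
        intro h
        have : -Complex.I * ((R : ℂ) + c) = 0 := by rw [e1, h, mul_zero]
        have := congrArg Complex.re this; simp at this; linarith
      have n2 : Complex.I * (1 - c / R) ≠ 0 := by
        intro h
        have : -Complex.I * (((-R : ℝ) : ℂ) + c) = 0 := by rw [e2, h, mul_zero]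
        have := congrArg Complex.re this; simp at this; linarith
      rw [e1, e2, Complex.log_ofReal_mul hR n1, Complex.log_ofReal_mul hR n2]
      ring
    · apply ContinuousOn.intervalIntegrable
      refine ContinuousOn.inv₀ (by fun_prop) fun x _ h => ?_
      have := congrArg Complex.im h; simp at this; linarith
  have hcR : Tendsto (fun R : ℝ => c / (R : ℂ)) atTop (𝓝 0) := by
    have h0 : Tendsto (fun R : ℝ => ((R⁻¹ : ℝ) : ℂ)) atTop (𝓝 ((0 : ℝ) : ℂ)) :=
      (Complex.continuous_ofReal.tendsto 0).comp tendsto_inv_atTop_zero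
    simpa [div_eq_mul_inv] using h0.const_mul c
  have l1 : Tendsto (fun R : ℝ => Complex.log (-Complex.I * (1 + c / R))) atTop
      (𝓝 (Complex.log (-Complex.I))) := by
    have : Tendsto (fun R : ℝ => -Complex.I * (1 + c / R)) atTop (𝓝 (-Complex.I)) := by
      simpa using (hcR.const_add 1).const_mul (-Complex.I)
    exact (continuousAt_clog (by right; simp)).tendsto.comp this
  have l2 : Tendsto (fun R : ℝ => Complex.log (Complex.I * (1 - c / R))) atTop
      (𝓝 (Complex.log (Complex.I))) := by
    have : Tendsto (fun R : ℝ => Complex.I * (1 - c / R)) atTop (𝓝 (Complex.I)) := by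
      simpa using (hcR.const_sub 1).const_mul (Complex.I)
    exact (continuousAt_clog (by right; simp)).tendsto.comp this
  have l3 := l1.sub l2
  rw [Complex.log_neg_I, Complex.log_I] at l3
  have e : -(Real.pi / 2 : ℂ) * Complex.I - Real.pi / 2 * Complex.I = -(Real.pi * Complex.I) := by ring
  rw [e] at l3
  refine l3.congr' ?_
  filter_upwards [eventually_gt_atTop 0] with R hR using (key R hR).symm

open Filter Topology MeasureTheory in
/-- The same integrals in the lower half-plane. -/
theorem tendsto_intervalIntegral_inv_add' {c : ℂ} (hc : c.im < 0) :
    Tendsto (fun R : ℝ => ∫ x in (-R)..R, ((x : ℂ) + c)⁻¹) atTop (𝓝 (Real.pi * Complex.I)) := by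
  have h := (tendsto_intervalIntegral_inv_add (c := -c) (by simpa using hc)).neg
  rw [neg_neg] at h
  refine h.congr fun R => ?_
  rw [← intervalIntegral.integral_neg]
  have := intervalIntegral.integral_comp_neg (a := -R) (b := R)
    (fun x : ℝ => ((x : ℂ) + c)⁻¹)
  rw [neg_neg] at this
  rw [← this]
  congr 1; ext x
  rw [← inv_neg]; congr 1; push_cast; ring

open MeasureTheory in
theorem integrable_exp_neg_mul_abs {δ : ℝ} (hδ : 0 < δ) :
    Integrable fun x : ℝ => Real.exp (-δ * |x|) := by
  have h1 : IntegrableOn (fun x : ℝ => Real.exp (-δ * |x|)) (Set.Ioi 0) := by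
    refine (integrableOn_exp_mul_Ioi (a := -δ) (by linarith) 0).congr_fun ?_ measurableSet_Ioi
    intro x hx
    simp [abs_of_pos (Set.mem_Ioi.1 hx)]
  have h2 : IntegrableOn (fun x : ℝ => Real.exp (-δ * |x|)) (Set.Iic 0) := by
    refine (integrableOn_exp_mul_Iic (a := δ) hδ 0).congr_fun ?_ measurableSet_Iic
    intro x hx
    simp [abs_of_nonpos (Set.mem_Iic.1 hx)]
  rw [← integrableOn_univ, ← Set.Iic_union_Ioi (a := (0 : ℝ))]
  exact h2.union h1

open MeasureTheory in
/-- A continuous function on the line that decays exponentially is integrable. -/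
theorem Continuous.integrable_of_exp_decay {h : ℝ → ℂ} (hc : Continuous h) {C δ X : ℝ} (hδ : 0 < δ)
    (hb : ∀ x, X ≤ |x| → ‖h x‖ ≤ C * Real.exp (-δ * |x|)) : Integrable h := by
  have hi : Integrable fun x : ℝ => C * Real.exp (-δ * |x|) :=
    (integrable_exp_neg_mul_abs hδ).const_mul C
  have h1 : IntegrableOn h (Set.Icc (-X) X) := hc.continuousOn.integrableOn_compact isCompact_Icc
  have h2 : IntegrableOn h (Set.Icc (-X) X)ᶜ := by
    refine Integrable.mono' (g := fun x => C * Real.exp (-δ * |x|)) hi.integrableOn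
      hc.aestronglyMeasurable ?_
    refine (ae_restrict_iff' measurableSet_Icc.compl).2 (.of_forall fun x hx => hb x ?_)
    by_contra hlt
    exact hx (abs_le.1 (not_le.1 hlt).le)
  rw [← integrableOn_univ, ← Set.union_compl_self (Set.Icc (-X) X)]
  exact h1.union h2

open Filter Topology MeasureTheory Complex in
/-- Residue theorem for a strip with one simple pole, given as `g v / (v - v₀)`. -/
theorem integral_sub_integral_strip {a b : ℝ} {g : ℂ → ℂ} {v₀ : ℂ} (ha : a < v₀.im) (hb : v₀.im < b)
    (hg : DifferentiableOn ℂ g {v | a ≤ v.im ∧ v.im ≤ b}) {C δ X : ℝ} (hδ : 0 < δ)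
    (hdecay : ∀ x y : ℝ, a ≤ y → y ≤ b → X ≤ |x| →
      ‖g (x + y * I) / (x + y * I - v₀)‖ ≤ C * Real.exp (-δ * |x|)) :
    (∫ x : ℝ, g (x + a * I) / (x + a * I - v₀)) - (∫ x : ℝ, g (x + b * I) / (x + b * I - v₀)) =
      2 * Real.pi * I * g v₀ := by
  have hab : a ≤ b := by linarith
  set S : Set ℂ := {v | a ≤ v.im ∧ v.im ≤ b} with hS
  have hSn : S ∈ 𝓝 v₀ := by
    have h1 : {v : ℂ | a < v.im} ∈ 𝓝 v₀ := (isOpen_lt continuous_const continuous_im).mem_nhds ha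
    have h2 : {v : ℂ | v.im < b} ∈ 𝓝 v₀ := (isOpen_lt continuous_im continuous_const).mem_nhds hb
    filter_upwards [h1, h2] with v h1 h2 using ⟨le_of_lt h1, le_of_lt h2⟩
  -- The divided slope has no pole, so Cauchy's theorem applies to it on rectangles. The subtracted
  -- term g(v₀)/(v - v₀) is not absolutely integrable on a line; it enters through its symmetric
  -- integrals, πi below the pole and -πi above, whose difference is the 2πi of the residue theorem.
  have hd : DifferentiableOn ℂ (dslope g v₀) S := (differentiableOn_dslope hSn).2 hg
  have hdv : ∀ v, v ≠ v₀ → dslope g v₀ v = g v / (v - v₀) - g v₀ * (v - v₀)⁻¹ := by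
    intro v hv
    rw [dslope_of_ne _ hv, slope_def_field]
    field_simp
  have line_cont : ∀ y : ℝ, a ≤ y → y ≤ b → y ≠ v₀.im →
      Continuous fun x : ℝ => g (x + y * I) / (x + y * I - v₀) := by
    intro y hy1 hy2 hy
    have hgc : Continuous fun x : ℝ => g (x + y * I) :=
      hg.continuousOn.comp_continuous (by fun_prop) fun x => by simp [hS, hy1, hy2]
    refine hgc.div (by fun_prop) fun x h => hy ?_
    have := congrArg Complex.im h; simp at this; linarith
  have line_int : ∀ y : ℝ, a ≤ y → y ≤ b → y ≠ v₀.im →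
      Integrable fun x : ℝ => g (x + y * I) / (x + y * I - v₀) := fun y h1 h2 h3 =>
    (line_cont y h1 h2 h3).integrable_of_exp_decay hδ fun x => hdecay x y h1 h2
  have line_lim : ∀ y : ℝ, a ≤ y → y ≤ b → y ≠ v₀.im →
      Tendsto (fun R : ℝ => ∫ x in (-R)..R, g (x + y * I) / (x + y * I - v₀)) atTop
        (𝓝 (∫ x : ℝ, g (x + y * I) / (x + y * I - v₀))) := fun y h1 h2 h3 =>
    intervalIntegral_tendsto_integral (line_int y h1 h2 h3) tendsto_neg_atTop_atBot tendsto_id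
  have line_split : ∀ y : ℝ, a ≤ y → y ≤ b → y ≠ v₀.im → ∀ R : ℝ,
      ∫ x in (-R)..R, dslope g v₀ (x + y * I) =
        (∫ x in (-R)..R, g (x + y * I) / (x + y * I - v₀)) -
          g v₀ * ∫ x in (-R)..R, ((x : ℂ) + (y * I - v₀))⁻¹ := by
    intro y h1 h2 h3 R
    have hne : ∀ x : ℝ, (x : ℂ) + (y * I - v₀) ≠ 0 := fun x h => h3 (by
      have := congrArg Complex.im h; simp at this; linarith)
    rw [← intervalIntegral.integral_const_mul, ← intervalIntegral.integral_sub]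
    · congr 1; ext x
      rw [hdv _ (fun h => hne x (by rw [← h]; ring))]
      ring
    · exact (line_cont y h1 h2 h3).intervalIntegrable _ _
    · exact (Continuous.mul continuous_const
        (Continuous.inv₀ (by fun_prop) hne)).intervalIntegrable _ _
  have vert : ∀ s : ℝ, |s| = 1 →
      Tendsto (fun R : ℝ => ∫ y in a..b, dslope g v₀ ((s * R : ℝ) + y * I)) atTop (𝓝 0) := by
    intro s hs
    have hbd : ∀ᶠ R : ℝ in atTop, ‖∫ y in a..b, dslope g v₀ ((s * R : ℝ) + y * I)‖ ≤
        (C * Real.exp (-δ * R) + ‖g v₀‖ * (R - |v₀.re|)⁻¹) * |b - a| := by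
      filter_upwards [eventually_gt_atTop |v₀.re|, eventually_ge_atTop X] with R hR hRX
      have hR0 : 0 < R := (abs_nonneg _).trans_lt hR
      have habs : |s * R| = R := by rw [abs_mul, hs, one_mul, abs_of_pos hR0]
      refine intervalIntegral.norm_integral_le_of_norm_le_const fun y hy => ?_
      rw [Set.uIoc_of_le hab] at hy
      have hlow : R - |v₀.re| ≤ ‖((s * R : ℝ) : ℂ) + y * I - v₀‖ := by
        refine le_trans ?_ (abs_re_le_norm _)
        have : (((s * R : ℝ) : ℂ) + y * I - v₀).re = s * R - v₀.re := by simp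
        rw [this]
        calc R - |v₀.re| = |s * R| - |v₀.re| := by rw [habs]
          _ ≤ _ := abs_sub_abs_le_abs_sub _ _
      have hpos : 0 < R - |v₀.re| := by linarith
      have hne : ((s * R : ℝ) : ℂ) + y * I ≠ v₀ := fun h => by
        rw [h, sub_self, norm_zero] at hlow; linarith
      rw [hdv _ hne]
      refine (norm_sub_le _ _).trans (add_le_add ?_ ?_)
      · have := hdecay (s * R) y hy.1.le hy.2 (by rw [habs]; exact hRX)
        rwa [habs] at this
      · rw [norm_mul, norm_inv]
        gcongr
    have hlim : Tendsto (fun R : ℝ => (C * Real.exp (-δ * R) + ‖g v₀‖ * (R - |v₀.re|)⁻¹) * |b - a|)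
        atTop (𝓝 ((C * 0 + ‖g v₀‖ * 0) * |b - a|)) := by
      refine ((Tendsto.const_mul _ ?_).add (Tendsto.const_mul _ ?_)).mul_const _
      · exact Real.tendsto_exp_atBot.comp (tendsto_id.const_mul_atTop_of_neg (by linarith))
      · exact tendsto_inv_atTop_zero.comp (tendsto_atTop_add_const_right _ _ tendsto_id)
    exact squeeze_zero_norm' hbd (by simpa using hlim)
  have rect : ∀ R : ℝ, (∫ x in (-R)..R, dslope g v₀ (x + a * I)) -
      (∫ x in (-R)..R, dslope g v₀ (x + b * I)) +
      I • (∫ y in a..b, dslope g v₀ ((1 * R : ℝ) + y * I)) -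
      I • (∫ y in a..b, dslope g v₀ ((-1 * R : ℝ) + y * I)) = 0 := by
    intro R
    have := integral_boundary_rect_eq_zero_of_differentiableOn (dslope g v₀)
      (⟨-R, a⟩ : ℂ) (⟨R, b⟩ : ℂ) (hd.mono fun v hv => by
        have := hv.2
        simp only [Set.mem_preimage, Set.uIcc_of_le hab] at this
        exact this)
    simpa using this
  have lim_a := tendsto_intervalIntegral_inv_add' (c := a * I - v₀) (by simpa using ha)
  have lim_b := tendsto_intervalIntegral_inv_add (c := b * I - v₀) (by simpa using hb)
  have total := ((((line_lim a le_rfl hab ha.ne).sub (lim_a.const_mul (g v₀))).sub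
    ((line_lim b hab le_rfl hb.ne').sub (lim_b.const_mul (g v₀)))).add
    ((vert 1 (by simp)).const_smul I)).sub ((vert (-1) (by simp)).const_smul I)
  have hz := tendsto_nhds_unique total (tendsto_const_nhds.congr fun R => by
    rw [← line_split a le_rfl hab ha.ne R, ← line_split b hab le_rfl hb.ne' R, rect R])
  simp only [smul_zero, add_zero, sub_zero] at hz
  linear_combination hz

open Filter Topology MeasureTheory Complex in
/-- Residue theorem for a strip with one simple pole, for a quotient. -/
theorem integral_div_sub_integral_div_strip {a b : ℝ} {M D : ℂ → ℂ} {v₀ : ℂ} (ha : a < v₀.im)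
    (hb : v₀.im < b) (hM : DifferentiableOn ℂ M {v | a ≤ v.im ∧ v.im ≤ b})
    (hD : Differentiable ℂ D) (hD0 : D v₀ = 0) (hD' : deriv D v₀ ≠ 0)
    (hDne : ∀ v : ℂ, a ≤ v.im → v.im ≤ b → D v = 0 → v = v₀) {C δ X : ℝ} (hδ : 0 < δ)
    (hdecay : ∀ x y : ℝ, a ≤ y → y ≤ b → X ≤ |x| →
      ‖M (x + y * I) / D (x + y * I)‖ ≤ C * Real.exp (-δ * |x|)) :
    (∫ x : ℝ, M (x + a * I) / D (x + a * I)) - (∫ x : ℝ, M (x + b * I) / D (x + b * I)) =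
      2 * Real.pi * I * (M v₀ / deriv D v₀) := by
  -- Since D v = `dslope D v₀ v` · (v - v₀) and the first factor has no zero in the strip, M/D is
  -- g/(v - v₀) with g holomorphic.
  have hdD : Differentiable ℂ (dslope D v₀) := by
    rw [← differentiableOn_univ] at hD ⊢
    exact (differentiableOn_dslope univ_mem).2 hD
  have hval : ∀ v, dslope D v₀ v * (v - v₀) = D v := fun v => by
    have := sub_smul_dslope D v₀ v
    rw [hD0, sub_zero, smul_eq_mul] at this
    rw [← this, mul_comm]
  have hne : ∀ v : ℂ, a ≤ v.im → v.im ≤ b → dslope D v₀ v ≠ 0 := by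
    intro v h1 h2 h
    have hv : v = v₀ := hDne v h1 h2 (by rw [← hval, h, zero_mul])
    rw [hv, dslope_same] at h
    exact hD' h
  have heq : ∀ v : ℂ, M v / dslope D v₀ v / (v - v₀) = M v / D v := fun v => by
    rw [div_div, hval]
  have := integral_sub_integral_strip (g := fun v => M v / dslope D v₀ v) ha hb
    (hM.div hdD.differentiableOn fun v hv => hne v hv.1 hv.2) (C := C) hδ (X := X)
    (fun x y h1 h2 h3 => by rw [heq]; exact hdecay x y h1 h2 h3)
  simpa only [heq, dslope_same] using this

/-! ### The Fourier transform of the hyperbolic secant. -/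

namespace Complex

theorem quarter_exp_abs_le_norm_cosh {v : ℂ} (hv : 1 ≤ |v.re|) :
    Real.exp |v.re| / 4 ≤ ‖cosh v‖ := by
  have h1 : Real.exp |v.re| - Real.exp (-|v.re|) ≤ ‖exp v + exp (-v)‖ := by
    rcases le_total 0 v.re with h | h
    · calc Real.exp |v.re| - Real.exp (-|v.re|) = ‖exp v‖ - ‖exp (-v)‖ := by
            rw [norm_exp, norm_exp, abs_of_nonneg h, neg_re]
        _ ≤ _ := norm_sub_le_norm_add _ _
    · calc Real.exp |v.re| - Real.exp (-|v.re|) = ‖exp (-v)‖ - ‖exp v‖ := by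
            rw [norm_exp, norm_exp, abs_of_nonpos h, neg_re, neg_neg]
        _ ≤ ‖exp (-v) + exp v‖ := norm_sub_le_norm_add _ _
        _ = _ := by rw [add_comm]
  have h2 : Real.exp (-|v.re|) ≤ Real.exp |v.re| / 2 := by
    have e1 : Real.exp |v.re| = Real.exp (-|v.re|) * Real.exp (2 * |v.re|) := by
      rw [← Real.exp_add]; ring_nf
    have e2 : 2 ≤ Real.exp (2 * |v.re|) := by
      have := Real.add_one_le_exp (2 * |v.re|); linarith
    rw [e1]
    nlinarith [Real.exp_pos (-|v.re|)]
  have h3 : ‖cosh v‖ = ‖exp v + exp (-v)‖ / 2 := by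
    rw [cosh, norm_div]; simp
  rw [h3]; linarith

theorem norm_exp_I_mul_mul_le (u : ℂ) (x y : ℝ) :
    ‖exp (I * u * (x + y * I))‖ ≤ Real.exp (|u.re| * |y|) * Real.exp (|u.im| * |x|) := by
  rw [norm_exp, ← Real.exp_add, Real.exp_le_exp]
  have : (I * u * (x + y * I)).re = -(u.re * y) - u.im * x := by simp; ring
  rw [this, ← abs_mul, ← abs_mul]
  linarith [neg_abs_le (u.re * y), neg_abs_le (u.im * x)]

theorem cosh_ne_zero_of_abs_im_lt {u : ℂ} (hu : |u.im| < Real.pi / 2) : cosh u ≠ 0 := by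
  intro h
  have h1 : (cosh u).re = 0 := by rw [h]; rfl
  have h2 : (cosh u).re = Real.cosh u.re * Real.cos u.im := by
    conv_lhs => rw [← re_add_im u, cosh_add, cosh_mul_I, sinh_mul_I]
    rw [← ofReal_cosh, ← ofReal_sinh, ← ofReal_cos, ← ofReal_sin]
    simp [cos_ofReal_re]
  have h3 := Real.cos_pos_of_mem_Ioo (abs_lt.1 hu)
  rw [h2] at h1
  exact (mul_pos (Real.cosh_pos _) h3).ne' h1

end Complex

open Filter Topology MeasureTheory Complex in
theorem integrable_exp_div_cosh {u : ℂ} (hu : |u.im| < Real.pi / 2) :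
    Integrable fun x : ℝ => exp (I * u * x) / cosh (Real.pi / 2 * x) := by
  have hc : Continuous fun x : ℝ => exp (I * u * x) / cosh (Real.pi / 2 * x) := by
    refine Continuous.div (by fun_prop) (by fun_prop) fun x => cosh_ne_zero_of_abs_im_lt ?_
    have : ((Real.pi : ℂ) / 2 * x).im = 0 := by
      rw [show (Real.pi : ℂ) / 2 * x = ((Real.pi / 2 * x : ℝ) : ℂ) by push_cast; ring]; simp
    rw [this]; simp [Real.pi_pos]
  refine hc.integrable_of_exp_decay (C := 4) (X := 1) (δ := Real.pi / 2 - |u.im|) (by linarith) ?_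
  intro x hx
  have h1 := norm_exp_I_mul_mul_le u x 0
  simp only [ofReal_zero, zero_mul, add_zero, abs_zero, mul_zero, Real.exp_zero, one_mul] at h1
  have hre : ((Real.pi : ℂ) / 2 * x).re = Real.pi / 2 * x := by
    rw [show (Real.pi : ℂ) / 2 * x = ((Real.pi / 2 * x : ℝ) : ℂ) by push_cast; ring]; simp
  have habs : |Real.pi / 2 * x| = Real.pi / 2 * |x| := by
    rw [abs_mul, abs_of_pos (by positivity)]
  have h2 := quarter_exp_abs_le_norm_cosh (v := (Real.pi : ℂ) / 2 * x) (by
    rw [hre, habs]; nlinarith [Real.pi_gt_three])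
  rw [hre, habs] at h2
  rw [norm_div, div_le_iff₀ ((by positivity : (0:ℝ) < _).trans_le h2)]
  calc _ ≤ Real.exp (|u.im| * |x|) := h1
    _ = 4 * Real.exp (-(Real.pi / 2 - |u.im|) * |x|) * (Real.exp (Real.pi / 2 * |x|) / 4) := by
      rw [mul_comm 4, mul_assoc, mul_div_cancel₀ _ (by norm_num : (4:ℝ) ≠ 0), ← Real.exp_add]; ring_nf
    _ ≤ _ := by gcongr

open Filter Topology MeasureTheory Complex in
/-- The Fourier transform of the hyperbolic secant, at complex frequencies. -/
theorem integral_exp_div_cosh {u : ℂ} (hu : |u.im| < Real.pi / 2) :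
    ∫ x : ℝ, exp (I * u * x) / cosh (Real.pi / 2 * x) = 2 / cosh u := by
  set D : ℂ → ℂ := fun v => cosh (Real.pi / 2 * v) with hDdef
  have hpi : (Real.pi : ℂ) ≠ 0 := by exact_mod_cast Real.pi_ne_zero
  have hDd : ∀ v, HasDerivAt D (sinh (Real.pi / 2 * v) * (Real.pi / 2)) v := fun v => by
    have := ((hasDerivAt_id v).const_mul ((Real.pi : ℂ) / 2)).ccosh
    simpa [hDdef] using this
  have hreim : ∀ v : ℂ, ((Real.pi : ℂ) / 2 * v).re = Real.pi / 2 * v.re ∧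
      ((Real.pi : ℂ) / 2 * v).im = Real.pi / 2 * v.im := by
    intro v
    rw [show (Real.pi : ℂ) / 2 * v = ((Real.pi / 2 : ℝ) : ℂ) * v by push_cast; ring]
    constructor
    · rw [re_ofReal_mul]
    · rw [im_ofReal_mul]
  have hsinh : sinh (Real.pi / 2 * I) = I := by rw [sinh_mul_I]; simp [sin_pi_div_two]
  have hstrip := integral_div_sub_integral_div_strip (a := 0) (b := 2) (v₀ := I)
    (M := fun v => exp (I * u * v)) (D := D) (by simp) (by norm_num)
    (by fun_prop) (fun v => (hDd v).differentiableAt)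
    (by simp only [hDdef]; rw [cosh_mul_I]; exact cos_pi_div_two)
    (by rw [(hDd I).deriv, hsinh]; simp [hpi])
    (by
      intro v h1 h2 h
      -- The zeros of cosh(πv/2) are the odd multiples of i, and i is the only one with 0 ≤ Im v ≤
      -- 2.
      have hcos : cos (Real.pi / 2 * v * I) = 0 := by rw [cos_mul_I]; exact h
      obtain ⟨k, hk⟩ := cos_eq_zero_iff.1 hcos
      have e : v * I = 2 * k + 1 := by
        have : (Real.pi : ℂ) / 2 * (v * I) = Real.pi / 2 * (2 * k + 1) := by
          rw [← mul_assoc, hk]; ring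
        exact mul_left_cancel₀ (by simp [hpi]) this
      have e2 : v = -(2 * k + 1) * I := by
        linear_combination (-I) * e + v * I_sq
      have him : v.im = -(2 * k + 1) := by rw [e2]; simp
      rw [him] at h1 h2
      have k1 : (k : ℝ) < 0 := by linarith
      have k2 : (-2 : ℝ) < k := by linarith
      have : k = -1 := by
        have h1' : k < 0 := by exact_mod_cast k1
        have h2' : -2 < k := by exact_mod_cast k2
        omega
      rw [e2, this]; push_cast; ring)
    (C := 4 * Real.exp (|u.re| * 2)) (δ := Real.pi / 2 - |u.im|) (X := 1) (by linarith)
    (by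
      intro x y h1 h2 hx
      have hre := (hreim (x + y * I)).1
      have hre' : ((x : ℂ) + y * I).re = x := by simp
      rw [hre'] at hre
      have habs : |Real.pi / 2 * x| = Real.pi / 2 * |x| := by
        rw [abs_mul, abs_of_pos (by positivity)]
      have h3 := quarter_exp_abs_le_norm_cosh (v := (Real.pi : ℂ) / 2 * (x + y * I)) (by
        rw [hre, habs]; nlinarith [Real.pi_gt_three])
      rw [hre, habs] at h3
      rw [norm_div, div_le_iff₀ ((by positivity : (0:ℝ) < _).trans_le h3)]
      calc _ ≤ Real.exp (|u.re| * |y|) * Real.exp (|u.im| * |x|) := norm_exp_I_mul_mul_le u x y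
        _ ≤ Real.exp (|u.re| * 2) * Real.exp (|u.im| * |x|) := by
          gcongr; rw [abs_of_nonneg h1]; exact h2
        _ = 4 * Real.exp (|u.re| * 2) * Real.exp (-(Real.pi / 2 - |u.im|) * |x|) *
            (Real.exp (Real.pi / 2 * |x|) / 4) := by
          have : Real.exp (|u.im| * |x|) =
              Real.exp (-(Real.pi / 2 - |u.im|) * |x|) * Real.exp (Real.pi / 2 * |x|) := by
            rw [← Real.exp_add]; ring_nf
          rw [this]; ring
        _ ≤ _ := by gcongr)
  -- On the line Im v = 2 the integrand is -e^{-2u} times its value on the real axis, so the residue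
  -- at i determines the integral J: (1 + e^{-2u}) J = 4 e^{-u}.
  have hshift : ∀ x : ℝ, exp (I * u * (x + (2 : ℝ) * I)) / D (x + (2 : ℝ) * I) =
      -exp (-2 * u) * (exp (I * u * x) / cosh (Real.pi / 2 * x)) := by
    intro x
    have e1 : D (x + (2 : ℝ) * I) = -cosh (Real.pi / 2 * x) := by
      simp only [hDdef]
      rw [show (Real.pi : ℂ) / 2 * (x + (2 : ℝ) * I) = Real.pi / 2 * x + Real.pi * I by
        push_cast; ring, cosh_add, cosh_mul_I, sinh_mul_I]
      simp
    have e2 : exp (I * u * (x + (2 : ℝ) * I)) = exp (-2 * u) * exp (I * u * x) := by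
      rw [← exp_add]; congr 1; push_cast; linear_combination (2 * u) * I_sq
    rw [e1, e2]; ring
  simp only [hshift] at hstrip
  rw [integral_const_mul, (hDd I).deriv, hsinh] at hstrip
  have hz : ∀ x : ℝ, exp (I * u * (x + (0 : ℝ) * I)) / D (x + (0 : ℝ) * I) =
      exp (I * u * x) / cosh (Real.pi / 2 * x) := fun x => by simp [hDdef]
  simp only [hz] at hstrip
  have hcosh : cosh u ≠ 0 := cosh_ne_zero_of_abs_im_lt hu
  have hexp : exp (I * u * I) = exp (-u) := by congr 1; linear_combination u * I_sq
  rw [hexp] at hstrip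
  have h2c : 2 * cosh u = exp u + exp (-u) := by rw [cosh]; ring
  have hprod : exp u * exp (-u) = 1 := by rw [← exp_add]; simp
  have hsq : exp (-2 * u) = exp (-u) * exp (-u) := by rw [← exp_add]; ring_nf
  rw [eq_div_iff hcosh]
  have h4 : 2 * Real.pi * I * (exp (-u) / (I * (Real.pi / 2))) = 4 * exp (-u) := by
    field_simp [I_ne_zero]; norm_num
  rw [h4, hsq] at hstrip
  set J := ∫ x : ℝ, exp (I * u * x) / cosh (Real.pi / 2 * x)
  have : exp u * (J - -(exp (-u) * exp (-u)) * J) = exp u * (4 * exp (-u)) := by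
    rw [← hstrip]
  linear_combination (1/2) * this + (1/2) * J * h2c - (1/2) * (J * exp (-u)) * hprod + 2 * hprod

open Filter Topology MeasureTheory Complex in
theorem integrable_cos_div_cosh {u : ℂ} (hu : |u.im| < Real.pi / 2) :
    Integrable fun x : ℝ => cos (u * x) / cosh (Real.pi / 2 * x) := by
  have h1 := integrable_exp_div_cosh hu
  have h2 := integrable_exp_div_cosh (u := -u) (by simpa using hu)
  refine ((h1.add h2).const_mul (1 / 2)).congr (.of_forall fun x => ?_)
  simp only [Pi.add_apply, cos]
  rw [show I * u * x = u * x * I by ring, show I * -u * x = -(u * x) * I by ring]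
  ring

open Filter Topology MeasureTheory Complex in
theorem integral_Ioi_cos_div_cosh {u : ℂ} (hu : |u.im| < Real.pi / 2) :
    ∫ x : ℝ in Set.Ioi 0, cos (u * x) / cosh (Real.pi / 2 * x) = 1 / cosh u := by
  have h1 := integrable_exp_div_cosh hu
  have h2 := integrable_exp_div_cosh (u := -u) (by simpa using hu)
  have e1 := integral_exp_div_cosh hu
  have e2 := integral_exp_div_cosh (u := -u) (by simpa using hu)
  have h3 : ∫ x : ℝ, cos (u * x) / cosh (Real.pi / 2 * x) = 2 / cosh u := by
    have : ∀ x : ℝ, cos (u * x) / cosh (Real.pi / 2 * x) =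
        (1 / 2) * (exp (I * u * x) / cosh (Real.pi / 2 * x) +
          exp (I * -u * x) / cosh (Real.pi / 2 * x)) := fun x => by
      rw [cos, show I * u * x = u * x * I by ring, show I * -u * x = -(u * x) * I by ring]
      ring
    simp only [this]
    rw [integral_const_mul, integral_add h1 h2, e1, e2, cosh_neg]
    ring
  have h4 := integrable_cos_div_cosh hu
  have h5 := integral_add_compl (μ := volume) (s := Set.Ioi (0:ℝ)) measurableSet_Ioi h4
  rw [Set.compl_Ioi] at h5
  have h6 := integral_comp_neg_Ioi (0 : ℝ) (fun x : ℝ => cos (u * x) / cosh (Real.pi / 2 * x))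
  simp only [ofReal_neg, mul_neg, cos_neg, cosh_neg, neg_zero] at h6
  rw [← h6, h3] at h5
  linear_combination (1/2) * h5

/-! ### The complex Gudermannian and its primitive as parameter integrals. -/

open Filter Topology MeasureTheory in
/-- Differentiation under the integral sign on an open convex set containing `0`, for integrands
that vanish at `0`. -/
theorem integrable_and_hasDerivAt_integral_of_convex {S : Set ℂ} (hSo : IsOpen S)
    (hSc : Convex ℝ S) (h0 : 0 ∈ S) {F F' : ℂ → ℝ → ℂ} {μ : Measure ℝ} {b : ℝ → ℝ}
    (hb : Integrable b μ) (hFm : ∀ u, AEStronglyMeasurable (F u) μ)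
    (hF'm : ∀ u, AEStronglyMeasurable (F' u) μ) (hF0 : ∀ τ, F 0 τ = 0)
    (hder : ∀ᵐ τ ∂μ, ∀ u ∈ S, HasDerivAt (F · τ) (F' u τ) u)
    (hbd : ∀ᵐ τ ∂μ, ∀ u ∈ S, ‖F' u τ‖ ≤ b τ) {u : ℂ} (hu : u ∈ S) :
    Integrable (F u) μ ∧ HasDerivAt (fun v => ∫ τ, F v τ ∂μ) (∫ τ, F' u τ ∂μ) u := by
  have hint : Integrable (F u) μ := by
    refine (hb.mul_const ‖u‖).mono' (hFm u) ?_
    filter_upwards [hder, hbd] with τ h1 h2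
    -- The mean value inequality on the segment from 0, where F vanishes, gives ‖F u τ‖ ≤ b τ ‖u‖;
    -- integrability of F thus comes from the bound on its derivative.
    have := hSc.norm_image_sub_le_of_norm_hasDerivWithin_le
      (fun v hv => (h1 v hv).hasDerivWithinAt) h2 h0 hu
    simpa [hF0] using this
  exact ⟨hint, (hasDerivAt_integral_of_dominated_loc_of_deriv_le (hSo.mem_nhds hu)
    (.of_forall hFm) hint (hF'm u) hbd hb hder).2⟩

/-- The horizontal strip `|Im u| < y`. -/
def hstrip (y : ℝ) : Set ℂ := {u | |u.im| < y}

theorem isOpen_hstrip (y : ℝ) : IsOpen (hstrip y) :=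
  isOpen_lt (continuous_abs.comp Complex.continuous_im) continuous_const

theorem convex_hstrip (y : ℝ) : Convex ℝ (hstrip y) := by
  have : hstrip y = Complex.imLm ⁻¹' (Set.Ioo (-y) y) := by
    ext u; simp [hstrip, abs_lt]
  rw [this]
  exact (convex_Ioo _ _).linear_preimage _

theorem zero_mem_hstrip {y : ℝ} (hy : 0 < y) : (0 : ℂ) ∈ hstrip y := by simpa [hstrip] using hy

namespace Complex

theorem norm_cos_le (z : ℂ) : ‖cos z‖ ≤ Real.exp |z.im| := by
  have h1 : ‖exp (z * I)‖ ≤ Real.exp |z.im| := by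
    rw [norm_exp, Real.exp_le_exp]; simpa using neg_le_abs z.im
  have h2 : ‖exp (-z * I)‖ ≤ Real.exp |z.im| := by
    rw [norm_exp, Real.exp_le_exp]; simpa using le_abs_self z.im
  rw [cos, norm_div]
  have := norm_add_le (exp (z * I)) (exp (-z * I))
  simp only [norm_ofNat]
  linarith

/-- The factor ‖z‖ is kept because it compensates the singularity at τ = 0 of the weights
multiplying sin(uτ). -/
theorem norm_sin_le (z : ℂ) : ‖sin z‖ ≤ Real.exp |z.im| * ‖z‖ := by
  have hc : Convex ℝ {w : ℂ | |w.im| ≤ |z.im|} := by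
    have : {w : ℂ | |w.im| ≤ |z.im|} = imLm ⁻¹' (Set.Icc (-|z.im|) |z.im|) := by
      ext u; simp [abs_le]
    rw [this]
    exact (convex_Icc _ _).linear_preimage _
  have := hc.norm_image_sub_le_of_norm_hasDerivWithin_le (f := sin) (f' := cos) (x := 0) (y := z)
    (C := Real.exp |z.im|)
    (fun w _ => (hasDerivAt_sin w).hasDerivWithinAt)
    (fun w hw => (norm_cos_le w).trans (Real.exp_le_exp.2 hw))
    (show |(0 : ℂ).im| ≤ |z.im| by simp) (show |z.im| ≤ |z.im| from le_rfl)
  simpa using this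

end Complex

/-- The weight `1 / cosh(π τ / 2)`. -/
noncomputable def sechWeight (τ : ℝ) : ℝ := 1 / Real.cosh (Real.pi / 2 * τ)

theorem sechWeight_pos (τ : ℝ) : 0 < sechWeight τ := one_div_pos.2 (Real.cosh_pos _)

theorem continuous_sechWeight : Continuous sechWeight :=
  continuous_const.div (by fun_prop) fun _ => (Real.cosh_pos _).ne'

theorem sechWeight_le (τ : ℝ) : sechWeight τ ≤ 2 * Real.exp (-(Real.pi / 2) * τ) := by
  rw [sechWeight, div_le_iff₀ (Real.cosh_pos _), Real.cosh_eq]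
  have : Real.exp (-(Real.pi / 2) * τ) * Real.exp (Real.pi / 2 * τ) = 1 := by
    rw [← Real.exp_add]; simp
  nlinarith [Real.exp_pos (-(Real.pi / 2 * τ)), Real.exp_pos (-(Real.pi / 2) * τ)]

open MeasureTheory in
/-- The complex Gudermannian, `gd' = 1 / cosh`, as a sine transform. -/
noncomputable def gdTransform (v : ℂ) : ℂ :=
  ∫ τ : ℝ in Set.Ioi 0, Complex.sin (v * τ) / τ * sechWeight τ

open MeasureTheory in
/-- The primitive of the Gudermannian that vanishes at `0`. -/
noncomputable def gdPrimitive (v : ℂ) : ℂ :=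
  ∫ τ : ℝ in Set.Ioi 0, (1 - Complex.cos (v * τ)) / τ ^ 2 * sechWeight τ

open MeasureTheory in
theorem aestronglyMeasurable_restrict_Ioi {F : ℝ → ℂ} (hF : ContinuousOn F (Set.Ioi 0)) :
    AEStronglyMeasurable F (volume.restrict (Set.Ioi 0)) :=
  hF.aestronglyMeasurable measurableSet_Ioi

theorem ofReal_ne_zero_of_mem_Ioi {τ : ℝ} (hτ : τ ∈ Set.Ioi (0 : ℝ)) : (τ : ℂ) ≠ 0 := by
  exact_mod_cast (Set.mem_Ioi.1 hτ).ne'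

open MeasureTheory in
theorem gdTransform_aux {y : ℝ} (hy0 : 0 < y) (hy : y < Real.pi / 2) {v : ℂ} (hv : v ∈ hstrip y) :
    IntegrableOn (fun τ : ℝ => Complex.sin (v * τ) / τ * sechWeight τ) (Set.Ioi 0) ∧
    HasDerivAt gdTransform (∫ τ : ℝ in Set.Ioi 0, Complex.cos (v * τ) * sechWeight τ) v := by
  have hs := continuous_sechWeight
  refine integrable_and_hasDerivAt_integral_of_convex (isOpen_hstrip y) (convex_hstrip y)
    (zero_mem_hstrip hy0) (μ := volume.restrict (Set.Ioi 0))
    (F := fun v τ => Complex.sin (v * τ) / τ * sechWeight τ)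
    (F' := fun v τ => Complex.cos (v * τ) * sechWeight τ)
    (b := fun τ => 2 * Real.exp ((y - Real.pi / 2) * τ))
    ((integrableOn_exp_mul_Ioi (by linarith) 0).const_mul 2)
    (fun v => aestronglyMeasurable_restrict_Ioi ?_) (fun v => aestronglyMeasurable_restrict_Ioi ?_)
    (by simp) ?_ ?_ hv
  · exact (ContinuousOn.div (by fun_prop) (by fun_prop)
      fun τ hτ => ofReal_ne_zero_of_mem_Ioi hτ).mul (by fun_prop)
  · fun_prop
  · refine (ae_restrict_iff' measurableSet_Ioi).2 (.of_forall fun τ hτ u _ => ?_)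
    have hτ0 := ofReal_ne_zero_of_mem_Ioi hτ
    have h1 := (((hasDerivAt_id u).mul_const (τ : ℂ)).csin.div_const (τ : ℂ)).mul_const
      (sechWeight τ : ℂ)
    convert! h1 using 1
    simp [hτ0]
  · refine (ae_restrict_iff' measurableSet_Ioi).2 (.of_forall fun τ hτ u hu => ?_)
    have hτ0 : 0 < τ := hτ
    rw [norm_mul, Complex.norm_real, Real.norm_of_nonneg (sechWeight_pos τ).le]
    have h1 : ‖Complex.cos (u * τ)‖ ≤ Real.exp (y * τ) := by
      refine (Complex.norm_cos_le _).trans (Real.exp_le_exp.2 ?_)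
      rw [Complex.im_mul_ofReal, abs_mul, abs_of_pos hτ0]
      exact mul_le_mul_of_nonneg_right (le_of_lt hu) hτ0.le
    calc _ ≤ Real.exp (y * τ) * (2 * Real.exp (-(Real.pi / 2) * τ)) := by
          gcongr
          · exact (sechWeight_pos τ).le
          · exact sechWeight_le τ
      _ = _ := by rw [mul_left_comm, ← Real.exp_add]; ring_nf

theorem exists_between_abs_im {v : ℂ} {y : ℝ} (hv : |v.im| < y) :
    ∃ y', 0 < y' ∧ y' < y ∧ v ∈ hstrip y' :=
  ⟨(|v.im| + y) / 2, by linarith [abs_nonneg v.im], by linarith, by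
    change |v.im| < _; linarith⟩

theorem hasDerivAt_gdTransform {v : ℂ} (hv : |v.im| < Real.pi / 2) :
    HasDerivAt gdTransform (1 / Complex.cosh v) v := by
  obtain ⟨y, h0, h1, h2⟩ := exists_between_abs_im hv
  convert (gdTransform_aux h0 h1 h2).2 using 1
  rw [← integral_Ioi_cos_div_cosh hv]
  simp [sechWeight, div_eq_mul_inv]

theorem gdTransform_zero : gdTransform 0 = 0 := by simp [gdTransform]

open Complex in
theorem one_add_I_exp_mul (v : ℂ) : (1 + I * exp v) * (1 - I * exp v) = 2 * exp v * cosh v := by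
  have : exp v * exp (-v) = 1 := by rw [← exp_add]; simp
  rw [cosh]
  linear_combination (-(exp v)^2) * I_sq - this

open Complex in
theorem one_add_I_exp_ne_zero {v : ℂ} (hv : |v.im| < Real.pi / 2) :
    1 + I * exp v ≠ 0 ∧ 1 - I * exp v ≠ 0 := by
  have : (1 + I * exp v) * (1 - I * exp v) ≠ 0 := by
    rw [one_add_I_exp_mul]
    exact mul_ne_zero (mul_ne_zero two_ne_zero (exp_ne_zero v)) (cosh_ne_zero_of_abs_im_lt hv)
  exact ⟨left_ne_zero_of_mul this, right_ne_zero_of_mul this⟩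

open Complex in
/-- The exponential of the Gudermannian. -/
theorem exp_I_mul_gdTransform {v : ℂ} (hv : |v.im| < Real.pi / 2) :
    exp (I * gdTransform v) * (1 - I * exp v) = -I * (1 + I * exp v) := by
  -- The derivative of Q vanishes because gd' = 1/cosh and (1 + i e^v)(1 - i e^v) = 2 e^v cosh v.
  -- The constant is Q(0) = (1 - i)/(1 + i) = -i.
  set Q : ℂ → ℂ := fun v => exp (I * gdTransform v) * ((1 - I * exp v) / (1 + I * exp v)) with hQ
  have hd : ∀ u ∈ hstrip (Real.pi / 2), HasDerivAt Q 0 u := by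
    intro u hu
    obtain ⟨n1, n2⟩ := one_add_I_exp_ne_zero hu
    have hc := cosh_ne_zero_of_abs_im_lt hu
    have h1 := ((hasDerivAt_gdTransform hu).const_mul I).cexp
    have h2 := (((Complex.hasDerivAt_exp u).const_mul I).const_sub 1).div
      (((Complex.hasDerivAt_exp u).const_mul I).const_add 1) n1
    convert! h1.mul h2 using 1
    have h3 := one_add_I_exp_mul u
    simp only [Pi.div_apply]
    field_simp
    linear_combination (-(exp (I * gdTransform u)) * I) * h3
  have hconst := (isOpen_hstrip (Real.pi / 2)).is_const_of_deriv_eq_zero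
    (convex_hstrip _).isPreconnected
    (fun u hu => (hd u hu).differentiableAt.differentiableWithinAt)
    (fun u hu => (hd u hu).deriv) hv (zero_mem_hstrip (by positivity))
  obtain ⟨n1, n2⟩ := one_add_I_exp_ne_zero hv
  have hI : (1 : ℂ) + I ≠ 0 := fun h => by
    have := congrArg Complex.re h; simp at this
  simp only [hQ, gdTransform_zero, mul_zero, exp_zero, mul_one, one_mul] at hconst
  rw [← mul_div_assoc, div_eq_div_iff n1 hI] at hconst
  refine mul_right_cancel₀ hI ?_
  rw [hconst]
  linear_combination (1 + I * exp v) * I_sq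

/-- On the real axis gd x = 2 arctan(e^x) - π/2, which lies between -π/2 and π/2. -/
theorem abs_re_gdTransform_le (x : ℝ) : |(gdTransform x).re| ≤ Real.pi / 2 := by
  have hd : ∀ x : ℝ, HasDerivAt (fun x : ℝ => (gdTransform x).re - 2 * Real.arctan (Real.exp x)) 0 x := by
    intro x
    have h1 := (hasDerivAt_gdTransform (v := x) (by simp [Real.pi_pos])).real_of_complex
    have h2 := ((Real.hasDerivAt_exp x).arctan).const_mul 2
    convert! h1.sub h2 using 1
    rw [← Complex.ofReal_cosh, ← Complex.ofReal_one, ← Complex.ofReal_div, Complex.ofReal_re,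
      Real.cosh_eq]
    have : Real.exp x * Real.exp (-x) = 1 := by rw [← Real.exp_add]; simp
    have hx := Real.exp_pos x
    have hx' := Real.exp_pos (-x)
    field_simp
    linear_combination 2 * this
  have := is_const_of_deriv_eq_zero (fun x => (hd x).differentiableAt) (fun x => (hd x).deriv) x 0
  simp only [Complex.ofReal_zero, gdTransform_zero, Complex.zero_re, Real.exp_zero,
    Real.arctan_one] at this
  rw [abs_le]
  constructor
  · have := Real.arctan_pos.2 (Real.exp_pos x); linarith
  · have := Real.arctan_lt_pi_div_two (Real.exp x); linarith

open MeasureTheory in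
theorem gdPrimitive_aux (x : ℝ) :
    IntegrableOn (fun τ : ℝ => (1 - Complex.cos (x * τ)) / (τ : ℂ) ^ 2 * sechWeight τ) (Set.Ioi 0) ∧
    HasDerivAt gdPrimitive (gdTransform x) x := by
  have hs := continuous_sechWeight
  have hpi := Real.pi_gt_three
  -- A strip of half-width 1 < π/2 suffices around the real axis. The ball bounds the factor ‖u‖ in
  -- the estimate of sin(uτ).
  refine integrable_and_hasDerivAt_integral_of_convex
    ((isOpen_hstrip 1).inter (Metric.isOpen_ball (x := (0 : ℂ)) (ε := |x| + 1)))
    ((convex_hstrip 1).inter (convex_ball _ _))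
    ⟨zero_mem_hstrip one_pos, Metric.mem_ball_self (by positivity)⟩ (μ := volume.restrict (Set.Ioi 0))
    (F := fun v τ => (1 - Complex.cos (v * τ)) / (τ : ℂ) ^ 2 * sechWeight τ)
    (F' := fun v τ => Complex.sin (v * τ) / τ * sechWeight τ)
    (b := fun τ => ((|x| + 1) * 2) * Real.exp ((1 - Real.pi / 2) * τ))
    ((integrableOn_exp_mul_Ioi (by linarith) 0).const_mul _)
    (fun v => aestronglyMeasurable_restrict_Ioi ?_) (fun v => aestronglyMeasurable_restrict_Ioi ?_)
    (by simp) ?_ ?_ ⟨by simp [hstrip], by simp⟩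
  · exact (ContinuousOn.div (by fun_prop) (by fun_prop)
      fun τ hτ => pow_ne_zero 2 (ofReal_ne_zero_of_mem_Ioi hτ)).mul (by fun_prop)
  · exact (ContinuousOn.div (by fun_prop) (by fun_prop)
      fun τ hτ => ofReal_ne_zero_of_mem_Ioi hτ).mul (by fun_prop)
  · refine (ae_restrict_iff' measurableSet_Ioi).2 (.of_forall fun τ hτ u _ => ?_)
    have hτ0 := ofReal_ne_zero_of_mem_Ioi hτ
    have h1 := ((((hasDerivAt_id u).mul_const (τ : ℂ)).ccos.const_sub 1).div_const
      ((τ : ℂ) ^ 2)).mul_const (sechWeight τ : ℂ)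
    convert! h1 using 1
    simp only [id]
    field_simp
    try simp
  · refine (ae_restrict_iff' measurableSet_Ioi).2 (.of_forall fun τ hτ u hu => ?_)
    have hτ0 : 0 < τ := hτ
    have hu1 : |u.im| < 1 := hu.1
    have hu2 : ‖u‖ < |x| + 1 := by simpa using hu.2
    rw [norm_mul, norm_div, Complex.norm_real, Complex.norm_real,
      Real.norm_of_nonneg (sechWeight_pos τ).le, Real.norm_of_nonneg hτ0.le]
    have h1 : ‖Complex.sin (u * τ)‖ ≤ Real.exp (1 * τ) * ((|x| + 1) * τ) := by
      refine (Complex.norm_sin_le _).trans ?_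
      rw [Complex.im_mul_ofReal, abs_mul, abs_of_pos hτ0, norm_mul, Complex.norm_real,
        Real.norm_of_nonneg hτ0.le]
      gcongr
    calc _ ≤ Real.exp (1 * τ) * ((|x| + 1) * τ) / τ * (2 * Real.exp (-(Real.pi / 2) * τ)) := by
          gcongr
          · exact (sechWeight_pos τ).le
          · exact sechWeight_le τ
      _ = (|x| + 1) * 2 * (Real.exp (1 * τ) * Real.exp (-(Real.pi / 2) * τ)) := by
          field_simp
      _ = _ := by rw [← Real.exp_add]; ring_nf

theorem re_gdPrimitive_le (x : ℝ) : (gdPrimitive x).re ≤ Real.pi / 2 * |x| := by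
  have hd : ∀ x : ℝ, HasDerivAt (fun x : ℝ => (gdPrimitive x).re) (gdTransform x).re x := fun x =>
    (gdPrimitive_aux x).2.real_of_complex
  have := convex_univ.norm_image_sub_le_of_norm_hasDerivWithin_le
    (fun x _ => (hd x).hasDerivWithinAt) (fun x _ => abs_re_gdTransform_le x)
    (Set.mem_univ (0 : ℝ)) (Set.mem_univ x)
  simp only [Complex.ofReal_zero, sub_zero] at this
  have h0 : gdPrimitive 0 = 0 := by simp [gdPrimitive]
  rw [h0, Complex.zero_re, sub_zero] at this
  exact (le_abs_self _).trans this

/-! ### The logarithm of the Malyuzhinets function and its growth. -/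

/-- The weight `1 / (2 sinh(β τ) cosh(π τ / 2))`. -/
noncomputable def cschSechWeight (β τ : ℝ) : ℝ := 1 / (2 * Real.sinh (β * τ)) * sechWeight τ

theorem cschSechWeight_pos {β τ : ℝ} (hβ : 0 < β) (hτ : 0 < τ) : 0 < cschSechWeight β τ :=
  mul_pos (one_div_pos.2 (mul_pos two_pos (Real.sinh_pos_iff.2 (mul_pos hβ hτ)))) (sechWeight_pos τ)

theorem continuousOn_cschSechWeight {β : ℝ} (hβ : 0 < β) :
    ContinuousOn (cschSechWeight β) (Set.Ioi 0) := by
  have hs := continuous_sechWeight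
  refine ContinuousOn.mul (ContinuousOn.div (by fun_prop) (by fun_prop) fun τ hτ => ?_)
    hs.continuousOn
  exact (mul_pos two_pos (Real.sinh_pos_iff.2 (mul_pos hβ hτ))).ne'

theorem cschSechWeight_le {β τ : ℝ} (hβ : 0 < β) (hτ : 0 < τ) :
    cschSechWeight β τ ≤ 1 / (2 * β * τ) * sechWeight τ := by
  have h : β * τ ≤ Real.sinh (β * τ) := Real.self_le_sinh_iff.2 (by positivity)
  have h0 : 0 < β * τ := by positivity
  refine mul_le_mul_of_nonneg_right ?_ (sechWeight_pos τ).le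
  rw [mul_assoc]
  gcongr

/-- The inequality x e^x ≤ (1 + 2x) sinh x costs a linear factor, which e^{δτ} absorbs. The decay
rate is thus as close as desired to β + π/2, the half-width of the strip in which `malyuzhinetsLog`
is holomorphic. -/
theorem mul_cschSechWeight_le {β δ τ : ℝ} (hβ : 0 < β) (hδ : 0 < δ) (hτ : 0 < τ) :
    τ * cschSechWeight β τ ≤ (1 + 2 * β / δ) / β * Real.exp (-(β + Real.pi / 2 - δ) * τ) := by
  set x := β * τ with hx
  have hx0 : 0 < x := by positivity
  have h1 : x * Real.exp x ≤ Real.sinh x * (1 + 2 * x) := by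
    have e1 : 2 * x + 1 ≤ Real.exp (2 * x) := Real.add_one_le_exp _
    have e2 : Real.exp (2 * x) = Real.exp x * Real.exp x := by rw [← Real.exp_add]; ring_nf
    have e3 : Real.exp x * Real.exp (-x) = 1 := by rw [← Real.exp_add]; simp
    rw [Real.sinh_eq]
    have hp := Real.exp_pos x
    have hm := Real.exp_pos (-x)
    have e4 : (2 * x + 1) * Real.exp (-x) ≤ Real.exp x := by
      calc (2 * x + 1) * Real.exp (-x) ≤ Real.exp (2 * x) * Real.exp (-x) := by gcongr
        _ = Real.exp x := by rw [e2, mul_assoc, e3, mul_one]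
    nlinarith
  have h2 : 1 + 2 * x ≤ (1 + 2 * β / δ) * Real.exp (δ * τ) := by
    have e1 : 1 ≤ Real.exp (δ * τ) := Real.one_le_exp (by positivity)
    have e2 : δ * τ ≤ Real.exp (δ * τ) := by linarith [Real.add_one_le_exp (δ * τ)]
    have e3 : 2 * x = 2 * β / δ * (δ * τ) := by rw [hx]; field_simp
    rw [e3, add_mul, one_mul]
    have : 0 ≤ 2 * β / δ := by positivity
    nlinarith
  have hs : 0 < Real.sinh x := Real.sinh_pos_iff.2 hx0
  have h3 : τ / (2 * Real.sinh x) ≤ (1 + 2 * β / δ) / (2 * β) * Real.exp (-(β - δ) * τ) := by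
    rw [div_le_iff₀ (by positivity)]
    have e1 : x * Real.exp x ≤ Real.sinh x * ((1 + 2 * β / δ) * Real.exp (δ * τ)) :=
      h1.trans (by gcongr)
    have e2 : Real.exp (-(β - δ) * τ) * Real.exp x = Real.exp (δ * τ) := by
      rw [← Real.exp_add, hx]; ring_nf
    have e3 : x * Real.exp x ≤
        Real.sinh x * ((1 + 2 * β / δ) * Real.exp (-(β - δ) * τ)) * Real.exp x := by
      rw [← e2] at e1; linarith
    have e4 := le_of_mul_le_mul_right e3 (Real.exp_pos x)
    have e5 : (1 + 2 * β / δ) / (2 * β) * Real.exp (-(β - δ) * τ) * (2 * Real.sinh x) =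
        (Real.sinh x * ((1 + 2 * β / δ) * Real.exp (-(β - δ) * τ))) / β := by field_simp
    rw [e5, le_div_iff₀ hβ]
    linarith
  calc τ * cschSechWeight β τ = τ / (2 * Real.sinh x) * sechWeight τ := by
        rw [cschSechWeight]; ring
    _ ≤ (1 + 2 * β / δ) / (2 * β) * Real.exp (-(β - δ) * τ) * (2 * Real.exp (-(Real.pi / 2) * τ)) := by
        gcongr
        · exact (sechWeight_pos τ).le
        · exact sechWeight_le τ
    _ = (1 + 2 * β / δ) / β * (Real.exp (-(β - δ) * τ) * Real.exp (-(Real.pi / 2) * τ)) := by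
        field_simp
    _ = _ := by rw [← Real.exp_add]; ring_nf

open MeasureTheory in
/-- The even solution `e` of the difference equation `e (v + iβ) - e (v - iβ) = i gd v`
(the logarithm of a Malyuzhinets function). -/
noncomputable def malyuzhinetsLog (β : ℝ) (u : ℂ) : ℂ :=
  ∫ τ : ℝ in Set.Ioi 0, (1 - Complex.cos (u * τ)) / τ * cschSechWeight β τ

open MeasureTheory in
theorem malyuzhinetsLog_aux {β : ℝ} (hβ : 0 < β) {u : ℂ} (hu : |u.im| < β + Real.pi / 2) :
    IntegrableOn (fun τ : ℝ => (1 - Complex.cos (u * τ)) / τ * cschSechWeight β τ) (Set.Ioi 0) ∧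
    DifferentiableAt ℂ (malyuzhinetsLog β) u := by
  obtain ⟨y, hy0, hy, huy⟩ := exists_between_abs_im hu
  have hs := continuousOn_cschSechWeight hβ
  have hs' : ContinuousOn (fun τ : ℝ => (cschSechWeight β τ : ℂ)) (Set.Ioi 0) :=
    Complex.continuous_ofReal.comp_continuousOn hs
  -- Half of the available gap: the exponents y and -(β + π/2 - δ) then add up to -δ.
  set δ := (β + Real.pi / 2 - y) / 2 with hδ
  have hδ0 : 0 < δ := by rw [hδ]; linarith
  have h := integrable_and_hasDerivAt_integral_of_convex
    ((isOpen_hstrip y).inter (Metric.isOpen_ball (x := (0 : ℂ)) (ε := ‖u‖ + 1)))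
    ((convex_hstrip y).inter (convex_ball _ _))
    ⟨zero_mem_hstrip hy0, Metric.mem_ball_self (by positivity)⟩ (μ := volume.restrict (Set.Ioi 0))
    (F := fun v τ => (1 - Complex.cos (v * τ)) / τ * cschSechWeight β τ)
    (F' := fun v τ => Complex.sin (v * τ) * cschSechWeight β τ)
    (b := fun τ => ((‖u‖ + 1) * ((1 + 2 * β / δ) / β)) * Real.exp (-δ * τ))
    ((integrableOn_exp_mul_Ioi (by linarith) 0).const_mul _)
    (fun v => aestronglyMeasurable_restrict_Ioi ?_) (fun v => aestronglyMeasurable_restrict_Ioi ?_)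
    (by simp) ?_ ?_ (u := u) ⟨huy, by simp⟩
  · exact ⟨h.1, h.2.differentiableAt⟩
  · exact (ContinuousOn.div (by fun_prop) (by fun_prop)
      fun τ hτ => ofReal_ne_zero_of_mem_Ioi hτ).mul hs'
  · exact ContinuousOn.mul (by fun_prop) hs'
  · refine (ae_restrict_iff' measurableSet_Ioi).2 (.of_forall fun τ hτ v _ => ?_)
    have hτ0 := ofReal_ne_zero_of_mem_Ioi hτ
    have h1 := ((((hasDerivAt_id v).mul_const (τ : ℂ)).ccos.const_sub 1).div_const
      (τ : ℂ)).mul_const (cschSechWeight β τ : ℂ)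
    convert! h1 using 1
    simp [hτ0]
  · refine (ae_restrict_iff' measurableSet_Ioi).2 (.of_forall fun τ hτ v hv => ?_)
    have hτ0 : 0 < τ := hτ
    have hv1 : |v.im| < y := hv.1
    have hv2 : ‖v‖ < ‖u‖ + 1 := by simpa using hv.2
    have hw := cschSechWeight_pos hβ hτ0
    rw [norm_mul, Complex.norm_real, Real.norm_of_nonneg hw.le]
    have h1 : ‖Complex.sin (v * τ)‖ ≤ Real.exp (y * τ) * ((‖u‖ + 1) * τ) := by
      refine (Complex.norm_sin_le _).trans ?_
      rw [Complex.im_mul_ofReal, abs_mul, abs_of_pos hτ0, norm_mul, Complex.norm_real,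
        Real.norm_of_nonneg hτ0.le]
      gcongr
    calc _ ≤ Real.exp (y * τ) * ((‖u‖ + 1) * τ) * cschSechWeight β τ := by gcongr
      _ = Real.exp (y * τ) * (‖u‖ + 1) * (τ * cschSechWeight β τ) := by ring
      _ ≤ Real.exp (y * τ) * (‖u‖ + 1) *
          ((1 + 2 * β / δ) / β * Real.exp (-(β + Real.pi / 2 - δ) * τ)) := by
        exact mul_le_mul_of_nonneg_left (mul_cschSechWeight_le hβ hδ0 hτ0) (by positivity)
      _ = (‖u‖ + 1) * ((1 + 2 * β / δ) / β) *
          (Real.exp (y * τ) * Real.exp (-(β + Real.pi / 2 - δ) * τ)) := by ring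
      _ = _ := by
        rw [← Real.exp_add]
        congr 2
        rw [hδ]; ring

theorem malyuzhinetsLog_neg (β : ℝ) (u : ℂ) : malyuzhinetsLog β (-u) = malyuzhinetsLog β u := by
  simp [malyuzhinetsLog]

theorem differentiableAt_malyuzhinetsLog {β : ℝ} (hβ : 0 < β) {u : ℂ}
    (hu : |u.im| < β + Real.pi / 2) : DifferentiableAt ℂ (malyuzhinetsLog β) u :=
  (malyuzhinetsLog_aux hβ hu).2

open MeasureTheory Complex in
/-- The difference equation. -/
theorem malyuzhinetsLog_add_sub {β : ℝ} (hβ : 0 < β) {v : ℂ} (hv : |v.im| < Real.pi / 2) :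
    malyuzhinetsLog β (v + I * β) - malyuzhinetsLog β (v - I * β) = I * gdTransform v := by
  have h1 : |(v + I * β).im| < β + Real.pi / 2 := by
    simp only [add_im, mul_im, I_re, ofReal_im, I_im, ofReal_re]
    rw [abs_lt] at hv ⊢; constructor <;> linarith
  have h2 : |(v - I * β).im| < β + Real.pi / 2 := by
    simp only [sub_im, mul_im, I_re, ofReal_im, I_im, ofReal_re]
    rw [abs_lt] at hv ⊢; constructor <;> linarith
  rw [malyuzhinetsLog, malyuzhinetsLog,
    ← integral_sub (malyuzhinetsLog_aux hβ h1).1 (malyuzhinetsLog_aux hβ h2).1, gdTransform,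
    ← integral_const_mul]
  refine setIntegral_congr_fun measurableSet_Ioi fun τ hτ => ?_
  have hτ0 := ofReal_ne_zero_of_mem_Ioi hτ
  have hs : Complex.sinh (β * τ) ≠ 0 := by
    rw [← ofReal_mul, ← ofReal_sinh]
    exact_mod_cast (Real.sinh_pos_iff.2 (mul_pos hβ hτ)).ne'
  simp only [cschSechWeight]
  push_cast
  -- The difference cos((v - iβ)τ) - cos((v + iβ)τ) is 2i sin(vτ) sinh(βτ), which cancels the sinh
  -- in the weight and leaves the sine transform of the secant.
  rw [show (v + I * β) * τ = v * τ + (β * τ) * I by ring,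
    show (v - I * β) * τ = v * τ - (β * τ) * I by ring, cos_add, cos_sub, sin_mul_I]
  generalize sinh (β * τ) = S at hs ⊢
  field_simp
  ring

open MeasureTheory Complex in
-- Because sinh(βτ) ≥ βτ, the integrand is at most 1/(2β) times that of `gdPrimitive`, whose slope
-- is at most π/2. The resulting slope π/(4β) governs the later decay rates.
theorem re_malyuzhinetsLog_ofReal_le {β : ℝ} (hβ : 0 < β) (x : ℝ) :
    (malyuzhinetsLog β x).re ≤ Real.pi / (4 * β) * |x| := by
  have hx : |(x : ℂ).im| < β + Real.pi / 2 := by simp; positivity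
  have h1 := (malyuzhinetsLog_aux hβ hx).1
  have h2 := (gdPrimitive_aux x).1
  have e1 : ∀ τ : ℝ, ((1 - Complex.cos (x * τ)) / τ * cschSechWeight β τ).re =
      (1 - Real.cos (x * τ)) / τ * cschSechWeight β τ := fun τ => by
    rw [← ofReal_re ((1 - Real.cos (x * τ)) / τ * cschSechWeight β τ)]; push_cast; rfl
  have e2 : ∀ τ : ℝ, ((1 - Complex.cos (x * τ)) / (τ : ℂ) ^ 2 * sechWeight τ).re =
      (1 - Real.cos (x * τ)) / τ ^ 2 * sechWeight τ := fun τ => by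
    rw [← ofReal_re ((1 - Real.cos (x * τ)) / τ ^ 2 * sechWeight τ)]; push_cast; rfl
  have h3 : (malyuzhinetsLog β x).re ≤ 1 / (2 * β) * (gdPrimitive x).re := by
    have r1 := integral_re h1
    have r2 := integral_re h2
    simp only [RCLike.re_eq_complex_re] at r1 r2
    have i1 := h1.re
    have i2 := h2.re
    simp only [RCLike.re_eq_complex_re] at i1 i2
    rw [malyuzhinetsLog, gdPrimitive, ← r1, ← r2, ← integral_const_mul]
    refine setIntegral_mono_on i1 (i2.const_mul _) measurableSet_Ioi fun τ hτ => ?_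
    have hτ0 : 0 < τ := hτ
    have hc := Real.cos_le_one (x * τ)
    rw [e1, e2]
    calc _ ≤ (1 - Real.cos (x * τ)) / τ * (1 / (2 * β * τ) * sechWeight τ) := by
          refine mul_le_mul_of_nonneg_left (cschSechWeight_le hβ hτ0) ?_
          exact div_nonneg (by linarith) hτ0.le
      _ = _ := by field_simp
  calc _ ≤ _ := h3
    _ ≤ 1 / (2 * β) * (Real.pi / 2 * |x|) := by
      gcongr; exact re_gdPrimitive_le x
    _ = _ := by field_simp; ring

open MeasureTheory Complex in
-- Since Re cos((x + iy)τ) = cos(xτ) cosh(yτ) and 1 - cos a cosh b ≤ (1 - cos a) + (cosh B - 1) for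
-- |b| ≤ B, leaving the real axis costs only the constant -Re e(iY).
theorem exists_re_malyuzhinetsLog_le {β Y : ℝ} (hβ : 0 < β) (hY0 : 0 ≤ Y)
    (hY : Y < β + Real.pi / 2) : ∃ C : ℝ, ∀ x y : ℝ, |y| ≤ Y →
      (malyuzhinetsLog β (x + y * I)).re ≤ Real.pi / (4 * β) * |x| + C := by
  refine ⟨-(malyuzhinetsLog β (Y * I)).re, fun x y hy => ?_⟩
  have hx : |(x : ℂ).im| < β + Real.pi / 2 := by simp; positivity
  have hxy : |((x : ℂ) + y * I).im| < β + Real.pi / 2 := by simp; linarith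
  have hYI : |((Y : ℂ) * I).im| < β + Real.pi / 2 := by simp [abs_of_nonneg hY0]; linarith
  have h1 := (malyuzhinetsLog_aux hβ hx).1
  have h2 := (malyuzhinetsLog_aux hβ hxy).1
  have h3 := (malyuzhinetsLog_aux hβ hYI).1
  have e1 : ∀ (v : ℂ) (τ : ℝ), ((1 - Complex.cos (v * τ)) / τ * cschSechWeight β τ).re =
      (1 - (Complex.cos (v * τ)).re) * (1 / τ * cschSechWeight β τ) := fun v τ => by
    rw [show (1 - Complex.cos (v * τ)) / τ * cschSechWeight β τ =
      (1 - Complex.cos (v * τ)) * ((1 / τ * cschSechWeight β τ : ℝ) : ℂ) by push_cast; ring,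
      re_mul_ofReal, sub_re, one_re]
  have r1 := integral_re h1
  have r2 := integral_re h2
  have r3 := integral_re h3
  have i1 := h1.re
  have i2 := h2.re
  have i3 := h3.re
  simp only [RCLike.re_eq_complex_re] at r1 r2 r3 i1 i2 i3
  suffices h : (malyuzhinetsLog β (x + y * I)).re ≤
      (malyuzhinetsLog β x).re - (malyuzhinetsLog β (Y * I)).re by
    linarith [re_malyuzhinetsLog_ofReal_le hβ x]
  rw [malyuzhinetsLog, malyuzhinetsLog, malyuzhinetsLog, ← r1, ← r2, ← r3, ← integral_sub i1 i3]
  refine setIntegral_mono_on i2 (i1.sub i3) measurableSet_Ioi fun τ hτ => ?_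
  have hτ0 : 0 < τ := hτ
  have hw : 0 ≤ 1 / τ * cschSechWeight β τ :=
    mul_nonneg (by positivity) (cschSechWeight_pos hβ hτ0).le
  rw [e1, e1, e1, ← sub_mul]
  refine mul_le_mul_of_nonneg_right ?_ hw
  have c1 : (Complex.cos ((x + y * I) * τ)).re = Real.cos (x * τ) * Real.cosh (y * τ) := by
    rw [show ((x : ℂ) + y * I) * τ = ((x * τ : ℝ) : ℂ) + ((y * τ : ℝ) : ℂ) * I by push_cast; ring,
      cos_add, cos_mul_I, sin_mul_I, ← ofReal_cos, ← ofReal_sin, ← ofReal_cosh, ← ofReal_sinh]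
    rw [← mul_assoc, ← ofReal_mul, ← ofReal_mul, sub_re, mul_I_re, ofReal_re, ofReal_im, neg_zero,
      sub_zero]
  have c2 : (Complex.cos (x * τ)).re = Real.cos (x * τ) := by
    rw [← ofReal_mul, cos_ofReal_re]
  have c3 : (Complex.cos (Y * I * τ)).re = Real.cosh (Y * τ) := by
    rw [show (Y : ℂ) * I * τ = ((Y * τ : ℝ) : ℂ) * I by push_cast; ring, cos_mul_I, cosh_ofReal_re]
  rw [c1, c2, c3]
  have m1 : Real.cosh (y * τ) ≤ Real.cosh (Y * τ) := by
    rw [Real.cosh_le_cosh, abs_mul, abs_mul, abs_of_pos hτ0, abs_of_nonneg hY0]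
    gcongr
  have m2 := Real.one_le_cosh (y * τ)
  have m3 := Real.neg_one_le_cos (x * τ)
  nlinarith

/-! ### Laplace integrals in the logarithmic variable, and decaying profiles. -/

open MeasureTheory in
theorem integrable_exp_neg_exp_add_mul {s : ℝ} (hs : 0 < s) :
    Integrable fun x : ℝ => Real.exp (-Real.exp x + s * x) := by
  have hc : Continuous fun x : ℝ => ((Real.exp (-Real.exp x + s * x) : ℝ) : ℂ) := by fun_prop
  -- From 4s onwards, e^x ≥ x²/2 ≥ 2sx, which leaves the exponent at most -sx.
  have := hc.integrable_of_exp_decay (C := 1) (X := 4 * s) hs fun x hx => by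
    rw [Complex.norm_real, Real.norm_of_nonneg (Real.exp_pos _).le, one_mul, Real.exp_le_exp]
    rcases le_total 0 x with h | h
    · rw [abs_of_nonneg h] at hx ⊢
      have := Real.quadratic_le_exp_of_nonneg h
      nlinarith
    · rw [abs_of_nonpos h] at hx ⊢
      have := Real.exp_pos x
      nlinarith
  exact_mod_cast this.re

open MeasureTheory in
theorem integral_exp_neg_mul_exp_add_mul {r : ℝ} (hr : 0 < r) (s : ℝ) :
    ∫ x : ℝ, Real.exp (-(r * Real.exp x) + s * x) =
      r ^ (-s) * ∫ x : ℝ, Real.exp (-Real.exp x + s * x) := by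
  rw [← integral_sub_right_eq_self _ (Real.log r), ← integral_const_mul]
  congr 1; ext x
  rw [Real.rpow_def_of_pos hr, ← Real.exp_add, Real.exp_sub, Real.exp_log hr]
  congr 1
  field_simp
  ring

open MeasureTheory in
theorem integrable_exp_neg_mul_exp_add_mul {r s : ℝ} (hr : 0 < r) (hs : 0 < s) :
    Integrable fun x : ℝ => Real.exp (-(r * Real.exp x) + s * x) := by
  refine (((integrable_exp_neg_exp_add_mul hs).comp_add_right (Real.log r)).const_mul
    (r ^ (-s))).congr (.of_forall fun x => ?_)
  simp only
  rw [Real.rpow_def_of_pos hr, ← Real.exp_add, Real.exp_add x, Real.exp_log hr]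
  congr 1
  ring

open MeasureTheory in
/-- The Laplace integral `∫ e^{-w ζ} D(log ζ) dζ / ζ` in the variable `x = log ζ`. -/
noncomputable def laplaceLog (D : ℝ → ℂ) (w : ℂ) : ℂ :=
  ∫ x : ℝ, Complex.exp (-(w * Real.exp x)) * D x

theorem norm_exp_neg_mul_exp (w : ℂ) (x : ℝ) :
    ‖Complex.exp (-(w * Real.exp x))‖ = Real.exp (-(w.re * Real.exp x)) := by
  rw [Complex.norm_exp, Complex.neg_re, Complex.re_mul_ofReal]

theorem mul_exp_neg_mul_le {r y : ℝ} (hr : 0 < r) : y * Real.exp (-(r * y)) ≤ r⁻¹ := by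
  have h := Real.add_one_le_exp (r * y)
  have h2 : Real.exp (-(r * y)) * Real.exp (r * y) = 1 := by rw [← Real.exp_add]; simp
  rw [← mul_le_mul_iff_right₀ hr, mul_inv_cancel₀ hr.ne', ← mul_assoc, ← h2, mul_comm]
  gcongr
  linarith

section LaplaceLog

variable {D : ℝ → ℂ} {C μ : ℝ}

open MeasureTheory Filter Topology in
theorem hasDerivAt_laplaceLog (hD : Continuous D) (hμ : 0 < μ)
    (hb : ∀ x, ‖D x‖ ≤ C * Real.exp (-μ * |x|)) {w : ℂ} (hw : 0 < w.re) :
    Integrable (fun x : ℝ => Complex.exp (-(w * Real.exp x)) * D x) ∧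
    Integrable (fun x : ℝ => -(Real.exp x * (Complex.exp (-(w * Real.exp x)) * D x))) ∧
    HasDerivAt (laplaceLog D)
      (∫ x : ℝ, -(Real.exp x * (Complex.exp (-(w * Real.exp x)) * D x))) w := by
  have hi := integrable_exp_neg_mul_abs hμ
  have h0 : Integrable (fun x : ℝ => Complex.exp (-(w * Real.exp x)) * D x) := by
    refine (hi.const_mul C).mono' (by fun_prop) (.of_forall fun x => ?_)
    rw [norm_mul, norm_exp_neg_mul_exp]
    calc _ ≤ 1 * (C * Real.exp (-μ * |x|)) := by
          gcongr
          · exact Real.exp_le_one_iff.2 (neg_nonpos.2 (by positivity))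
          · exact hb x
      _ = _ := one_mul _
  refine ⟨h0, ?_⟩
  set r := w.re / 2 with hr
  have hr0 : 0 < r := by positivity
  have hopen : {v : ℂ | r < v.re} ∈ 𝓝 w :=
    (isOpen_lt continuous_const Complex.continuous_re).mem_nhds (by
      change r < w.re; rw [hr]; linarith)
  refine hasDerivAt_integral_of_dominated_loc_of_deriv_le
    (F := fun w x => Complex.exp (-(w * Real.exp x)) * D x)
    (F' := fun w x => -(Real.exp x * (Complex.exp (-(w * Real.exp x)) * D x)))
    (bound := fun x => r⁻¹ * (C * Real.exp (-μ * |x|)))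
    hopen (.of_forall fun v => by fun_prop) h0 (by fun_prop) (.of_forall fun x v hv => ?_)
    ((hi.const_mul C).const_mul _) (.of_forall fun x v hv => ?_)
  · have hv' : r < v.re := hv
    rw [norm_neg, norm_mul, norm_mul, norm_exp_neg_mul_exp, Complex.norm_real,
      Real.norm_of_nonneg (Real.exp_pos x).le, ← mul_assoc]
    refine mul_le_mul ?_ (hb x) (norm_nonneg _) (by positivity)
    calc _ ≤ Real.exp x * Real.exp (-(r * Real.exp x)) := by gcongr
      _ ≤ _ := mul_exp_neg_mul_le hr0
  · have h1 := (((hasDerivAt_id v).mul_const (Real.exp x : ℂ)).neg.cexp).mul_const (D x)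
    convert! h1 using 1
    simp only [id, Pi.neg_apply]
    ring

open MeasureTheory in
theorem continuousOn_laplaceLog (hD : Continuous D) (hμ : 0 < μ)
    (hb : ∀ x, ‖D x‖ ≤ C * Real.exp (-μ * |x|)) :
    ContinuousOn (laplaceLog D) {w | 0 ≤ w.re} := by
  have hi := integrable_exp_neg_mul_abs hμ
  refine continuousOn_of_dominated (bound := fun x => C * Real.exp (-μ * |x|))
    (fun w _ => by fun_prop) (fun w hw => .of_forall fun x => ?_) (hi.const_mul C)
    (.of_forall fun x => by fun_prop)
  have hw' : 0 ≤ w.re := hw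
  rw [norm_mul, norm_exp_neg_mul_exp]
  calc _ ≤ 1 * (C * Real.exp (-μ * |x|)) := by
        gcongr
        · exact Real.exp_le_one_iff.2 (neg_nonpos.2 (by positivity))
        · exact hb x
    _ = _ := one_mul _

open MeasureTheory in
-- Only the bound e^{μx} is used, that is, the decay at x → -∞: rescaling e^x by Re w turns it into
-- a power of Re w times a Gamma integral. The decay at x → +∞ serves the continuity up to the
-- imaginary axis and the vertex.
theorem norm_laplaceLog_le (hD : Continuous D) (hμ : 0 < μ) (hC : 0 ≤ C)
    (hb : ∀ x, ‖D x‖ ≤ C * Real.exp (-μ * |x|)) :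
    ∃ K, ∀ w : ℂ, 0 < w.re → ‖laplaceLog D w‖ ≤ K * w.re ^ (-μ) ∧
      ‖deriv (laplaceLog D) w‖ ≤ K * w.re ^ (-(μ + 1)) := by
  have hb' : ∀ x, ‖D x‖ ≤ C * Real.exp (μ * x) := fun x => (hb x).trans (by
    refine mul_le_mul_of_nonneg_left (Real.exp_le_exp.2 ?_) hC
    nlinarith [neg_abs_le x])
  set K : ℝ → ℝ := fun s => ∫ x : ℝ, Real.exp (-Real.exp x + s * x) with hK
  have hK0 : ∀ s, 0 ≤ K s := fun s => integral_nonneg fun x => (Real.exp_pos _).le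
  refine ⟨C * K μ + C * K (μ + 1), fun w hw => ⟨?_, ?_⟩⟩
  · calc ‖laplaceLog D w‖ ≤ ∫ x : ℝ, C * Real.exp (-(w.re * Real.exp x) + μ * x) := by
          refine norm_integral_le_of_norm_le
            ((integrable_exp_neg_mul_exp_add_mul hw hμ).const_mul C) (.of_forall fun x => ?_)
          rw [norm_mul, norm_exp_neg_mul_exp, Real.exp_add, mul_left_comm]
          gcongr
          exact hb' x
      _ = C * K μ * w.re ^ (-μ) := by
          rw [integral_const_mul, integral_exp_neg_mul_exp_add_mul hw]; ring
      _ ≤ _ := by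
          gcongr
          exact le_add_of_nonneg_right (mul_nonneg hC (hK0 _))
  · rw [(hasDerivAt_laplaceLog hD hμ hb hw).2.2.deriv]
    calc _ ≤ ∫ x : ℝ, C * Real.exp (-(w.re * Real.exp x) + (μ + 1) * x) := by
          refine norm_integral_le_of_norm_le
            ((integrable_exp_neg_mul_exp_add_mul hw (by linarith)).const_mul C)
            (.of_forall fun x => ?_)
          rw [norm_neg, norm_mul, norm_mul, norm_exp_neg_mul_exp, Complex.norm_real,
            Real.norm_of_nonneg (Real.exp_pos x).le]
          calc _ ≤ Real.exp x * (Real.exp (-(w.re * Real.exp x)) * (C * Real.exp (μ * x))) := by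
                gcongr; exact hb' x
            _ = C * (Real.exp (-(w.re * Real.exp x)) * (Real.exp (μ * x) * Real.exp x)) := by ring
            _ = _ := by rw [← Real.exp_add, ← Real.exp_add]; ring_nf
      _ = C * K (μ + 1) * w.re ^ (-(μ + 1)) := by
          rw [integral_const_mul, integral_exp_neg_mul_exp_add_mul hw]; ring
      _ ≤ _ := by
          gcongr
          exact le_add_of_nonneg_left (mul_nonneg hC (hK0 _))

end LaplaceLog

/-- A function on the closed right half-plane that is holomorphic inside, continuous up to the
boundary, and decays like `|w|^{-μ}` with its derivative in the sector `|arg w| ≤ β`. -/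
structure IsDecayingProfile (β μ : ℝ) (g : ℂ → ℂ) : Prop where
  differentiableAt : ∀ w : ℂ, 0 < w.re → DifferentiableAt ℂ g w
  continuousOn : ContinuousOn g {w | 0 ≤ w.re}
  decay : ∃ C, 0 ≤ C ∧ ∀ ρ θ : ℝ, 1 ≤ ρ → |θ| ≤ β →
    ‖g (ρ * Complex.exp (θ * Complex.I))‖ + ρ * ‖deriv g (ρ * Complex.exp (θ * Complex.I))‖ ≤
      C * ρ ^ (-μ)

theorem re_polar (ρ θ : ℝ) : (ρ * Complex.exp (θ * Complex.I)).re = ρ * Real.cos θ := by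
  rw [Complex.re_ofReal_mul, Complex.exp_ofReal_mul_I_re]

theorem re_polar_pos {β ρ θ : ℝ} (hβ' : β < Real.pi / 2) (hρ : 0 < ρ) (hθ : |θ| ≤ β) :
    0 < (ρ * Complex.exp (θ * Complex.I)).re := by
  rw [re_polar]
  have := abs_le.1 hθ
  exact mul_pos hρ (Real.cos_pos_of_mem_Ioo ⟨by linarith, by linarith⟩)

theorem cos_le_cos_of_abs_le {β θ : ℝ} (hβ' : β < Real.pi / 2) (hθ : |θ| ≤ β) :
    Real.cos β ≤ Real.cos θ := by
  rw [← Real.cos_abs θ]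
  exact Real.cos_le_cos_of_nonneg_of_le_pi (abs_nonneg _) (by linarith [Real.pi_pos]) hθ

namespace IsDecayingProfile

variable {β μ : ℝ} {g g' : ℂ → ℂ}

theorem add (hβ' : β < Real.pi / 2) (h : IsDecayingProfile β μ g) (h' : IsDecayingProfile β μ g') :
    IsDecayingProfile β μ (fun w => g w + g' w) where
  differentiableAt w hw := (h.differentiableAt w hw).add (h'.differentiableAt w hw)
  continuousOn := h.continuousOn.add h'.continuousOn
  decay := by
    obtain ⟨C, hC, H⟩ := h.decay
    obtain ⟨C', hC', H'⟩ := h'.decay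
    refine ⟨C + C', add_nonneg hC hC', fun ρ θ hρ hθ => ?_⟩
    have hre := re_polar_pos hβ' (by linarith : 0 < ρ) hθ
    have hd : deriv (fun w => g w + g' w) (ρ * Complex.exp (θ * Complex.I)) = _ :=
      deriv_add (h.differentiableAt _ hre) (h'.differentiableAt _ hre)
    rw [hd]
    have h1 := H ρ θ hρ hθ
    have h2 := H' ρ θ hρ hθ
    have h3 := norm_add_le (g (ρ * Complex.exp (θ * Complex.I))) (g' (ρ * Complex.exp (θ * Complex.I)))
    have h4 := mul_le_mul_of_nonneg_left (norm_add_le (deriv g (ρ * Complex.exp (θ * Complex.I)))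
      (deriv g' (ρ * Complex.exp (θ * Complex.I)))) (by linarith : 0 ≤ ρ)
    linarith

theorem const_mul (hβ' : β < Real.pi / 2) (h : IsDecayingProfile β μ g) (c : ℂ) :
    IsDecayingProfile β μ (fun w => c * g w) where
  differentiableAt w hw := (h.differentiableAt w hw).const_mul c
  continuousOn := continuousOn_const.mul h.continuousOn
  decay := by
    obtain ⟨C, hC, H⟩ := h.decay
    refine ⟨‖c‖ * C, by positivity, fun ρ θ hρ hθ => ?_⟩
    have hre := re_polar_pos hβ' (by linarith : 0 < ρ) hθ
    rw [deriv_const_mul _ (h.differentiableAt _ hre), norm_mul, norm_mul]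
    have h1 := mul_le_mul_of_nonneg_left (H ρ θ hρ hθ) (norm_nonneg c)
    linarith

theorem zero : IsDecayingProfile β μ (fun _ => 0) where
  differentiableAt w _ := by fun_prop
  continuousOn := continuousOn_const
  decay := ⟨0, le_rfl, fun ρ θ _ _ => by simp⟩

theorem sum (hβ' : β < Real.pi / 2) {ι : Type*} (s : Finset ι) {G : ι → ℂ → ℂ}
    (h : ∀ i ∈ s, IsDecayingProfile β μ (G i)) :
    IsDecayingProfile β μ (fun w => ∑ i ∈ s, G i w) := by
  classical
  induction s using Finset.induction_on with
  | empty => simpa using zero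
  | insert i s hi ih =>
    simp only [Finset.sum_insert hi]
    exact add hβ' (h i (Finset.mem_insert_self i s))
      (ih fun j hj => h j (Finset.mem_insert_of_mem hj))

end IsDecayingProfile

theorem isDecayingProfile_laplaceLog {D : ℝ → ℂ} {β C μ : ℝ} (hβ0 : 0 < β) (hβ' : β < Real.pi / 2)
    (hD : Continuous D) (hμ : 0 < μ) (hC : 0 ≤ C) (hb : ∀ x, ‖D x‖ ≤ C * Real.exp (-μ * |x|)) :
    IsDecayingProfile β μ (laplaceLog D) where
  differentiableAt w hw := (hasDerivAt_laplaceLog hD hμ hb hw).2.2.differentiableAt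
  continuousOn := continuousOn_laplaceLog hD hμ hb
  decay := by
    obtain ⟨K, hK⟩ := norm_laplaceLog_le hD hμ hC hb
    have hc : 0 < Real.cos β := Real.cos_pos_of_mem_Ioo ⟨by linarith, hβ'⟩
    have hK0 : 0 ≤ K := by
      have := (norm_nonneg _).trans (hK 1 (by simp)).1
      simpa using this
    refine ⟨K * Real.cos β ^ (-μ) + K * Real.cos β ^ (-(μ + 1)), by positivity, fun ρ θ hρ hθ => ?_⟩
    have hρ0 : 0 < ρ := by linarith
    have hre := re_polar_pos hβ' hρ0 hθ
    have hlow : ρ * Real.cos β ≤ (ρ * Complex.exp (θ * Complex.I)).re := by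
      rw [re_polar]
      exact mul_le_mul_of_nonneg_left (cos_le_cos_of_abs_le hβ' hθ) hρ0.le
    have hp : ∀ s : ℝ, 0 < s → (ρ * Complex.exp (θ * Complex.I)).re ^ (-s) ≤
        Real.cos β ^ (-s) * ρ ^ (-s) := fun s hs => by
      rw [mul_comm (Real.cos β ^ (-s)), ← Real.mul_rpow hρ0.le hc.le]
      exact Real.rpow_le_rpow_of_nonpos (by positivity) hlow (by linarith)
    obtain ⟨h1, h2⟩ := hK _ hre
    have e : ρ * ρ ^ (-(μ + 1)) = ρ ^ (-μ) := by
      rw [← Real.rpow_one_add' hρ0.le (by linarith)]; ring_nf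
    calc _ ≤ K * (Real.cos β ^ (-μ) * ρ ^ (-μ)) +
          ρ * (K * (Real.cos β ^ (-(μ + 1)) * ρ ^ (-(μ + 1)))) := by
          refine add_le_add (h1.trans ?_) (mul_le_mul_of_nonneg_left (h2.trans ?_) hρ0.le)
          · exact mul_le_mul_of_nonneg_left (hp _ hμ) hK0
          · exact mul_le_mul_of_nonneg_left (hp _ (by linarith)) hK0
      _ = K * (Real.cos β ^ (-μ) * ρ ^ (-μ)) +
          K * (Real.cos β ^ (-(μ + 1)) * (ρ * ρ ^ (-(μ + 1)))) := by ring
      _ = _ := by rw [e]; ring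

/-! ### Exponentials and their defect in the Robin condition. -/

/-- The exponential `e^{-w e^u}`. -/
noncomputable def expAtom (u w : ℂ) : ℂ := Complex.exp (-(w * Complex.exp u))

theorem hasDerivAt_expAtom (u w : ℂ) :
    HasDerivAt (expAtom u) (-Complex.exp u * expAtom u w) w := by
  have := ((hasDerivAt_id w).mul_const (Complex.exp u)).neg.cexp
  convert! this using 1
  simp only [expAtom, id, Pi.neg_apply]; ring

theorem exists_mul_exp_neg_le_rpow {c : ℝ} (hc : 0 < c) (μ : ℝ) :
    ∃ C, 0 ≤ C ∧ ∀ ρ : ℝ, 1 ≤ ρ → (1 + ρ) * Real.exp (-(c * ρ)) ≤ C * ρ ^ (-μ) := by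
  obtain ⟨m, hm⟩ := exists_nat_ge (μ + 1)
  refine ⟨2 * (m.factorial / c ^ m), by positivity, fun ρ hρ => ?_⟩
  have hρ0 : 0 < ρ := by linarith
  have h1 := Real.pow_div_factorial_le_exp (x := c * ρ) (by positivity) m
  have h2 : ρ ^ (μ + 1) ≤ ρ ^ m := by
    rw [← Real.rpow_natCast]; exact Real.rpow_le_rpow_of_exponent_le hρ hm
  have h3 : Real.exp (-(c * ρ)) * Real.exp (c * ρ) = 1 := by rw [← Real.exp_add]; simp
  have h4 : ρ ^ m * Real.exp (-(c * ρ)) ≤ m.factorial / c ^ m := by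
    have := mul_le_mul_of_nonneg_left h1 (Real.exp_pos (-(c * ρ))).le
    rw [h3, mul_pow] at this
    rw [le_div_iff₀ (by positivity)]
    have hf : (0 : ℝ) < m.factorial := by positivity
    rw [mul_div_assoc', div_le_one hf] at this
    linarith
  have h5 : ρ ^ (-μ) = ρ ^ (-(μ + 1)) * ρ := by
    rw [← Real.rpow_add_one hρ0.ne']; ring_nf
  have h6 : ρ ^ (-(μ + 1)) * ρ ^ (μ + 1) = 1 := by
    rw [← Real.rpow_add hρ0]; simp
  have hp : 0 < ρ ^ (-(μ + 1)) := Real.rpow_pos_of_pos hρ0 _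
  rw [h5]
  calc (1 + ρ) * Real.exp (-(c * ρ)) ≤ (2 * ρ) * Real.exp (-(c * ρ)) := by gcongr; linarith
    _ = 2 * ρ * (ρ ^ (-(μ + 1)) * (ρ ^ (μ + 1) * Real.exp (-(c * ρ)))) := by
      rw [← mul_assoc (ρ ^ (-(μ + 1))), h6, one_mul]
    _ ≤ 2 * ρ * (ρ ^ (-(μ + 1)) * (m.factorial / c ^ m)) := by
      gcongr
      exact (mul_le_mul_of_nonneg_right h2 (Real.exp_pos _).le).trans h4
    _ = _ := by ring

open Complex in
-- For |arg w| ≤ β the hypothesis keeps Re(w e^{iφ}) ≥ |w| cos(|φ| + β) > 0, so the decay is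
-- exponential and beats every power.
theorem isDecayingProfile_expAtom {β φ : ℝ} (μ : ℝ) (hβ0 : 0 < β) (hφ : |φ| + β < Real.pi / 2) :
    IsDecayingProfile β μ (expAtom (φ * I)) where
  differentiableAt w _ := (hasDerivAt_expAtom _ w).differentiableAt
  continuousOn := (continuous_iff_continuousAt.2 fun w =>
    (hasDerivAt_expAtom _ w).continuousAt).continuousOn
  decay := by
    have hc : 0 < Real.cos (|φ| + β) :=
      Real.cos_pos_of_mem_Ioo ⟨by linarith [abs_nonneg φ], hφ⟩
    obtain ⟨C, hC, h⟩ := exists_mul_exp_neg_le_rpow hc μ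
    refine ⟨C, hC, fun ρ θ hρ hθ => ?_⟩
    have hρ0 : 0 < ρ := by linarith
    have e1 : (ρ : ℂ) * exp (θ * I) * exp (φ * I) = ρ * exp ((θ + φ : ℝ) * I) := by
      rw [mul_assoc, ← exp_add]; push_cast; ring_nf
    have h1 : ‖expAtom (φ * I) (ρ * exp (θ * I))‖ ≤ Real.exp (-(Real.cos (|φ| + β) * ρ)) := by
      rw [expAtom, norm_exp, e1, neg_re, re_polar, Real.exp_le_exp, neg_le_neg_iff, mul_comm]
      refine mul_le_mul_of_nonneg_left (cos_le_cos_of_abs_le hφ ?_) hρ0.le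
      exact (abs_add_le _ _).trans (by linarith)
    rw [(hasDerivAt_expAtom _ _).deriv, norm_mul, norm_neg, norm_exp_ofReal_mul_I, one_mul,
      ← one_add_mul]
    exact (mul_le_mul_of_nonneg_left h1 (by linarith)).trans (h ρ hρ)

open Complex in
/-- The defect of `f` in the Robin condition for `w ↦ f w + ε f (conj w)` on the ray `arg w = β`. -/
noncomputable def robinDefect (β : ℝ) (ε : ℂ) (t : ℝ) (f : ℂ → ℂ) : ℂ :=
  I * exp (β * I) * deriv f (t * exp (β * I)) - f (t * exp (β * I)) -
    ε * (f (t * exp (-(β * I))) + I * exp (-(β * I)) * deriv f (t * exp (-(β * I))))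

section RobinDefect

variable {β t : ℝ} {ε : ℂ} {f g : ℂ → ℂ}

open Complex in
theorem re_ray_pos (hβ0 : 0 < β) (hβ' : β < Real.pi / 2) (ht : 0 < t) :
    0 < (t * exp (β * I)).re ∧ 0 < (t * exp (-(β * I))).re := by
  refine ⟨re_polar_pos hβ' ht (abs_of_pos hβ0).le, ?_⟩
  have := re_polar_pos (θ := -β) hβ' ht (by rw [abs_neg]; exact (abs_of_pos hβ0).le)
  rwa [ofReal_neg, neg_mul] at this

theorem robinDefect_add (hβ0 : 0 < β) (hβ' : β < Real.pi / 2) (ht : 0 < t)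
    (hf : ∀ w : ℂ, 0 < w.re → DifferentiableAt ℂ f w)
    (hg : ∀ w : ℂ, 0 < w.re → DifferentiableAt ℂ g w) :
    robinDefect β ε t (fun w => f w + g w) = robinDefect β ε t f + robinDefect β ε t g := by
  obtain ⟨h1, h2⟩ := re_ray_pos hβ0 hβ' ht
  have e : ∀ w : ℂ, 0 < w.re → deriv (fun w => f w + g w) w = deriv f w + deriv g w :=
    fun w hw => deriv_add (hf w hw) (hg w hw)
  simp only [robinDefect]
  rw [e _ h1, e _ h2]
  ring

theorem robinDefect_const_mul (hβ0 : 0 < β) (hβ' : β < Real.pi / 2) (ht : 0 < t)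
    (hf : ∀ w : ℂ, 0 < w.re → DifferentiableAt ℂ f w) (c : ℂ) :
    robinDefect β ε t (fun w => c * f w) = c * robinDefect β ε t f := by
  obtain ⟨h1, h2⟩ := re_ray_pos hβ0 hβ' ht
  simp only [robinDefect]
  rw [deriv_const_mul _ (hf _ h1), deriv_const_mul _ (hf _ h2)]
  ring

theorem robinDefect_sum (hβ0 : 0 < β) (hβ' : β < Real.pi / 2) (ht : 0 < t) {ι : Type*}
    (s : Finset ι) {G : ι → ℂ → ℂ}
    (hG : ∀ i ∈ s, ∀ w : ℂ, 0 < w.re → DifferentiableAt ℂ (G i) w) :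
    robinDefect β ε t (fun w => ∑ i ∈ s, G i w) = ∑ i ∈ s, robinDefect β ε t (G i) := by
  classical
  induction s using Finset.induction_on with
  | empty => simp [robinDefect]
  | insert i s hi ih =>
    have hs : ∀ j ∈ s, ∀ w : ℂ, 0 < w.re → DifferentiableAt ℂ (G j) w :=
      fun j hj => hG j (Finset.mem_insert_of_mem hj)
    simp only [Finset.sum_insert hi]
    rw [robinDefect_add hβ0 hβ' ht (hG i (Finset.mem_insert_self i s))
      (fun w hw => DifferentiableAt.fun_sum fun j hj => hs j hj w hw), ih hs]

open Complex in
-- On the rays arg w = ±β the exponential becomes e^{-t e^{u ± iβ}}. This converts the boundary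
-- condition into a difference equation in u with step 2iβ.
theorem robinDefect_expAtom (u : ℂ) :
    robinDefect β ε t (expAtom u) =
      -((1 + I * exp (u + I * β)) * exp (-(t * exp (u + I * β)))) -
        ε * ((1 - I * exp (u - I * β)) * exp (-(t * exp (u - I * β)))) := by
  have e1 : exp (u + I * β) = exp (β * I) * exp u := by rw [← exp_add]; ring_nf
  have e2 : exp (u - I * β) = exp (-(β * I)) * exp u := by rw [← exp_add]; ring_nf
  simp only [robinDefect, (hasDerivAt_expAtom _ _).deriv, e1, e2, expAtom, mul_assoc]
  ring

end RobinDefect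

/-! ### The amplitude, its difference equation and the telescoping of defects. -/

open Complex in
/-- The amplitude of the exponential `e^{-w e^u}` in the solution. -/
noncomputable def edgeAmp (β p : ℝ) (u : ℂ) : ℂ :=
  exp (malyuzhinetsLog β u + p * (Real.pi / β) * u)

open Complex in
-- With `edgeLower`, the two boundary contributions that carry the same factor e^{-t e^v}: this one
-- comes from the exponent u = v - iβ on the ray arg w = β, the other from u = v + iβ on arg w = -β.
noncomputable def edgeUpper (β p t : ℝ) (v : ℂ) : ℂ :=
  (1 + I * exp v) * edgeAmp β p (v - I * β) * exp (-(t * exp v))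

open Complex in
noncomputable def edgeLower (β p : ℝ) (ε : ℂ) (t : ℝ) (v : ℂ) : ℂ :=
  -ε * (1 - I * exp v) * edgeAmp β p (v + I * β) * exp (-(t * exp v))

section Edge

variable {β p t : ℝ} {ε : ℂ}

open Complex in
theorem differentiableAt_edgeAmp (hβ : 0 < β) {u : ℂ} (hu : |u.im| < β + Real.pi / 2) :
    DifferentiableAt ℂ (edgeAmp β p) u :=
  ((differentiableAt_malyuzhinetsLog hβ hu).add (by fun_prop)).cexp

open Complex in
-- The ratio A(v + iβ)/A(v - iβ) is e^{i gd v} e^{2πip}, and e^{i gd v} = -i (1 + i e^v)/(1 - i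
-- e^v). The condition `hε` on p absorbs the remaining constant.
theorem edgeUpper_eq_edgeLower (hβ : 0 < β) (hε : ε * I * exp (2 * Real.pi * p * I) = 1) {v : ℂ}
    (hv : |v.im| < Real.pi / 2) : edgeUpper β p t v = edgeLower β p ε t v := by
  have hβ' : (β : ℂ) ≠ 0 := by exact_mod_cast hβ.ne'
  have h1 : edgeAmp β p (v + I * β) =
      edgeAmp β p (v - I * β) * exp (I * gdTransform v) * exp (2 * Real.pi * p * I) := by
    rw [← malyuzhinetsLog_add_sub hβ hv, edgeAmp, edgeAmp, ← exp_add, ← exp_add]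
    congr 1
    field_simp
    ring
  have h2 := exp_I_mul_gdTransform hv
  rw [edgeUpper, edgeLower, h1]
  linear_combination (-(1 + I * exp v) * edgeAmp β p (v - I * β) * exp (-(t * exp v))) * hε +
    (ε * edgeAmp β p (v - I * β) * exp (2 * Real.pi * p * I) * exp (-(t * exp v))) * h2

theorem edgeAmp_mul_robinDefect (u : ℂ) :
    edgeAmp β p u * robinDefect β ε t (expAtom u) =
      edgeLower β p ε t (u - Complex.I * β) - edgeUpper β p t (u + Complex.I * β) := by
  rw [robinDefect_expAtom, edgeLower, edgeUpper, sub_add_cancel, add_sub_cancel_right]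
  ring

open Complex in
/-- The defects of a ladder of exponentials telescope. -/
theorem sum_edgeAmp_mul_robinDefect (hβ : 0 < β) (hε : ε * I * exp (2 * Real.pi * p * I) = 1)
    (u : ℂ) (k : ℕ) (hu : ∀ j < k, |(u - 2 * j * (I * β) - I * β).im| < Real.pi / 2) :
    ∑ j ∈ Finset.range (k + 1), edgeAmp β p (u - 2 * j * (I * β)) *
        robinDefect β ε t (expAtom (u - 2 * j * (I * β))) =
      edgeLower β p ε t (u - 2 * k * (I * β) - I * β) - edgeUpper β p t (u + I * β) := by
  induction k with
  | zero => simp [edgeAmp_mul_robinDefect]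
  | succ k ih =>
    rw [Finset.sum_range_succ, ih fun j hj => hu j (by omega), edgeAmp_mul_robinDefect,
      ← edgeUpper_eq_edgeLower hβ hε (hu k (by omega))]
    have : u - 2 * ((k + 1 : ℕ) : ℂ) * (I * β) + I * β = u - 2 * k * (I * β) - I * β := by
      push_cast; ring
    rw [this]
    ring

open Complex in
theorem differentiableAt_edgeUpper (hβ : 0 < β) {v : ℂ} (hv : |v.im - β| < β + Real.pi / 2) :
    DifferentiableAt ℂ (edgeUpper β p t) v := by
  have h : DifferentiableAt ℂ (fun v => edgeAmp β p (v - I * β)) v := by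
    refine DifferentiableAt.comp (g := edgeAmp β p) v (differentiableAt_edgeAmp hβ ?_) (by fun_prop)
    simpa using hv
  unfold edgeUpper
  fun_prop

open Complex in
theorem exists_norm_edgeAmp_le (hβ : 0 < β) (hβ' : β < Real.pi / 2) : ∃ C : ℝ, ∀ x y : ℝ,
    |y| ≤ 2 * β → ‖edgeAmp β p (x + y * I)‖ ≤
      Real.exp (Real.pi / (4 * β) * |x| + C + p * (Real.pi / β) * x) := by
  obtain ⟨C, hC⟩ := exists_re_malyuzhinetsLog_le hβ (by linarith : 0 ≤ 2 * β)
    (by linarith : 2 * β < β + Real.pi / 2)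
  refine ⟨C, fun x y hy => ?_⟩
  rw [edgeAmp, norm_exp, Real.exp_le_exp, add_re]
  have : ((p : ℂ) * (Real.pi / β) * (x + y * I)).re = p * (Real.pi / β) * x := by
    rw [show (p : ℂ) * (Real.pi / β) * (x + y * I) =
      ((p * (Real.pi / β) : ℝ) : ℂ) * (x + y * I) by push_cast; ring, re_ofReal_mul]
    simp
  rw [this]
  linarith [hC x y hy]

theorem norm_edgeAmp_ofReal_le (hβ : 0 < β) (x : ℝ) :
    ‖edgeAmp β p x‖ ≤ Real.exp (Real.pi / (4 * β) * |x| + p * (Real.pi / β) * x) := by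
  rw [edgeAmp, Complex.norm_exp, Real.exp_le_exp, Complex.add_re]
  have : ((p : ℂ) * (Real.pi / β) * x).re = p * (Real.pi / β) * x := by
    rw [show (p : ℂ) * (Real.pi / β) * x = ((p * (Real.pi / β) * x : ℝ) : ℂ) by push_cast; ring,
      Complex.ofReal_re]
  rw [this]
  linarith [re_malyuzhinetsLog_ofReal_le hβ x]

open Complex in
-- To the right, Re e^v ≥ e^x cos β makes e^{-t e^v} doubly exponentially small. To the left, the
-- growth π/(4β)|x| of the Malyuzhinets logarithm competes with p(π/β)x, which leaves the rate (p -
-- 1/4)π/β.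
theorem exists_norm_edgeUpper_le (hβ : 0 < β) (hβ' : β < Real.pi / 2) (ht : 0 < t)
    (hp0 : 0 ≤ p) : ∃ C X : ℝ, 0 ≤ C ∧ ∀ x y : ℝ, |y| ≤ β → X ≤ |x| →
      ‖edgeUpper β p t (x + y * I)‖ ≤ C * Real.exp (-((p - 1 / 4) * (Real.pi / β)) * |x|) := by
  obtain ⟨C, hC⟩ := exists_norm_edgeAmp_le (p := p) hβ hβ'
  have hcos : 0 < Real.cos β := Real.cos_pos_of_mem_Ioo ⟨by linarith, hβ'⟩
  -- Chosen so that e^{x - Ax} = e^{-2p(π/β)x}, enough to reverse the growth e^{p(π/β)x}. The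
  -- threshold for |x| is where t cos β · x²/2 ≥ Ax.
  set A : ℝ := 2 * p * (Real.pi / β) + 1 with hA
  have hA0 : 0 ≤ A := by positivity
  refine ⟨2 * Real.exp C, 2 * A / (t * Real.cos β), by positivity, fun x y hy hx => ?_⟩
  have hy2 : |y - β| ≤ 2 * β := by
    rw [abs_le] at hy ⊢; constructor <;> linarith
  have h1 := hC x (y - β) hy2
  have e1 : (x : ℂ) + y * I - I * β = x + ((y - β : ℝ) : ℂ) * I := by push_cast; ring
  have hexp : exp ((x : ℂ) + y * I) = (Real.exp x : ℝ) * exp (y * I) := by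
    rw [exp_add, ofReal_exp]
  have h2 : ‖1 + I * exp ((x : ℂ) + y * I)‖ ≤ 1 + Real.exp x := by
    refine (norm_add_le _ _).trans ?_
    rw [norm_one, norm_mul, norm_I, one_mul, norm_exp]
    simp
  have h3 : ‖exp (-(t * exp ((x : ℂ) + y * I)))‖ ≤ Real.exp (-(t * Real.cos β * Real.exp x)) := by
    rw [norm_exp, Real.exp_le_exp, neg_re, re_ofReal_mul, hexp, re_polar, neg_le_neg_iff]
    have := cos_le_cos_of_abs_le hβ' hy
    have hx0 := Real.exp_pos x
    calc t * Real.cos β * Real.exp x = t * (Real.exp x * Real.cos β) := by ring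
      _ ≤ _ := by gcongr
  have hmain : (1 + Real.exp x) * Real.exp (-(t * Real.cos β * Real.exp x)) ≤
      2 * Real.exp (-(p * (Real.pi / β)) * (|x| + x)) := by
    rcases le_total 0 x with h | h
    · rw [abs_of_nonneg h] at hx ⊢
      have h4 := Real.quadratic_le_exp_of_nonneg h
      have h5 : A * x ≤ t * Real.cos β * Real.exp x := by
        rw [div_le_iff₀ (by positivity)] at hx
        have h6 : x ^ 2 / 2 ≤ Real.exp x := by linarith
        calc A * x = (2 * A) * (x / 2) := by ring
          _ ≤ x * (t * Real.cos β) * (x / 2) := by gcongr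
          _ = t * Real.cos β * (x ^ 2 / 2) := by ring
          _ ≤ _ := by gcongr
      have h7 : 1 + Real.exp x ≤ 2 * Real.exp x := by linarith [Real.one_le_exp h]
      calc _ ≤ 2 * Real.exp x * Real.exp (-(A * x)) := by gcongr
        _ = _ := by rw [mul_assoc, ← Real.exp_add, hA]; ring_nf
    · rw [abs_of_nonpos h]
      have h4 : Real.exp x ≤ 1 := Real.exp_le_one_iff.2 h
      have h5 : Real.exp (-(t * Real.cos β * Real.exp x)) ≤ 1 :=
        Real.exp_le_one_iff.2 (neg_nonpos.2 (by positivity))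
      simp only [neg_add_cancel, mul_zero, Real.exp_zero, mul_one]
      calc _ ≤ (1 + 1) * (1 : ℝ) := by gcongr
        _ = 2 := by norm_num
  rw [edgeUpper, norm_mul, norm_mul, e1]
  calc _ ≤ (1 + Real.exp x) * Real.exp (Real.pi / (4 * β) * |x| + C + p * (Real.pi / β) * x) *
        Real.exp (-(t * Real.cos β * Real.exp x)) := by gcongr
    _ = (1 + Real.exp x) * Real.exp (-(t * Real.cos β * Real.exp x)) *
        Real.exp (Real.pi / (4 * β) * |x| + C + p * (Real.pi / β) * x) := by ring
    _ ≤ 2 * Real.exp (-(p * (Real.pi / β)) * (|x| + x)) *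
        Real.exp (Real.pi / (4 * β) * |x| + C + p * (Real.pi / β) * x) := by gcongr
    _ = _ := by
      rw [mul_assoc, ← Real.exp_add, mul_assoc (2 : ℝ) (Real.exp C), ← Real.exp_add]
      congr 2
      field_simp
      ring

end Edge

/-! ### The contour shift and the density of the Laplace integral. -/

section Strip

variable {β p t s : ℝ}

open Complex in
theorem norm_exp_pi_div (β x y : ℝ) :
    ‖exp (Real.pi / β * (x + y * I))‖ = Real.exp (Real.pi / β * x) := by
  rw [norm_exp, show (Real.pi : ℂ) / β * (x + y * I) = ((Real.pi / β : ℝ) : ℂ) * (x + y * I) by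
    push_cast; ring, re_ofReal_mul]
  simp

open Complex in
theorem half_le_norm_exp_pi_div_sub (hβ : 0 < β) {z : ℂ} (hz : ‖z‖ = 1) {x : ℝ} (hx : β ≤ |x|)
    (y : ℝ) : 1 / 2 ≤ ‖exp (Real.pi / β * (x + y * I)) - z‖ := by
  have h1 := norm_sub_norm_le (exp (Real.pi / β * (x + y * I))) z
  have h2 := norm_sub_norm_le z (exp (Real.pi / β * (x + y * I)))
  rw [norm_sub_rev] at h2
  rw [norm_exp_pi_div, hz] at h1 h2
  have hpi := Real.pi_gt_three
  rcases le_total 0 x with h | h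
  · rw [abs_of_nonneg h] at hx
    have h3 : Real.pi ≤ Real.pi / β * x := by
      rw [div_mul_eq_mul_div, le_div_iff₀ hβ]; gcongr
    have := Real.add_one_le_exp (Real.pi / β * x)
    linarith
  · rw [abs_of_nonpos h] at hx
    have h3 : Real.pi ≤ -(Real.pi / β * x) := by
      rw [← mul_neg, div_mul_eq_mul_div, le_div_iff₀ hβ]; gcongr
    have h4 := Real.add_one_le_exp (-(Real.pi / β * x))
    have h5 : Real.exp (Real.pi / β * x) * Real.exp (-(Real.pi / β * x)) = 1 := by
      rw [← Real.exp_add]; simp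
    have h6 := Real.exp_pos (Real.pi / β * x)
    nlinarith

open Complex in
/-- The unimodular number `-e^{i π s / β}`. -/
noncomputable def poleValue (β s : ℝ) : ℂ := -exp (Real.pi / β * (s * I))

open Complex in
theorem norm_poleValue (β s : ℝ) : ‖poleValue β s‖ = 1 := by
  have := norm_exp_pi_div β 0 s
  rw [poleValue, norm_neg]
  simpa using this

open Complex in
theorem poleValue_ne_one (hβ : 0 < β) (hs : |s| < β) : poleValue β s ≠ 1 := by
  intro h
  have h1 : Real.cos (Real.pi / β * s) = -1 := by
    have h2 := congrArg re h
    rw [poleValue, show (Real.pi : ℂ) / β * (s * I) = ((Real.pi / β * s : ℝ) : ℂ) * I by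
      push_cast; ring, neg_re, exp_ofReal_mul_I_re, one_re] at h2
    linarith
  have h2 : |Real.pi / β * s| < Real.pi := by
    rw [abs_mul, abs_of_pos (by positivity), div_mul_eq_mul_div, div_lt_iff₀ hβ]
    gcongr
  have h3 : Real.cos Real.pi < Real.cos |Real.pi / β * s| :=
    Real.cos_lt_cos_of_nonneg_of_le_pi (abs_nonneg _) le_rfl h2
  rw [Real.cos_abs, h1, Real.cos_pi] at h3
  exact lt_irrefl _ h3

open Complex in
theorem exp_pi_div_ofReal_sub_ne_zero (hβ : 0 < β) (hs : |s| < β) (x : ℝ) :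
    (Real.exp (Real.pi / β * x) : ℂ) - poleValue β s ≠ 0 := by
  intro h
  have h1 : (Real.exp (Real.pi / β * x) : ℂ) = poleValue β s := sub_eq_zero.1 h
  have h2 := norm_poleValue β s
  rw [← h1, norm_real, Real.norm_of_nonneg (Real.exp_pos _).le] at h2
  rw [h2] at h1
  exact poleValue_ne_one hβ hs (by rw [← h1]; simp)

open Complex MeasureTheory in
/-- The residue formula for the integrals over the two sides of the strip `|Im v| ≤ β`. -/
theorem integral_edgeUpper_strip (hβ : 0 < β) (hβ' : β < Real.pi / 2) (ht : 0 < t)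
    (hp : 1 / 4 < p) (hs : |s| < β) :
    Integrable (fun x : ℝ => edgeUpper β p t (x - I * β) /
      (Real.exp (Real.pi / β * x) - poleValue β s)) ∧
    Integrable (fun x : ℝ => edgeUpper β p t (x + I * β) /
      (Real.exp (Real.pi / β * x) - poleValue β s)) ∧
    (∫ x : ℝ, edgeUpper β p t (x - I * β) / (Real.exp (Real.pi / β * x) - poleValue β s)) -
      (∫ x : ℝ, edgeUpper β p t (x + I * β) / (Real.exp (Real.pi / β * x) - poleValue β s)) =
      2 * I * β * edgeUpper β p t (s * I) / poleValue β s := by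
  have hβc : (β : ℂ) ≠ 0 := by exact_mod_cast hβ.ne'
  have hpic : (Real.pi : ℂ) ≠ 0 := by exact_mod_cast Real.pi_ne_zero
  obtain ⟨C, X, hC, hT⟩ := exists_norm_edgeUpper_le (p := p) hβ hβ' ht (by linarith)
  set δ := (p - 1 / 4) * (Real.pi / β) with hδ
  have hδ0 : 0 < δ := mul_pos (by linarith) (by positivity)
  -- As e^{πv/β} changes sign from Im v = 0 to Im v = ±β, 1/D takes on both edges of the strip the
  -- values of the real kernel. Its only pole in the strip is v = is, by 2iβ-periodicity.
  set D : ℂ → ℂ := fun v => -exp (Real.pi / β * v) - poleValue β s with hD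
  have hDd : ∀ v, HasDerivAt D (-(exp (Real.pi / β * v) * (Real.pi / β))) v := fun v => by
    have := (((hasDerivAt_id v).const_mul ((Real.pi : ℂ) / β)).cexp.neg).sub_const (poleValue β s)
    simpa [hD] using this
  have hX0 : poleValue β s ≠ 0 := by
    rw [← norm_ne_zero_iff, norm_poleValue]; exact one_ne_zero
  have hdecay : ∀ x y : ℝ, -β ≤ y → y ≤ β → max X β ≤ |x| →
      ‖edgeUpper β p t (x + y * I) / D (x + y * I)‖ ≤ 2 * C * Real.exp (-δ * |x|) := by
    intro x y h1 h2 h3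
    have h4 := half_le_norm_exp_pi_div_sub hβ (z := -poleValue β s)
      (by rw [norm_neg, norm_poleValue]) ((le_max_right X β).trans h3) y
    have h5 : ‖D (x + y * I)‖ = ‖exp (Real.pi / β * (x + y * I)) - -poleValue β s‖ := by
      rw [← norm_neg]; congr 1; simp only [hD]; ring
    rw [norm_div, h5, div_le_iff₀ (by linarith)]
    calc _ ≤ C * Real.exp (-δ * |x|) := hT x y (abs_le.2 ⟨h1, h2⟩) ((le_max_left X β).trans h3)
      _ = 2 * C * Real.exp (-δ * |x|) * (1 / 2) := by ring
      _ ≤ _ := by gcongr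
  have hline : ∀ x : ℝ, ∀ σ : ℝ, (σ = β ∨ σ = -β) →
      D (x + σ * I) = Real.exp (Real.pi / β * x) - poleValue β s := by
    intro x σ hσ
    simp only [hD]
    have : exp (Real.pi / β * (x + σ * I)) = -exp (Real.pi / β * x) := by
      rw [mul_add, exp_add]
      rcases hσ with rfl | rfl
      · rw [show (Real.pi : ℂ) / σ * (σ * I) = Real.pi * I by field_simp, exp_pi_mul_I]; ring
      · rw [show (Real.pi : ℂ) / β * ((-β : ℝ) * I) = -(Real.pi * I) by push_cast; field_simp,
          exp_neg, exp_pi_mul_I]; norm_num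
    rw [this]; push_cast; ring
  have hlineT : ∀ x : ℝ, (x : ℂ) + (-β : ℝ) * I = x - I * β ∧ (x : ℂ) + (β : ℝ) * I = x + I * β :=
    fun x => ⟨by push_cast; ring, by ring⟩
  have hTd : ∀ v : ℂ, -β ≤ v.im → v.im ≤ β → DifferentiableAt ℂ (edgeUpper β p t) v :=
    fun v h1 h2 => differentiableAt_edgeUpper hβ (by
      rw [abs_lt]; constructor <;> linarith)
  have hint : ∀ σ : ℝ, (σ = β ∨ σ = -β) → Integrable (fun x : ℝ => edgeUpper β p t (x + σ * I) /
      (Real.exp (Real.pi / β * x) - poleValue β s)) := by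
    intro σ hσ
    have hσ1 : -β ≤ σ ∧ σ ≤ β := by rcases hσ with rfl | rfl <;> constructor <;> linarith
    have hc : Continuous (fun x : ℝ => edgeUpper β p t (x + σ * I) /
        (Real.exp (Real.pi / β * x) - poleValue β s)) := by
      refine Continuous.div ?_ (by fun_prop) fun x => exp_pi_div_ofReal_sub_ne_zero hβ hs x
      refine continuous_iff_continuousAt.2 fun x => ?_
      have h1 := (hTd (x + σ * I) (by simpa using hσ1.1) (by simpa using hσ1.2)).continuousAt
      exact ContinuousAt.comp (f := fun x : ℝ => (x : ℂ) + σ * I) h1 (by fun_prop)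
    refine hc.integrable_of_exp_decay (C := 2 * C) (X := max X β) hδ0 fun x hx => ?_
    rw [← hline x σ hσ]
    exact hdecay x σ hσ1.1 hσ1.2 hx
  refine ⟨by simpa only [hlineT] using hint (-β) (Or.inr rfl),
    by simpa only [hlineT] using hint β (Or.inl rfl), ?_⟩
  have hs' := abs_lt.1 hs
  have main := integral_div_sub_integral_div_strip (a := -β) (b := β) (v₀ := s * I)
    (M := edgeUpper β p t) (D := D) (by simpa using hs'.1) (by simpa using hs'.2)
    (fun v hv => (hTd v hv.1 hv.2).differentiableWithinAt)
    (fun v => (hDd v).differentiableAt)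
    (by simp [hD, poleValue])
    (by rw [(hDd _).deriv]; simp [hβc, hpic])
    (by
      intro v h1 h2 h
      have h3 : exp (Real.pi / β * v) = exp (Real.pi / β * (s * I)) := by
        simp only [hD, poleValue] at h
        linear_combination -h
      obtain ⟨k, hk⟩ := exp_eq_exp_iff_exists_int.1 h3
      have e : v = s * I + k * (2 * β * I) := by
        have : (Real.pi : ℂ) / β * v = Real.pi / β * (s * I + k * (2 * β * I)) := by
          rw [hk]; field_simp
        exact mul_left_cancel₀ (div_ne_zero hpic hβc) this
      have him : v.im = s + k * (2 * β) := by
        rw [e, show (s : ℂ) * I + k * (2 * β * I) = ((s + k * (2 * β) : ℝ) : ℂ) * I by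
          push_cast; ring]
        simp
      rw [him] at h1 h2
      have k1 : (k : ℝ) < 1 := by by_contra hk1; nlinarith
      have k2 : (-1 : ℝ) < k := by by_contra hk1; nlinarith
      have : k = 0 := by
        have h1' : k < 1 := by exact_mod_cast k1
        have h2' : -1 < k := by exact_mod_cast k2
        omega
      rw [e, this]; simp)
    hδ0 hdecay
  simp only [fun x => hline x β (Or.inl rfl), fun x => hline x (-β) (Or.inr rfl)] at main
  simp only [hlineT] at main
  rw [main, (hDd _).deriv]
  have : exp (Real.pi / β * (s * I)) = -poleValue β s := by rw [poleValue, neg_neg]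
  rw [this]
  field_simp

open Complex in
/-- The density of the Laplace integral in the solution. -/
noncomputable def edgeDensity (β p s : ℝ) (x : ℝ) : ℂ :=
  edgeAmp β p x * (1 / (Real.exp (Real.pi / β * x) - poleValue β s) -
    1 / (Real.exp (Real.pi / β * x) - poleValue β (-s)))

theorem continuous_edgeDensity (hβ : 0 < β) (hs : |s| < β) : Continuous (edgeDensity β p s) := by
  have h : Continuous fun x : ℝ => edgeAmp β p x := continuous_iff_continuousAt.2 fun x => by
    have h1 := (differentiableAt_edgeAmp (p := p) hβ (u := x) (by simp; positivity)).continuousAt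
    exact ContinuousAt.comp (f := fun x : ℝ => (x : ℂ)) h1 (by fun_prop)
  refine h.mul (Continuous.sub ?_ ?_)
  · exact continuous_const.div (by fun_prop) fun x => exp_pi_div_ofReal_sub_ne_zero hβ hs x
  · exact continuous_const.div (by fun_prop) fun x =>
      exp_pi_div_ofReal_sub_ne_zero hβ (by rwa [abs_neg]) x

/-- The difference of the squares of the two sides is (1 + Re z)(1 - Y)²/2 ≥ 0. -/
theorem norm_one_sub_mul_le {z : ℂ} (hz : ‖z‖ = 1) (Y : ℝ) :
    ‖1 - z‖ / 2 * (1 + Y) ≤ ‖(Y : ℂ) - z‖ := by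
  have h1 : z.re ^ 2 + z.im ^ 2 = 1 := by
    have := Complex.sq_norm_sub_sq_re z; rw [hz] at this; linarith
  have h2 : ‖1 - z‖ ^ 2 = (1 - z.re) ^ 2 + z.im ^ 2 := by
    have := Complex.sq_norm_sub_sq_re (1 - z); simp at this; linarith
  have h3 : ‖(Y : ℂ) - z‖ ^ 2 = (Y - z.re) ^ 2 + z.im ^ 2 := by
    have := Complex.sq_norm_sub_sq_re (Y - z); simp at this; linarith
  refine le_of_sq_le_sq ?_ (norm_nonneg _)
  rw [h3, mul_pow, div_pow, h2]
  have h4 : 0 ≤ 1 + z.re := by nlinarith [sq_nonneg (z.im)]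
  nlinarith [mul_nonneg h4 (sq_nonneg (1 - Y))]

/-- Subtracting the two kernels improves their decay to (1 + Y)^{-2}. In units of π/β the exponents
are then p + 1/4 - 2 at +∞ and 1/4 - p at -∞; both give decay at rate at least 1/2 exactly when 3/4
≤ p ≤ 5/4. -/
theorem exists_norm_edgeDensity_le (hβ : 0 < β) (hs : |s| < β) (hp : 3 / 4 ≤ p) (hp' : p ≤ 5 / 4) :
    ∃ C, 0 ≤ C ∧ ∀ x, ‖edgeDensity β p s x‖ ≤ C * Real.exp (-(Real.pi / (2 * β)) * |x|) := by
  set c := ‖1 - poleValue β s‖ / 2 with hc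
  set c' := ‖1 - poleValue β (-s)‖ / 2 with hc'
  have hs' : |-s| < β := by rwa [abs_neg]
  have hc0 : 0 < c := by
    have := norm_pos_iff.2 (sub_ne_zero.2 (poleValue_ne_one hβ hs).symm); positivity
  have hc0' : 0 < c' := by
    have := norm_pos_iff.2 (sub_ne_zero.2 (poleValue_ne_one hβ hs').symm); positivity
  refine ⟨2 / (c * c'), by positivity, fun x => ?_⟩
  set Y := Real.exp (Real.pi / β * x) with hY
  have hY0 : 0 < Y := Real.exp_pos _
  have h1 := norm_one_sub_mul_le (norm_poleValue β s) Y
  have h2 := norm_one_sub_mul_le (norm_poleValue β (-s)) Y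
  have n1 : (Y : ℂ) - poleValue β s ≠ 0 := exp_pi_div_ofReal_sub_ne_zero hβ hs x
  have n2 : (Y : ℂ) - poleValue β (-s) ≠ 0 := exp_pi_div_ofReal_sub_ne_zero hβ hs' x
  have h3 : ‖1 / ((Y : ℂ) - poleValue β s) - 1 / ((Y : ℂ) - poleValue β (-s))‖ ≤
      2 / (c * c' * (1 + Y) ^ 2) := by
    rw [div_sub_div _ _ n1 n2, norm_div, norm_mul]
    have h4 : ‖1 * ((Y : ℂ) - poleValue β (-s)) - ((Y : ℂ) - poleValue β s) * 1‖ ≤ 2 := by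
      rw [show 1 * ((Y : ℂ) - poleValue β (-s)) - ((Y : ℂ) - poleValue β s) * 1 =
        poleValue β s - poleValue β (-s) by ring]
      refine (norm_sub_le _ _).trans ?_
      rw [norm_poleValue, norm_poleValue]; norm_num
    have h5 : c * c' * (1 + Y) ^ 2 ≤ ‖(Y : ℂ) - poleValue β s‖ * ‖(Y : ℂ) - poleValue β (-s)‖ := by
      calc c * c' * (1 + Y) ^ 2 = (c * (1 + Y)) * (c' * (1 + Y)) := by ring
        _ ≤ _ := by gcongr
    gcongr
  have hpi : 0 < Real.pi / β := by positivity
  have e4 : Real.pi / (4 * β) = Real.pi / β / 4 := by field_simp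
  have e2 : Real.pi / (2 * β) = Real.pi / β / 2 := by field_simp
  have h6 : Real.exp (Real.pi / (4 * β) * |x| + p * (Real.pi / β) * x) ≤
      Real.exp (-(Real.pi / (2 * β)) * |x|) * (1 + Y) ^ 2 := by
    rw [e4, e2]
    generalize Real.pi / β = q at hpi hY
    rcases le_total 0 x with h | h
    · rw [abs_of_nonneg h]
      have h7 : Y ^ 2 ≤ (1 + Y) ^ 2 := by gcongr; linarith
      have h8 : Y ^ 2 = Real.exp (2 * (q * x)) := by rw [hY, ← Real.exp_nat_mul]; norm_num
      refine le_trans ?_ (mul_le_mul_of_nonneg_left h7 (Real.exp_pos _).le)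
      rw [h8, ← Real.exp_add, Real.exp_le_exp]
      have : 0 ≤ q * x := by positivity
      nlinarith
    · rw [abs_of_nonpos h]
      have h7 : 1 ≤ (1 + Y) ^ 2 := by nlinarith
      refine le_trans ?_ (mul_le_mul_of_nonneg_left h7 (Real.exp_pos _).le)
      rw [mul_one, Real.exp_le_exp]
      have : 0 ≤ q * -x := mul_nonneg hpi.le (by linarith)
      nlinarith
  rw [edgeDensity, norm_mul]
  calc _ ≤ Real.exp (-(Real.pi / (2 * β)) * |x|) * (1 + Y) ^ 2 * (2 / (c * c' * (1 + Y) ^ 2)) := by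
        gcongr
        exact (norm_edgeAmp_ofReal_le hβ x).trans h6
    _ = _ := by field_simp

end Strip

/-! ### Construction of the edge profiles. -/

section Profile

variable {β p t s : ℝ} {ε : ℂ}

open Complex MeasureTheory in
theorem robinDefect_laplaceLog (hβ0 : 0 < β) (hβ' : β < Real.pi / 2) (ht : 0 < t) {D : ℝ → ℂ}
    {C μ : ℝ} (hD : Continuous D) (hμ : 0 < μ) (hb : ∀ x, ‖D x‖ ≤ C * Real.exp (-μ * |x|)) :
    robinDefect β ε t (laplaceLog D) = ∫ x : ℝ, D x * robinDefect β ε t (expAtom x) := by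
  obtain ⟨r1, r2⟩ := re_ray_pos hβ0 hβ' ht
  obtain ⟨a1, b1, d1⟩ := hasDerivAt_laplaceLog hD hμ hb r1
  obtain ⟨a2, b2, d2⟩ := hasDerivAt_laplaceLog hD hμ hb r2
  have hpt : ∀ x : ℝ, D x * robinDefect β ε t (expAtom x) =
      I * exp (β * I) * -(Real.exp x * (exp (-(t * exp (β * I) * Real.exp x)) * D x)) -
        exp (-(t * exp (β * I) * Real.exp x)) * D x -
      ε * (exp (-(t * exp (-(β * I)) * Real.exp x)) * D x +
        I * exp (-(β * I)) * -(Real.exp x * (exp (-(t * exp (-(β * I)) * Real.exp x)) * D x))) := by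
    intro x
    simp only [robinDefect, (hasDerivAt_expAtom _ _).deriv, expAtom, ofReal_exp]
    ring
  simp only [hpt]
  rw [integral_sub ((b1.const_mul _).sub' a1) ((a2.fun_add (b2.const_mul _)).const_mul _),
    integral_sub (b1.const_mul _) a1, integral_const_mul, integral_const_mul,
    integral_add a2 (b2.const_mul _), integral_const_mul, robinDefect, d1.deriv, d2.deriv]
  rfl

open Complex MeasureTheory in
-- The defect of each exponential is T(x - iβ) - T(x + iβ), so the integral is a difference over the
-- two edges of the strip, and only the residues at ±is survive.
theorem robinDefect_laplaceLog_edgeDensity (hβ : 0 < β) (hβ' : β < Real.pi / 2) (ht : 0 < t)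
    (hp : 3 / 4 ≤ p) (hp' : p ≤ 5 / 4) (hε : ε * I * exp (2 * Real.pi * p * I) = 1) (hs : |s| < β) :
    robinDefect β ε t (laplaceLog (edgeDensity β p s)) =
      2 * I * β * edgeUpper β p t (s * I) / poleValue β s -
        2 * I * β * edgeUpper β p t (-(s * I)) / poleValue β (-s) := by
  obtain ⟨C, -, hC⟩ := exists_norm_edgeDensity_le hβ hs hp hp'
  obtain ⟨i1, i2, e1⟩ := integral_edgeUpper_strip (t := t) hβ hβ' ht (by linarith : 1 / 4 < p) hs
  obtain ⟨i3, i4, e2⟩ := integral_edgeUpper_strip (s := -s) (t := t) hβ hβ' ht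
    (by linarith : 1 / 4 < p) (by rwa [abs_neg])
  rw [ofReal_neg, neg_mul] at e2
  rw [robinDefect_laplaceLog hβ hβ' ht (continuous_edgeDensity hβ hs) (by positivity) hC, ← e1,
    ← e2, ← integral_sub i1 i2, ← integral_sub i3 i4, ← integral_sub (i1.sub' i2) (i3.sub' i4)]
  congr 1; ext x
  have h := edgeAmp_mul_robinDefect (β := β) (p := p) (ε := ε) (t := t) x
  rw [← edgeUpper_eq_edgeLower hβ hε (by simpa [abs_of_pos hβ] using hβ')] at h
  rw [edgeDensity]
  linear_combination (1 / ((Real.exp (Real.pi / β * x) : ℂ) - poleValue β s) -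
    1 / ((Real.exp (Real.pi / β * x) : ℂ) - poleValue β (-s))) * h

open Complex in
theorem edgeUpper_pi_div_two (β p t : ℝ) : edgeUpper β p t (I * (Real.pi / 2)) = 0 := by
  rw [edgeUpper, mul_comm I (Real.pi / 2 : ℂ), exp_pi_div_two_mul_I, I_mul_I]; simp

open Complex in
theorem edgeLower_neg_pi_div_two (β p t : ℝ) (ε : ℂ) :
    edgeLower β p ε t (-(I * (Real.pi / 2))) = 0 := by
  rw [edgeLower, mul_comm I (Real.pi / 2 : ℂ), exp_neg, exp_pi_div_two_mul_I, mul_inv_cancel₀ I_ne_zero]; simp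

/-- The phase shift `π² / (8β) - π / 4` of the plane waves. -/
noncomputable def edgePhase (β : ℝ) : ℝ := Real.pi / 4 * (Real.pi / (2 * β) - 1)

open Complex in
theorem edgeAmp_neg (β p : ℝ) (u : ℂ) :
    edgeAmp β p (-u) = exp (malyuzhinetsLog β u - p * (Real.pi / β) * u) := by
  rw [edgeAmp, malyuzhinetsLog_neg]; congr 1; ring

open Complex in
/-- The point `u` for which `e^{-w e^u}` is the plane wave of the side `arg w = β`. -/
noncomputable def edgeTop (β : ℝ) : ℂ := I * (Real.pi / 2 - β)

open Complex in
theorem edgeTop_sub (β : ℝ) (j : ℕ) :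
    edgeTop β - 2 * j * (I * β) = ((Real.pi / 2 - β - 2 * j * β : ℝ) : ℂ) * I := by
  rw [edgeTop]; push_cast; ring

open Complex in
-- Once e^{πu/β} is split off the amplitude, the exponent p becomes p - 1 = -ε/4, and its value at
-- `edgeTop β` is the phase of the plane wave.
theorem edgePhase_factor (hβ : 0 < β) (ε : ℝ) :
    (((1 - ε / 4 : ℝ) : ℂ) - 1) * (Real.pi / β) * edgeTop β = -(I * ε * edgePhase β) := by
  have hβc : (β : ℂ) ≠ 0 := by exact_mod_cast hβ.ne'
  rw [edgeTop, edgePhase]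
  push_cast
  field_simp
  ring

/-- A decaying `g` which, added to the two plane waves with amplitudes `e^{∓iεσ}`, satisfies the
Robin condition. -/
def HasEdgeProfile (β ε : ℝ) : Prop :=
  ∃ g, IsDecayingProfile β (Real.pi / (2 * β)) g ∧ ∀ t : ℝ, 0 < t →
    robinDefect β ε t (fun w => Complex.exp (-(Complex.I * ε * edgePhase β)) * expAtom (edgeTop β) w +
      Complex.exp (Complex.I * ε * edgePhase β) * expAtom (-edgeTop β) w + g w) = 0

theorem hasEdgeProfile_of_scaled {β ε : ℝ} (hβ : 0 < β) (hβ' : β < Real.pi / 2) {κ : ℂ} (hκ : κ ≠ 0)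
    {g f : ℂ → ℂ} (hg : IsDecayingProfile β (Real.pi / (2 * β)) g)
    (hf : ∀ w, f w = κ * Complex.exp (-(Complex.I * ε * edgePhase β)) * expAtom (edgeTop β) w +
      κ * Complex.exp (Complex.I * ε * edgePhase β) * expAtom (-edgeTop β) w + g w)
    (hd : ∀ t : ℝ, 0 < t → robinDefect β ε t f = 0) : HasEdgeProfile β ε := by
  refine ⟨fun w => κ⁻¹ * g w, hg.const_mul hβ' _, fun t ht => ?_⟩
  have hfd : ∀ w : ℂ, 0 < w.re → DifferentiableAt ℂ f w := fun w hw => by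
    rw [funext hf]
    exact (((hasDerivAt_expAtom _ w).differentiableAt.const_mul _).add
      ((hasDerivAt_expAtom _ w).differentiableAt.const_mul _)).add (hg.differentiableAt w hw)
  have e : (fun w => Complex.exp (-(Complex.I * ε * edgePhase β)) * expAtom (edgeTop β) w +
      Complex.exp (Complex.I * ε * edgePhase β) * expAtom (-edgeTop β) w + κ⁻¹ * g w) =
      fun w => κ⁻¹ * f w := by
    funext w
    rw [hf]
    field_simp
  rw [e, robinDefect_const_mul hβ hβ' ht hfd, hd t ht, mul_zero]

theorem differentiableAt_mul_expAtom (c u w : ℂ) :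
    DifferentiableAt ℂ (fun w => c * expAtom u w) w :=
  (hasDerivAt_expAtom u w).differentiableAt.const_mul c

theorem robinDefect_sum_mul_expAtom (hβ : 0 < β) (hβ' : β < Real.pi / 2) (ht : 0 < t) (n : ℕ)
    (c u : ℕ → ℂ) :
    robinDefect β ε t (fun w => ∑ j ∈ Finset.range n, c j * expAtom (u j) w) =
      ∑ j ∈ Finset.range n, c j * robinDefect β ε t (expAtom (u j)) := by
  rw [robinDefect_sum hβ hβ' ht _ fun i _ w _ => differentiableAt_mul_expAtom _ _ w]
  exact Finset.sum_congr rfl fun j _ => robinDefect_const_mul hβ hβ' ht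
    (fun w _ => (hasDerivAt_expAtom _ w).differentiableAt) _

open Complex in
theorem isDecayingProfile_ladder {μ : ℝ} (hβ : 0 < β) (hβ' : β < Real.pi / 2) (n : ℕ)
    (c u : ℕ → ℂ) (φ : ℕ → ℝ) (hu : ∀ j < n, u j = φ j * I)
    (hφ : ∀ j < n, |φ j| + β < Real.pi / 2) :
    IsDecayingProfile β μ (fun w => ∑ j ∈ Finset.range n, c j * expAtom (u j) w) :=
  .sum hβ' _ fun j hj => by
    rw [hu j (Finset.mem_range.1 hj)]
    exact (isDecayingProfile_expAtom μ hβ (hφ j (Finset.mem_range.1 hj))).const_mul hβ' _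

open Complex in
/-- Angles `2β = π / (2n + 1)`: a finite sum of exponentials. -/
theorem hasEdgeProfile_of_odd {β ε : ℝ} (hβ : 0 < β) (hβ' : β < Real.pi / 2)
    (hε : (ε : ℂ) * I * exp (2 * Real.pi * (1 - ε / 4 : ℝ) * I) = 1) {m : ℕ}
    (hm : Real.pi / 2 = (2 * (m + 1) + 1) * β) : HasEdgeProfile β ε := by
  set p : ℝ := 1 - ε / 4 with hp
  have hβc : (β : ℂ) ≠ 0 := by exact_mod_cast hβ.ne'
  have hmc : (Real.pi : ℂ) = 2 * ((2 * (m + 1) + 1) * β) := by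
    have : Real.pi = 2 * ((2 * (m + 1) + 1) * β) := by linarith
    exact_mod_cast this
  set u : ℕ → ℂ := fun j => edgeTop β - 2 * j * (I * β) with hu
  have hu0 : u 0 = edgeTop β := by simp [hu]
  have hulast : u (2 * m + 1 + 1) = -edgeTop β := by
    simp only [hu, edgeTop, hmc]; push_cast; ring
  -- Here π/2 - β = 2(m + 1)β, so the factor e^{πu/β} equals 1 at both plane waves, and their
  -- amplitudes differ by a phase only.
  have hX : exp ((Real.pi / β) * edgeTop β) = 1 := by
    rw [exp_eq_one_iff]
    refine ⟨m + 1, ?_⟩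
    rw [edgeTop]
    push_cast
    have : (Real.pi : ℂ) / 2 - β = 2 * (m + 1) * β := by rw [hmc]; ring
    rw [this]
    field_simp
  have hph := edgePhase_factor hβ ε
  rw [← hp] at hph
  have n1 : edgeAmp β p (edgeTop β) =
      exp (malyuzhinetsLog β (edgeTop β)) * exp (-(I * ε * edgePhase β)) := by
    rw [← hph, ← exp_add, edgeAmp]
    have : malyuzhinetsLog β (edgeTop β) + p * (Real.pi / β) * edgeTop β =
      (malyuzhinetsLog β (edgeTop β) + (p - 1) * (Real.pi / β) * edgeTop β) +
        (Real.pi / β) * edgeTop β := by ring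
    rw [this, exp_add _ ((Real.pi : ℂ) / β * edgeTop β), hX, mul_one]
  have n2 : edgeAmp β p (-edgeTop β) =
      exp (malyuzhinetsLog β (edgeTop β)) * exp (I * ε * edgePhase β) := by
    rw [← neg_neg (I * ε * edgePhase β), ← hph, ← exp_add, edgeAmp_neg]
    have : malyuzhinetsLog β (edgeTop β) - p * (Real.pi / β) * edgeTop β =
      (malyuzhinetsLog β (edgeTop β) + -((p - 1) * (Real.pi / β) * edgeTop β)) -
        (Real.pi / β) * edgeTop β := by ring
    rw [this, exp_sub _ ((Real.pi : ℂ) / β * edgeTop β), hX, div_one]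
  refine hasEdgeProfile_of_scaled (κ := exp (malyuzhinetsLog β (edgeTop β))) hβ hβ'
    (exp_ne_zero _)
    (g := fun w => ∑ j ∈ Finset.range (2 * m + 1), edgeAmp β p (u (j + 1)) * expAtom (u (j + 1)) w)
    (f := fun w => ∑ j ∈ Finset.range (2 * m + 1 + 1 + 1), edgeAmp β p (u j) * expAtom (u j) w)
    ?_ ?_ ?_
  · refine isDecayingProfile_ladder hβ hβ' _ _ _
      (fun j => Real.pi / 2 - β - 2 * ((j + 1 : ℕ) : ℝ) * β)
      (fun j _ => edgeTop_sub β (j + 1)) fun j hj => ?_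
    have hj' : (j : ℝ) + 1 ≤ 2 * m + 1 := by exact_mod_cast hj
    have hj0 : (0 : ℝ) ≤ j := Nat.cast_nonneg j
    rw [← lt_sub_iff_add_lt, abs_lt]
    push_cast
    constructor <;> nlinarith
  · intro w
    rw [Finset.sum_range_succ, Finset.sum_range_succ', hu0, hulast, n1, n2]
    ring
  · intro t ht
    rw [robinDefect_sum_mul_expAtom hβ hβ' ht]
    have := sum_edgeAmp_mul_robinDefect (t := t) hβ hε (edgeTop β) (2 * m + 1 + 1) fun j hj => by
      rw [edgeTop_sub, show ((Real.pi / 2 - β - 2 * j * β : ℝ) : ℂ) * I - I * β =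
        ((Real.pi / 2 - 2 * (j + 1) * β : ℝ) : ℂ) * I by push_cast; ring]
      have hj' : (j : ℝ) + 1 ≤ 2 * m + 2 := by exact_mod_cast hj
      have hj0 : (0 : ℝ) ≤ j := Nat.cast_nonneg j
      rw [im_ofReal_mul, I_im, mul_one, abs_lt]
      have := Real.pi_pos
      constructor <;> nlinarith
    refine this.trans ?_
    rw [show edgeTop β - 2 * ((2 * m + 1 + 1 : ℕ) : ℂ) * (I * β) - I * β = -(I * (Real.pi / 2)) by
        rw [edgeTop, hmc]; push_cast; ring,
      show edgeTop β + I * β = I * (Real.pi / 2) by rw [edgeTop]; ring,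
      edgeUpper_pi_div_two, edgeLower_neg_pi_div_two, sub_zero]

open Complex in
/-- The other angles: two finite ladders of exponentials and a Laplace integral. -/
theorem hasEdgeProfile_of_abs_lt {β ε : ℝ} (hβ : 0 < β) (hβ' : β < Real.pi / 2) (hε1 : |ε| ≤ 1)
    (hε : (ε : ℂ) * I * exp (2 * Real.pi * (1 - ε / 4 : ℝ) * I) = 1) {m : ℕ}
    (hm : |Real.pi / 2 - 2 * (m + 1) * β| < β) : HasEdgeProfile β ε := by
  obtain ⟨hε2, hε3⟩ := abs_le.1 hε1
  set p : ℝ := 1 - ε / 4 with hp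
  set s : ℝ := Real.pi / 2 - 2 * (m + 1) * β with hs
  have hm' := abs_lt.1 hm
  have hβc : (β : ℂ) ≠ 0 := by exact_mod_cast hβ.ne'
  have hsc : (Real.pi : ℂ) = 2 * (s + 2 * (m + 1) * β) := by
    have : Real.pi = 2 * (s + 2 * (m + 1) * β) := by rw [hs]; ring
    exact_mod_cast this
  have hp1 : 3 / 4 ≤ p := by rw [hp]; linarith
  have hp2 : p ≤ 5 / 4 := by rw [hp]; linarith
  -- The first ladder descends from the upper wave to i(s + β). The second is its mirror image under
  -- u ↦ -u and descends from -i(s + β) to the lower wave.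
  set u : ℕ → ℂ := fun j => edgeTop β - 2 * j * (I * β) with hu
  set u' : ℕ → ℂ := fun j => -u m - 2 * j * (I * β) with hu'
  have hu0 : u 0 = edgeTop β := by simp [hu]
  have hulast : u' m = -edgeTop β := by simp only [hu', hu]; ring
  have hXs : exp ((Real.pi / β) * edgeTop β) = poleValue β s := by
    have e1 : (Real.pi : ℂ) / β * edgeTop β =
        Real.pi / β * (s * I) + ((m : ℤ) * (2 * Real.pi * I) + Real.pi * I) := by
      have : (Real.pi : ℂ) / 2 - β = s + (2 * m + 1) * β := by rw [hsc]; ring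
      rw [edgeTop, this]; push_cast; field_simp
    rw [e1, exp_add, exp_add, exp_int_mul_two_pi_mul_I, exp_pi_mul_I, poleValue]; ring
  have hXs' : exp (-((Real.pi / β) * edgeTop β)) = poleValue β (-s) := by
    rw [exp_neg, hXs, poleValue, poleValue, ofReal_neg, neg_mul, mul_neg, exp_neg, inv_neg]
  have hph := edgePhase_factor hβ ε
  rw [← hp] at hph
  set κ : ℂ := -(2 * I * β) * exp (malyuzhinetsLog β (edgeTop β)) with hκ
  -- The division by the pole value, forced by the residue, also removes e^{πu/β}: both waves
  -- receive the same constant κ up to the phase.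
  have n1 : -(2 * I * β / poleValue β s) * edgeAmp β p (edgeTop β) =
      κ * exp (-(I * ε * edgePhase β)) := by
    rw [← hph, hκ, mul_assoc (-(2 * I * (β : ℂ))), ← exp_add, ← hXs, edgeAmp]
    have : malyuzhinetsLog β (edgeTop β) + p * (Real.pi / β) * edgeTop β =
      (malyuzhinetsLog β (edgeTop β) + (p - 1) * (Real.pi / β) * edgeTop β) +
        (Real.pi / β) * edgeTop β := by ring
    rw [this, exp_add _ ((Real.pi : ℂ) / β * edgeTop β)]
    have := exp_ne_zero ((Real.pi : ℂ) / β * edgeTop β)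
    field_simp
  have n2 : -(2 * I * β / poleValue β (-s)) * edgeAmp β p (-edgeTop β) =
      κ * exp (I * ε * edgePhase β) := by
    rw [← neg_neg (I * ε * edgePhase β), ← hph, hκ, mul_assoc (-(2 * I * (β : ℂ))), ← exp_add, ← hXs', edgeAmp_neg]
    have : malyuzhinetsLog β (edgeTop β) - p * (Real.pi / β) * edgeTop β =
      (malyuzhinetsLog β (edgeTop β) + -((p - 1) * (Real.pi / β) * edgeTop β)) +
        -((Real.pi / β) * edgeTop β) := by ring
    rw [this, exp_add _ (-((Real.pi : ℂ) / β * edgeTop β))]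
    have := exp_ne_zero (-((Real.pi : ℂ) / β * edgeTop β))
    field_simp
  obtain ⟨C, hC0, hC⟩ := exists_norm_edgeDensity_le (p := p) hβ hm hp1 hp2
  have hL : IsDecayingProfile β (Real.pi / (2 * β)) (laplaceLog (edgeDensity β p s)) :=
    isDecayingProfile_laplaceLog hβ hβ' (continuous_edgeDensity hβ hm) (by positivity) hC0 hC
  have hG : ∀ n, ∀ v : ℕ → ℂ, ∀ w : ℂ, 0 < w.re → DifferentiableAt ℂ
      (fun w => ∑ j ∈ Finset.range n, edgeAmp β p (v j) * expAtom (v j) w) w := fun n v w _ =>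
    DifferentiableAt.fun_sum fun j _ => differentiableAt_mul_expAtom _ _ w
  refine hasEdgeProfile_of_scaled (κ := κ) hβ hβ'
    (mul_ne_zero (by simp [hβc]) (exp_ne_zero _))
    (g := fun w => laplaceLog (edgeDensity β p s) w +
      (-(2 * I * β / poleValue β s) *
        ∑ j ∈ Finset.range m, edgeAmp β p (u (j + 1)) * expAtom (u (j + 1)) w +
      -(2 * I * β / poleValue β (-s)) *
        ∑ j ∈ Finset.range m, edgeAmp β p (u' j) * expAtom (u' j) w))
    (f := fun w => laplaceLog (edgeDensity β p s) w +
      (-(2 * I * β / poleValue β s) *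
        ∑ j ∈ Finset.range (m + 1), edgeAmp β p (u j) * expAtom (u j) w +
      -(2 * I * β / poleValue β (-s)) *
        ∑ j ∈ Finset.range (m + 1), edgeAmp β p (u' j) * expAtom (u' j) w))
    ?_ ?_ ?_
  · refine hL.add hβ' (.add hβ' (.const_mul hβ' ?_ _) (.const_mul hβ' ?_ _))
    · refine isDecayingProfile_ladder hβ hβ' _ _ _
        (fun j => Real.pi / 2 - β - 2 * ((j + 1 : ℕ) : ℝ) * β)
        (fun j _ => edgeTop_sub β (j + 1)) fun j hj => ?_
      have hj' : (j : ℝ) + 1 ≤ m := by exact_mod_cast hj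
      have hj0 : (0 : ℝ) ≤ j := Nat.cast_nonneg j
      rw [← lt_sub_iff_add_lt, abs_lt]
      push_cast
      constructor <;> nlinarith
    · refine isDecayingProfile_ladder hβ hβ' _ _ _
        (fun j => -(Real.pi / 2 - β - 2 * m * β) - 2 * j * β)
        (fun j _ => by simp only [hu', hu]; rw [edgeTop_sub]; push_cast; ring) fun j hj => ?_
      have hj' : (j : ℝ) + 1 ≤ m := by exact_mod_cast hj
      have hj0 : (0 : ℝ) ≤ j := Nat.cast_nonneg j
      rw [← lt_sub_iff_add_lt, abs_lt]
      constructor <;> nlinarith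
  · intro w
    rw [Finset.sum_range_succ', hu0, Finset.sum_range_succ (fun j => edgeAmp β p (u' j) * _), hulast]
    linear_combination expAtom (edgeTop β) w * n1 + expAtom (-edgeTop β) w * n2
  · intro t ht
    have s1 := sum_edgeAmp_mul_robinDefect (t := t) hβ hε (edgeTop β) m fun j hj => by
      rw [edgeTop_sub, show ((Real.pi / 2 - β - 2 * j * β : ℝ) : ℂ) * I - I * β =
        ((Real.pi / 2 - 2 * (j + 1) * β : ℝ) : ℂ) * I by push_cast; ring]
      have hj' : (j : ℝ) + 1 ≤ m := by exact_mod_cast hj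
      have hj0 : (0 : ℝ) ≤ j := Nat.cast_nonneg j
      rw [im_ofReal_mul, I_im, mul_one, abs_lt]
      constructor <;> nlinarith
    have s2 := sum_edgeAmp_mul_robinDefect (t := t) hβ hε (-u m) m fun j hj => by
      rw [show -u m - 2 * j * (I * β) - I * β =
        ((-(Real.pi / 2 - 2 * m * β) - 2 * j * β : ℝ) : ℂ) * I by
          simp only [hu, edgeTop]; push_cast; ring]
      have hj' : (j : ℝ) + 1 ≤ m := by exact_mod_cast hj
      have hj0 : (0 : ℝ) ≤ j := Nat.cast_nonneg j
      rw [im_ofReal_mul, I_im, mul_one, abs_lt]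
      constructor <;> nlinarith
    rw [show edgeTop β - 2 * (m : ℂ) * (I * β) - I * β = s * I by
        rw [edgeTop, hsc]; ring,
      show edgeTop β + I * β = I * (Real.pi / 2) by rw [edgeTop]; ring,
      edgeUpper_pi_div_two, sub_zero, ← edgeUpper_eq_edgeLower hβ hε (by
        rw [im_ofReal_mul, I_im, mul_one]; exact hm.trans hβ')] at s1
    rw [show -u m - 2 * (m : ℂ) * (I * β) - I * β = -(I * (Real.pi / 2)) by
        simp only [hu, edgeTop]; ring,
      show -u m + I * β = -(s * I) by simp only [hu, edgeTop]; rw [hsc]; ring,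
      edgeLower_neg_pi_div_two, zero_sub] at s2
    rw [robinDefect_add hβ hβ' ht hL.differentiableAt (fun w hw => ((hG _ _ w hw).const_mul _).fun_add
        ((hG _ _ w hw).const_mul _)),
      robinDefect_add hβ hβ' ht (fun w hw => (hG _ _ w hw).const_mul _)
        (fun w hw => (hG _ _ w hw).const_mul _),
      robinDefect_const_mul hβ hβ' ht (hG _ _), robinDefect_const_mul hβ hβ' ht (hG _ _),
      robinDefect_sum_mul_expAtom hβ hβ' ht, robinDefect_sum_mul_expAtom hβ hβ' ht, s1, s2,
      robinDefect_laplaceLog_edgeDensity hβ hβ' ht hp1 hp2 hε hm]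
    ring

open Complex in
theorem hasEdgeProfile {β ε : ℝ} (hβ : 0 < β) (hβ' : β < Real.pi / 2) (hε : ε = 1 ∨ ε = -1) :
    HasEdgeProfile β ε := by
  have hε' : (ε : ℂ) * I * exp (2 * Real.pi * (1 - ε / 4 : ℝ) * I) = 1 := by
    rcases hε with rfl | rfl
    · rw [show (2 : ℂ) * Real.pi * (1 - 1 / 4 : ℝ) * I = Real.pi * I + Real.pi / 2 * I by
        push_cast; ring, exp_add, exp_pi_mul_I, exp_pi_div_two_mul_I]
      push_cast
      linear_combination -I_sq
    · rw [show (2 : ℂ) * Real.pi * (1 - -1 / 4 : ℝ) * I = 2 * Real.pi * I + Real.pi / 2 * I by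
        push_cast; ring, exp_add, exp_two_pi_mul_I, exp_pi_div_two_mul_I]
      push_cast
      linear_combination -I_sq
  have hε1 : |ε| ≤ 1 := by rcases hε with rfl | rfl <;> simp
  -- the integer part of `π / (4β) + 1/2`
  set y : ℝ := Real.pi / (4 * β) + 1 / 2 with hy
  have hy1 : 1 < y := by
    have : 1 / 2 < Real.pi / (4 * β) := by rw [lt_div_iff₀ (by positivity)]; linarith
    rw [hy]; linarith
  have hyβ : Real.pi / 2 = (2 * y - 1) * β := by rw [hy]; field_simp; ring
  obtain ⟨m, hm⟩ : ∃ m : ℕ, ⌊y⌋₊ = m + 1 :=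
    Nat.exists_eq_succ_of_ne_zero (Nat.floor_pos.2 hy1.le).ne'
  have h1 : ((m : ℝ) + 1) ≤ y := by
    have := Nat.floor_le (by linarith : 0 ≤ y); rw [hm] at this; exact_mod_cast this
  have h2 : y < (m : ℝ) + 1 + 1 := by
    have := Nat.lt_floor_add_one y; rw [hm] at this; exact_mod_cast this
  -- Since π/2 = (2y - 1)β, equality y = m + 1 means that π/(2β) = 2m + 1, and y > 1 excludes m = 0.
  -- Otherwise s = (2(y - m) - 3)β lies strictly between -β and β.
  rcases h1.eq_or_lt with h | h
  · obtain _ | k := m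
    · norm_num at h; linarith
    · exact hasEdgeProfile_of_odd hβ hβ' hε' (m := k) (by
        rw [hyβ, ← h]; push_cast; ring)
  · refine hasEdgeProfile_of_abs_lt hβ hβ' hε1 hε' (m := m) ?_
    rw [hyβ, abs_lt]
    constructor <;> nlinarith

end Profile

/-! ### Geometry of the sector. -/

section SectorGeometry

open Complex

theorem im_polar (ρ θ : ℝ) : (ρ * exp (θ * I)).im = ρ * Real.sin θ := by
  rw [im_ofReal_mul, exp_ofReal_mul_I_im]

/-- As α < π, the sector is an intersection of two half-planes, from which openness and convexity
follow. -/
theorem mem_sector_iff {α : ℝ} (hα0 : 0 < α) (hα : α < Real.pi) {z : ℂ} :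
    z ∈ sector α ↔ z.im < 0 ∧ 0 < (z * exp (α * I)).im := by
  have hz : (‖z‖ : ℂ) * exp (z.arg * I) = z := norm_mul_exp_arg_mul_I z
  have e1 : z.im = ‖z‖ * Real.sin z.arg := by rw [← im_polar, hz]
  have e2 : (z * exp (α * I)).im = ‖z‖ * Real.sin (z.arg + α) := by
    rw [← im_polar]
    conv_lhs => rw [← hz]
    rw [mul_assoc, ← exp_add]; push_cast; ring_nf
  have hp := neg_pi_lt_arg z
  have hn := norm_nonneg z
  constructor
  · rintro ⟨h1, h2⟩
    have hz0 : 0 < ‖z‖ := norm_pos_iff.2 fun h => by rw [h, arg_zero] at h2; exact lt_irrefl _ h2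
    refine ⟨arg_neg_iff.1 h2, ?_⟩
    rw [e2]
    exact mul_pos hz0 (Real.sin_pos_of_pos_of_lt_pi (by linarith) (by linarith))
  · rintro ⟨h1, h2⟩
    have h3 := arg_neg_iff.2 h1
    refine ⟨?_, h3⟩
    by_contra h4
    rw [e2] at h2
    have := Real.sin_nonpos_of_nonpos_of_neg_pi_le (x := z.arg + α) (by linarith) (by linarith)
    nlinarith

theorem isOpen_sector {α : ℝ} (hα0 : 0 < α) (hα : α < Real.pi) : IsOpen (sector α) := by
  have : sector α = {z | z.im < 0} ∩ {z | 0 < (z * exp (α * I)).im} := by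
    ext z; exact mem_sector_iff hα0 hα
  rw [this]
  exact (isOpen_lt continuous_im continuous_const).inter
    (isOpen_lt continuous_const (by fun_prop))

theorem convex_sector {α : ℝ} (hα0 : 0 < α) (hα : α < Real.pi) : Convex ℝ (sector α) := by
  intro x hx y hy a b ha hb hab
  rw [mem_sector_iff hα0 hα] at hx hy ⊢
  have e1 : (a • x + b • y).im = a * x.im + b * y.im := by simp
  have e2 : ((a • x + b • y) * exp (α * I)).im =
      a * (x * exp (α * I)).im + b * (y * exp (α * I)).im := by
    rw [add_mul, add_im, smul_mul_assoc, smul_mul_assoc, smul_im, smul_im]; rfl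
  rw [e1, e2]
  have h1 := hx.1; have h2 := hx.2; have h3 := hy.1; have h4 := hy.2
  rcases ha.eq_or_lt with h | h
  · have : b = 1 := by linarith
    rw [← h, this]; constructor <;> linarith
  · constructor
    · nlinarith [mul_pos_of_neg_of_neg (by linarith : -a < 0) h1,
        mul_nonneg hb (by linarith : 0 ≤ -y.im)]
    · nlinarith [mul_pos h h2, mul_nonneg hb h4.le]

theorem polar_mem_sector {α ρ θ : ℝ} (hα : α < Real.pi) (hρ : 0 < ρ)
    (h1 : -α < θ) (h2 : θ < 0) : (ρ : ℂ) * exp (θ * I) ∈ sector α := by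
  have : ((ρ : ℂ) * exp (θ * I)).arg = θ := by
    rw [arg_real_mul _ hρ, arg_exp_mul_I, toIocMod_eq_self]
    constructor <;> linarith [Real.pi_pos]
  exact ⟨by rw [this]; exact h1, by rw [this]; exact h2⟩

theorem polar_mem_closure_sector {α ρ θ : ℝ} (hα0 : 0 < α) (hα : α < Real.pi) (hρ : 0 < ρ)
    (h1 : -α ≤ θ) (h2 : θ ≤ 0) : (ρ : ℂ) * exp (θ * I) ∈ closure (sector α) := by
  have hc : Continuous fun θ : ℝ => (ρ : ℂ) * exp (θ * I) := by fun_prop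
  have h3 := image_closure_subset_closure_image hc (s := Set.Ioo (-α) 0)
  rw [closure_Ioo (by linarith)] at h3
  exact closure_mono (by
    rintro _ ⟨φ, hφ, rfl⟩
    exact polar_mem_sector hα hρ hφ.1 hφ.2) (h3 ⟨θ, ⟨h1, h2⟩, rfl⟩)

theorem uniqueDiffOn_closure_sector {α : ℝ} (hα0 : 0 < α) (hα : α < Real.pi) :
    UniqueDiffOn ℝ (closure (sector α)) := by
  refine uniqueDiffOn_convex (convex_sector hα0 hα).closure ?_
  refine Set.Nonempty.mono (interior_mono subset_closure) ?_
  rw [(isOpen_sector hα0 hα).interior_eq]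
  exact ⟨_, polar_mem_sector (ρ := 1) (θ := -(α / 2)) hα one_pos (by linarith) (by linarith)⟩

/-- The rotated closed sector meets the imaginary axis only at 0. Functions holomorphic in the right
half-plane are therefore smooth across the open sides, and only the vertex needs separate
continuity. -/
theorem re_rotate_pos {β : ℝ} (hβ : 0 < β) (hβ' : β < Real.pi / 2) {z : ℂ}
    (hz : z ∈ closure (sector (2 * β))) :
    0 ≤ (z * exp (β * I)).re ∧ (z ≠ 0 → 0 < (z * exp (β * I)).re) := by
  have hK : closure (sector (2 * β)) ⊆ {z | z.im ≤ 0} ∩ {z | 0 ≤ (z * exp ((2 * β : ℝ) * I)).im} := by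
    refine closure_minimal ?_ ((isClosed_le continuous_im continuous_const).inter
      (isClosed_le continuous_const (by fun_prop)))
    intro z hz
    have := (mem_sector_iff (by linarith) (by linarith)).1 hz
    exact ⟨this.1.le, this.2.le⟩
  obtain ⟨h1, h2⟩ := hK hz
  set w := z * exp (β * I) with hw
  have hsin : 0 < Real.sin β := Real.sin_pos_of_pos_of_lt_pi hβ (by linarith)
  have hcos : 0 < Real.cos β := Real.cos_pos_of_mem_Ioo ⟨by linarith, hβ'⟩
  have ez : z = w * exp ((-β : ℝ) * I) := by
    rw [hw, mul_assoc, ← exp_add]; push_cast; simp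
  have ez2 : z * exp ((2 * β : ℝ) * I) = w * exp (β * I) := by
    rw [hw, mul_assoc, ← exp_add]; push_cast; ring_nf
  have i1 : z.im = w.im * Real.cos β - w.re * Real.sin β := by
    rw [ez, mul_im, exp_ofReal_mul_I_im, exp_ofReal_mul_I_re, Real.cos_neg, Real.sin_neg]; ring
  have i2 : (z * exp ((2 * β : ℝ) * I)).im = w.im * Real.cos β + w.re * Real.sin β := by
    rw [ez2, mul_im, exp_ofReal_mul_I_im, exp_ofReal_mul_I_re]; ring
  have h1' : z.im ≤ 0 := h1
  have h2' : 0 ≤ (z * exp ((2 * β : ℝ) * I)).im := h2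
  rw [i1] at h1'
  rw [i2] at h2'
  have hre : 0 ≤ w.re := by
    by_contra h
    nlinarith [mul_pos (by linarith : 0 < -w.re) hsin]
  refine ⟨hre, fun hz0 => hre.lt_of_ne fun h => hz0 ?_⟩
  rw [← h] at h1' h2'
  have him : w.im = 0 := by
    have a1 : w.im * Real.cos β ≤ 0 := by linarith
    have a2 : 0 ≤ w.im * Real.cos β := by linarith
    have a3 : w.im * Real.cos β = 0 := le_antisymm a1 a2
    exact (mul_eq_zero.1 a3).resolve_right hcos.ne'
  have hw0 : w = 0 := Complex.ext h.symm him
  rw [ez, hw0, zero_mul]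

theorem exists_polar_of_mem_sector {β : ℝ} {z : ℂ} (hz : z ∈ sector (2 * β)) :
    ∃ θ : ℝ, |θ| ≤ β ∧ z * exp (β * I) = ‖z‖ * exp (θ * I) ∧
      conj (z * exp (β * I)) = ‖z‖ * exp ((-θ : ℝ) * I) := by
  have e : z * exp (β * I) = ‖z‖ * exp ((z.arg + β : ℝ) * I) := by
    conv_lhs => rw [← norm_mul_exp_arg_mul_I z]
    rw [mul_assoc, ← exp_add]; push_cast; ring_nf
  refine ⟨z.arg + β, ?_, e, ?_⟩
  · have h1 := hz.1
    have h2 := hz.2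
    rw [abs_le]; constructor <;> linarith
  · rw [e, map_mul, conj_ofReal, ← exp_conj, map_mul, conj_ofReal, conj_I]
    push_cast; ring_nf

end SectorGeometry

/-! ### From holomorphic profiles to solutions in the sector. -/

section Assembly

open Complex

variable {β : ℝ} {f₁ f₂ : ℂ → ℂ}

/-- The harmonic function built from two holomorphic functions of the rotated variable
`w = z e^{iβ}`, for which the bisector is the positive real axis. -/
noncomputable def foldedWave (β : ℝ) (f₁ f₂ : ℂ → ℂ) (z : ℂ) : ℂ :=
  f₁ (z * exp (β * I)) + f₂ (conj (z * exp (β * I)))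

theorem exists_hasFDerivAt_foldedWave {z : ℂ} (h₁ : DifferentiableAt ℂ f₁ (z * exp (β * I)))
    (h₂ : DifferentiableAt ℂ f₂ (conj (z * exp (β * I)))) :
    ∃ L : ℂ →L[ℝ] ℂ, HasFDerivAt (foldedWave β f₁ f₂) L z ∧ ∀ v, L v =
      v * exp (β * I) * deriv f₁ (z * exp (β * I)) +
        conj (v * exp (β * I)) * deriv f₂ (conj (z * exp (β * I))) := by
  have a1 : HasFDerivAt (𝕜 := ℝ) (fun z : ℂ => z * exp (β * I)) _ z :=
    ((hasDerivAt_mul_const (exp (β * I))).hasFDerivAt (x := z)).restrictScalars ℝ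
  have a2 := conjCLE.hasFDerivAt.comp z a1
  have b1 := (h₁.hasDerivAt.hasFDerivAt.restrictScalars ℝ).comp z a1
  have b2 := HasFDerivAt.comp (f := conjCLE ∘ fun z : ℂ => z * exp (β * I)) z
    (h₂.hasDerivAt.hasFDerivAt.restrictScalars ℝ) a2
  exact ⟨_, b1.add b2, fun v => by simp⟩

theorem analyticAt_of_differentiable_rightHalfPlane {f : ℂ → ℂ}
    (hf : ∀ w : ℂ, 0 < w.re → DifferentiableAt ℂ f w) {w : ℂ} (hw : 0 < w.re) :
    AnalyticAt ℂ f w :=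
  DifferentiableOn.analyticAt (s := {w : ℂ | 0 < w.re})
    (fun v hv => (hf v hv).differentiableWithinAt)
    ((isOpen_lt continuous_const continuous_re).mem_nhds hw)

theorem contDiffAt_foldedWave {z : ℂ} (h₁ : AnalyticAt ℂ f₁ (z * exp (β * I)))
    (h₂ : AnalyticAt ℂ f₂ (conj (z * exp (β * I)))) : ContDiffAt ℝ 1 (foldedWave β f₁ f₂) z := by
  have a1 : ContDiffAt ℝ 1 (fun z : ℂ => z * exp (β * I)) z := by fun_prop
  have a2 : ContDiffAt ℝ 1 (fun z : ℂ => conj (z * exp (β * I))) z :=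
    conjCLE.contDiff.contDiffAt.comp z a1
  exact (ContDiffAt.comp z (h₁.contDiffAt.restrict_scalars ℝ) a1).add
    (ContDiffAt.comp (f := fun z : ℂ => conj (z * exp (β * I))) z
      (h₂.contDiffAt.restrict_scalars ℝ) a2)

/-- The second term is the conjugate of a holomorphic function of z, because conj ∘ f₂ ∘ conj is
holomorphic. -/
theorem harmonicAt_foldedWave {z : ℂ} (h₁ : AnalyticAt ℂ f₁ (z * exp (β * I)))
    (h₂ : AnalyticAt ℂ f₂ (conj (z * exp (β * I)))) :
    InnerProductSpace.HarmonicAt (foldedWave β f₁ f₂) z := by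
  have a1 : AnalyticAt ℂ (fun z : ℂ => z * exp (β * I)) z := by fun_prop
  have b1 : AnalyticAt ℂ (fun z : ℂ => f₁ (z * exp (β * I))) z :=
    AnalyticAt.comp (f := fun z : ℂ => z * exp (β * I)) h₁ a1
  have hc : AnalyticAt ℂ (conj ∘ f₂ ∘ conj) (z * exp (β * I)) := by
    rw [Complex.analyticAt_iff_eventually_differentiableAt] at h₂ ⊢
    have ht : Filter.Tendsto (fun w : ℂ => conj w) (nhds (z * exp (β * I)))
        (nhds (conj (z * exp (β * I)))) := continuous_conj.tendsto _
    filter_upwards [ht.eventually h₂] with w hw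
    have := hw.conj_conj
    rwa [conj_conj] at this
  have b2 : AnalyticAt ℂ (fun z : ℂ => conj (f₂ (conj (z * exp (β * I))))) z :=
    AnalyticAt.comp (f := fun z : ℂ => z * exp (β * I)) hc a1
  have h := b1.harmonicAt.add b2.harmonicAt_conj
  have e : foldedWave β f₁ f₂ = (fun z : ℂ => f₁ (z * exp (β * I))) +
      conj (fun z : ℂ => conj (f₂ (conj (z * exp (β * I))))) := by
    funext w
    simp [foldedWave]
  rw [e]
  exact h

theorem isRobinSolution_foldedWave (hβ : 0 < β) (hβ' : β < Real.pi / 2)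
    (hd₁ : ∀ w : ℂ, 0 < w.re → DifferentiableAt ℂ f₁ w)
    (hd₂ : ∀ w : ℂ, 0 < w.re → DifferentiableAt ℂ f₂ w)
    (hc₁ : ContinuousOn f₁ {w | 0 ≤ w.re}) (hc₂ : ContinuousOn f₂ {w | 0 ≤ w.re})
    (hout : ∀ t : ℝ, 0 < t → I * exp (β * I) * deriv f₁ (t * exp (β * I)) -
      I * exp (-(β * I)) * deriv f₂ (t * exp (-(β * I))) =
        f₁ (t * exp (β * I)) + f₂ (t * exp (-(β * I))))
    (hin : ∀ t : ℝ, 0 < t → I * exp (β * I) * deriv f₂ (t * exp (β * I)) -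
      I * exp (-(β * I)) * deriv f₁ (t * exp (-(β * I))) =
        f₂ (t * exp (β * I)) + f₁ (t * exp (-(β * I)))) :
    IsRobinSolution (2 * β) (foldedWave β f₁ f₂) := by
  have hα0 : 0 < 2 * β := by linarith
  have hα : 2 * β < Real.pi := by linarith
  have hpos : ∀ z ∈ closure (sector (2 * β)), z ≠ 0 → 0 < (z * exp (β * I)).re ∧
      0 < (conj (z * exp (β * I))).re := fun z hz h0 => by
    have := (re_rotate_pos hβ hβ' hz).2 h0
    exact ⟨this, by rwa [conj_re]⟩
  have han : ∀ z ∈ closure (sector (2 * β)), z ≠ 0 → AnalyticAt ℂ f₁ (z * exp (β * I)) ∧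
      AnalyticAt ℂ f₂ (conj (z * exp (β * I))) := fun z hz h0 =>
    ⟨analyticAt_of_differentiable_rightHalfPlane hd₁ (hpos z hz h0).1,
      analyticAt_of_differentiable_rightHalfPlane hd₂ (hpos z hz h0).2⟩
  have hconj : conj (exp (β * I)) = exp (-(β * I)) := by
    rw [← exp_conj, map_mul, conj_ofReal, conj_I, mul_neg]
  -- The function is differentiable in a full neighbourhood of each such point, so the derivative
  -- within the closed sector is the ordinary one.
  have hfd : ∀ z ∈ closure (sector (2 * β)), z ≠ 0 → ∀ v,
      fderivWithin ℝ (foldedWave β f₁ f₂) (closure (sector (2 * β))) z v =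
      v * exp (β * I) * deriv f₁ (z * exp (β * I)) +
        conj (v * exp (β * I)) * deriv f₂ (conj (z * exp (β * I))) := fun z hz h0 v => by
    obtain ⟨L, hL, hLv⟩ := exists_hasFDerivAt_foldedWave (β := β)
      (han z hz h0).1.differentiableAt (han z hz h0).2.differentiableAt
    rw [hL.hasFDerivWithinAt.fderivWithin (uniqueDiffOn_closure_sector hα0 hα z hz), hLv]
  refine ⟨?_, ?_, ?_, ?_, ?_⟩
  · intro z hz
    have h0 : z ≠ 0 := fun h => by
      have := hz.2; rw [h, arg_zero] at this; exact lt_irrefl _ this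
    obtain ⟨h1, h2⟩ := han z (subset_closure hz) h0
    exact harmonicAt_foldedWave h1 h2
  · refine ContinuousOn.add (hc₁.comp (by fun_prop) fun z hz => (re_rotate_pos hβ hβ' hz).1)
      (hc₂.comp (continuous_conj.comp (by fun_prop)).continuousOn fun z hz => ?_)
    change 0 ≤ (conj (z * exp (β * I))).re
    rw [conj_re]
    exact (re_rotate_pos hβ hβ' hz).1
  · rintro z ⟨hz, h0⟩
    obtain ⟨h1, h2⟩ := han z hz h0
    exact (contDiffAt_foldedWave h1 h2).contDiffWithinAt
  · rintro z ⟨t, ht, rfl⟩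
    have hz : (t : ℂ) ∈ closure (sector (2 * β)) := by
      simpa using polar_mem_closure_sector (θ := 0) hα0 hα ht (by linarith) le_rfl
    have h0 : (t : ℂ) ≠ 0 := by exact_mod_cast ht.ne'
    rw [hfd _ hz h0, foldedWave, map_mul, map_mul, conj_ofReal, conj_I, hconj, ← hout t ht]
    ring
  · rintro z ⟨t, ht, rfl⟩
    have hz : (t : ℂ) * exp (-((2 * β : ℝ) * I)) ∈ closure (sector (2 * β)) := by
      have := polar_mem_closure_sector (θ := -(2 * β)) hα0 hα ht le_rfl (by linarith)
      rwa [ofReal_neg, neg_mul] at this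
    have h0 : (t : ℂ) * exp (-((2 * β : ℝ) * I)) ≠ 0 :=
      mul_ne_zero (by exact_mod_cast ht.ne') (exp_ne_zero _)
    have e1 : exp (-((2 * β : ℝ) * I)) * exp (β * I) = exp (-(β * I)) := by
      rw [← exp_add]; push_cast; ring_nf
    have hconj' : conj (exp (-(β * I))) = exp (β * I) := by
      rw [← hconj, conj_conj]
    rw [hfd _ hz h0, foldedWave, mul_assoc (t : ℂ), mul_assoc (-I), e1, map_mul, map_mul, map_neg,
      conj_ofReal, conj_I, hconj', add_comm (f₁ _), ← hin t ht]
    ring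

/-- In the constant 4K, one factor 2 counts the two profiles and the other comes from a crude bound
of the gradient by twice the sum of the derivatives. -/
theorem remainderBound_foldedWave (hβ' : β < Real.pi / 2) {g₁ g₂ : ℂ → ℂ} {μ K : ℝ}
    (hd₁ : ∀ w : ℂ, 0 < w.re → DifferentiableAt ℂ g₁ w)
    (hd₂ : ∀ w : ℂ, 0 < w.re → DifferentiableAt ℂ g₂ w)
    (h₁ : ∀ ρ θ : ℝ, 1 ≤ ρ → |θ| ≤ β →
      ‖g₁ (ρ * exp (θ * I))‖ + ρ * ‖deriv g₁ (ρ * exp (θ * I))‖ ≤ K * ρ ^ (-μ))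
    (h₂ : ∀ ρ θ : ℝ, 1 ≤ ρ → |θ| ≤ β →
      ‖g₂ (ρ * exp (θ * I))‖ + ρ * ‖deriv g₂ (ρ * exp (θ * I))‖ ≤ K * ρ ^ (-μ)) :
    RemainderBound (2 * β) (foldedWave β g₁ g₂) μ (4 * K) 1 := by
  intro z hz hz1
  obtain ⟨θ, hθ, e1, e2⟩ := exists_polar_of_mem_sector hz
  have hρ : 0 < ‖z‖ := by linarith
  have b1 := h₁ ‖z‖ θ hz1 hθ
  have b2 := h₂ ‖z‖ (-θ) hz1 (by rwa [abs_neg])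
  rw [← e1] at b1
  rw [← e2] at b2
  obtain ⟨L, hL, hLv⟩ := exists_hasFDerivAt_foldedWave (β := β)
    (hd₁ (z * exp (β * I)) (by rw [e1]; exact re_polar_pos hβ' hρ hθ))
    (hd₂ (conj (z * exp (β * I))) (by rw [e2]; exact re_polar_pos hβ' hρ (by rwa [abs_neg])))
  set A := ‖deriv g₁ (z * exp (β * I))‖ with hA
  set B := ‖deriv g₂ (conj (z * exp (β * I)))‖ with hB
  have hn : ∀ v : ℂ, ‖v‖ = 1 → ‖L v‖ ≤ A + B := fun v hv => by
    rw [hLv]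
    refine (norm_add_le _ _).trans_eq ?_
    simp [hv, norm_exp_ofReal_mul_I, hA, hB]
  have hA0 : 0 ≤ A := norm_nonneg _
  have hB0 : 0 ≤ B := norm_nonneg _
  have hg : gradNorm (foldedWave β g₁ g₂) z ≤ 2 * (A + B) := by
    rw [gradNorm, hL.fderiv]
    refine Real.sqrt_le_iff.2 ⟨by positivity, ?_⟩
    have n1 := hn 1 (by simp)
    have n2 := hn I (by simp)
    have := pow_le_pow_left₀ (norm_nonneg _) n1 2
    have := pow_le_pow_left₀ (norm_nonneg _) n2 2
    nlinarith [sq_nonneg (A + B)]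
  have hs : ‖foldedWave β g₁ g₂ z‖ ≤ ‖g₁ (z * exp (β * I))‖ + ‖g₂ (conj (z * exp (β * I)))‖ :=
    norm_add_le _ _
  have hm := mul_le_mul_of_nonneg_left hg hρ.le
  have p1 := norm_nonneg (g₁ (z * exp (β * I)))
  have p2 := norm_nonneg (g₂ (conj (z * exp (β * I))))
  linarith

theorem waveOut_eq (h : EuclideanSpace ℂ (Fin 2)) (z : ℂ) :
    waveOut h z = h 0 * exp (I * conj z) + h 1 * exp (-(I * z)) := by
  have c1 : conj (exp (-(I * z.re))) = exp (I * z.re) := by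
    rw [← exp_conj, map_neg, map_mul, conj_I, conj_ofReal]; ring_nf
  have c2 : conj (exp (I * z.re)) = exp (-(I * z.re)) := by
    rw [← exp_conj, map_mul, conj_I, conj_ofReal]; ring_nf
  have e1 : exp (I * conj z) = exp z.im * exp (I * z.re) := by
    rw [← exp_add]; congr 1
    apply Complex.ext <;> simp
  have e2 : exp (-(I * z)) = exp z.im * exp (-(I * z.re)) := by
    rw [← exp_add]; congr 1
    apply Complex.ext <;> simp
  rw [waveOut, cdot, expVec]
  simp only [Matrix.cons_val_zero, Matrix.cons_val_one]
  rw [c1, c2, e1, e2, ofReal_exp]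
  ring

theorem expAtom_edgeTop (β : ℝ) (w : ℂ) :
    expAtom (edgeTop β) w = exp (-(I * (w * exp (-(β * I))))) ∧
    expAtom (-edgeTop β) w = exp (I * (w * exp (β * I))) := by
  have e1 : exp (edgeTop β) = I * exp (-(β * I)) := by
    rw [edgeTop, show I * ((Real.pi : ℂ) / 2 - β) = Real.pi / 2 * I + -(β * I) by ring, exp_add,
      exp_pi_div_two_mul_I]
  have e2 : exp (-edgeTop β) = -I * exp (β * I) := by
    rw [edgeTop, show -(I * ((Real.pi : ℂ) / 2 - β)) = β * I - Real.pi / 2 * I by ring, exp_sub,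
      exp_pi_div_two_mul_I]
    field_simp
    rw [I_sq]; ring
  rw [expAtom, expAtom, e1, e2]
  constructor <;> congr 1 <;> ring

/-- The exponent `edgeTop β` gives an outgoing term in w and an incoming one in conj w; for
`-edgeTop β` the roles are exchanged. Hence the crossed placement of the coefficients. -/
theorem waves_eq_foldedWave (β : ℝ) (a₁ a₂ b₁ b₂ : ℂ) (z : ℂ) :
    waveOut !₂[b₂, a₁] z + waveIn (2 * β) !₂[b₁, a₂] z =
      foldedWave β (fun w => a₁ * expAtom (edgeTop β) w + a₂ * expAtom (-edgeTop β) w)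
        (fun w => b₁ * expAtom (edgeTop β) w + b₂ * expAtom (-edgeTop β) w) z := by
  have hconj : conj (exp (β * I)) = exp (-(β * I)) := by
    rw [← exp_conj, map_mul, conj_ofReal, conj_I, mul_neg]
  have hconj' : conj (exp (-(β * I))) = exp (β * I) := by rw [← hconj, conj_conj]
  have hmul : exp (-(β * I)) * exp (β * I) = 1 := by rw [← exp_add]; simp
  have h2 : exp (-((2 * β : ℝ) * I)) = exp (-(β * I)) * exp (-(β * I)) := by
    rw [← exp_add]; push_cast; ring_nf
  rw [waveIn, waveOut_eq, waveOut_eq, reflect, foldedWave, h2]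
  simp only [expAtom_edgeTop, Matrix.cons_val_zero, Matrix.cons_val_one, map_mul,
    hconj, hconj', conj_conj]
  have r1 : z * exp (β * I) * exp (-(β * I)) = z := by rw [mul_assoc, mul_comm (exp _), hmul, mul_one]
  have r2 : conj z * exp (-(β * I)) * exp (β * I) = conj z := by rw [mul_assoc, hmul, mul_one]
  rw [r1, r2, show exp (-(β * I)) * exp (-(β * I)) * conj z =
    conj z * exp (-(β * I)) * exp (-(β * I)) by ring,
    show exp (β * I) * exp (β * I) * z = z * exp (β * I) * exp (β * I) by ring]
  ring

end Assembly

/-! ### Amplitudes of the solutions and the two cases of the theorem. -/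

section Main

open Complex

theorem RemainderBound.mono {α r C C' ρ₀ : ℝ} {R : ℂ → ℂ} (h : RemainderBound α R r C ρ₀)
    (hC : C ≤ C') : RemainderBound α R r C' ρ₀ := fun z hz hρ =>
  (h z hz hρ).trans (mul_le_mul_of_nonneg_right hC (Real.rpow_nonneg (norm_nonneg z) _))

/-- The two-parameter family of solutions: symmetric ones, with amplitude `a`, and antisymmetric
ones, with amplitude `b`. -/
theorem exists_robinSolution_family {β : ℝ} (hβ : 0 < β) (hβ' : β < Real.pi / 2) {E F : ℂ}
    (hE : E = exp (I * edgePhase β)) (hF : F = exp (-(I * edgePhase β))) :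
    ∃ K : ℝ, 0 < K ∧ ∀ a b : ℂ, ∃ Φ : ℂ → ℂ, IsRobinSolution (2 * β) Φ ∧
      RemainderBound (2 * β)
        (remainder (2 * β) !₂[a * F - b * E, a * E + b * F] !₂[a * E - b * F, a * F + b * E] Φ)
        (Real.pi / (2 * β)) (K * (‖a‖ + ‖b‖)) 1 := by
  obtain ⟨g, hg, hgd⟩ := hasEdgeProfile hβ hβ' (Or.inl rfl : (1 : ℝ) = 1 ∨ (1 : ℝ) = -1)
  obtain ⟨g', hg', hgd'⟩ := hasEdgeProfile hβ hβ' (Or.inr rfl : (-1 : ℝ) = 1 ∨ (-1 : ℝ) = -1)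
  simp only [ofReal_one, ofReal_neg, mul_one, mul_neg, neg_mul, neg_neg, ← hE, ← hF] at hgd hgd'
  set P : ℂ → ℂ := expAtom (edgeTop β) with hP
  set Q : ℂ → ℂ := expAtom (-edgeTop β) with hQ
  set f : ℂ → ℂ := fun w => F * P w + E * Q w + g w with hf
  set f' : ℂ → ℂ := fun w => E * P w + F * Q w + g' w with hf'
  have hPd : Differentiable ℂ P := fun w => (hasDerivAt_expAtom _ w).differentiableAt
  have hQd : Differentiable ℂ Q := fun w => (hasDerivAt_expAtom _ w).differentiableAt
  have hfd : ∀ w : ℂ, 0 < w.re → DifferentiableAt ℂ f w := fun w hw =>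
    (((hPd w).const_mul _).add ((hQd w).const_mul _)).add (hg.differentiableAt w hw)
  have hfd' : ∀ w : ℂ, 0 < w.re → DifferentiableAt ℂ f' w := fun w hw =>
    (((hPd w).const_mul _).add ((hQd w).const_mul _)).add (hg'.differentiableAt w hw)
  have hfc : ContinuousOn f {w | 0 ≤ w.re} :=
    ((continuousOn_const.mul hPd.continuous.continuousOn).add
      (continuousOn_const.mul hQd.continuous.continuousOn)).add hg.continuousOn
  have hfc' : ContinuousOn f' {w | 0 ≤ w.re} :=
    ((continuousOn_const.mul hPd.continuous.continuousOn).add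
      (continuousOn_const.mul hQd.continuous.continuousOn)).add hg'.continuousOn
  obtain ⟨C, hC, hCb⟩ := hg.decay
  obtain ⟨C', hC', hCb'⟩ := hg'.decay
  have hder : ∀ {u v : ℂ → ℂ}, (∀ w : ℂ, 0 < w.re → DifferentiableAt ℂ u w) →
      (∀ w : ℂ, 0 < w.re → DifferentiableAt ℂ v w) → ∀ (a b w : ℂ), 0 < w.re →
      HasDerivAt (fun w => a * u w + b * v w) (a * deriv u w + b * deriv v w) w :=
    fun hu hv a b w hw => ((hu w hw).hasDerivAt.const_mul a).add ((hv w hw).hasDerivAt.const_mul b)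
  have hbound : ∀ a b : ℂ, ∀ ρ θ : ℝ, 1 ≤ ρ → |θ| ≤ β →
      ‖a * g (ρ * exp (θ * I)) + b * g' (ρ * exp (θ * I))‖ +
        ρ * ‖deriv (fun w => a * g w + b * g' w) (ρ * exp (θ * I))‖ ≤
      ((C + C' + 1) * (‖a‖ + ‖b‖)) * ρ ^ (-(Real.pi / (2 * β))) := by
    intro a b ρ θ hρ hθ
    have hρ0 : 0 < ρ := by linarith
    have hre := re_polar_pos hβ' hρ0 hθ
    rw [(hder hg.differentiableAt hg'.differentiableAt a b _ hre).deriv]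
    have b1 := mul_le_mul_of_nonneg_left (hCb ρ θ hρ hθ) (norm_nonneg a)
    have b2 := mul_le_mul_of_nonneg_left (hCb' ρ θ hρ hθ) (norm_nonneg b)
    have n1 := norm_add_le (a * g (ρ * exp (θ * I))) (b * g' (ρ * exp (θ * I)))
    have n2 := mul_le_mul_of_nonneg_left (norm_add_le (a * deriv g (ρ * exp (θ * I)))
      (b * deriv g' (ρ * exp (θ * I)))) hρ0.le
    simp only [norm_mul a, norm_mul b] at n1 n2
    have hr : 0 ≤ ρ ^ (-(Real.pi / (2 * β))) := Real.rpow_nonneg hρ0.le _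
    have p1 : 0 ≤ ‖a‖ * (C' + 1) * ρ ^ (-(Real.pi / (2 * β))) := by positivity
    have p2 : 0 ≤ ‖b‖ * (C + 1) * ρ ^ (-(Real.pi / (2 * β))) := by positivity
    linarith
  -- The summand 1 keeps the constant positive even when both decay constants are zero.
  refine ⟨4 * (C + C' + 1), by positivity, fun a b => ?_⟩
  refine ⟨foldedWave β (fun w => a * f w + b * f' w) (fun w => a * f w + (-b) * f' w), ?_, ?_⟩
  · have hsplit : ∀ t : ℝ, 0 < t → _ := fun t ht => re_ray_pos hβ hβ' ht
    refine isRobinSolution_foldedWave hβ hβ'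
      (fun w hw => (hder hfd hfd' a b w hw).differentiableAt)
      (fun w hw => (hder hfd hfd' a (-b) w hw).differentiableAt)
      ((continuousOn_const.mul hfc).add (continuousOn_const.mul hfc'))
      ((continuousOn_const.mul hfc).add (continuousOn_const.mul hfc')) ?_ ?_
    · intro t ht
      obtain ⟨r1, r2⟩ := hsplit t ht
      have k1 := hgd t ht
      have k2 := hgd' t ht
      rw [(hder hfd hfd' a b _ r1).deriv, (hder hfd hfd' a (-b) _ r2).deriv]
      simp only [robinDefect] at k1 k2
      linear_combination a * k1 + b * k2
    -- On the other side f₁ and f₂ exchange roles, which amounts to changing the sign of b.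
    · intro t ht
      obtain ⟨r1, r2⟩ := hsplit t ht
      have k1 := hgd t ht
      have k2 := hgd' t ht
      rw [(hder hfd hfd' a (-b) _ r1).deriv, (hder hfd hfd' a b _ r2).deriv]
      simp only [robinDefect] at k1 k2
      linear_combination a * k1 - b * k2
  · have hR : remainder (2 * β) !₂[a * F - b * E, a * E + b * F] !₂[a * E - b * F, a * F + b * E]
        (foldedWave β (fun w => a * f w + b * f' w) (fun w => a * f w + (-b) * f' w)) =
        foldedWave β (fun w => a * g w + b * g' w) (fun w => a * g w + (-b) * g' w) := by
      funext z
      rw [remainder, sub_sub, waves_eq_foldedWave]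
      simp only [foldedWave, hf, hf', hP, hQ]
      ring
    rw [hR, mul_assoc]
    refine remainderBound_foldedWave hβ'
      (fun w hw => (hder hg.differentiableAt hg'.differentiableAt a b w hw).differentiableAt)
      (fun w hw => (hder hg.differentiableAt hg'.differentiableAt a (-b) w hw).differentiableAt)
      (hbound a b) fun ρ θ hρ hθ => ?_
    have := hbound a (-b) ρ θ hρ hθ
    rwa [norm_neg] at this

/-- Twice the phase is π²/(2α) - π/2 with α = 2β; this is how the angle of the transfer matrix
appears. -/
theorem exp_edgePhase_sq {β : ℝ} (hβ : 0 < β) :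
    exp (I * edgePhase β) ^ 2 = Real.sin (Real.pi ^ 2 / (2 * (2 * β))) -
      I * Real.cos (Real.pi ^ 2 / (2 * (2 * β))) ∧
    exp (-(I * edgePhase β)) ^ 2 = Real.sin (Real.pi ^ 2 / (2 * (2 * β))) +
      I * Real.cos (Real.pi ^ 2 / (2 * (2 * β))) := by
  set κ := Real.pi ^ 2 / (2 * (2 * β)) with hκ
  have hκ' : edgePhase β = (κ - Real.pi / 2) / 2 := by
    rw [edgePhase, hκ]; field_simp; norm_num
  have e : exp (I * κ) = Real.cos κ + Real.sin κ * I := by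
    rw [mul_comm, exp_mul_I, ofReal_cos, ofReal_sin]
  have e' : exp (-(I * κ)) = Real.cos κ - Real.sin κ * I := by
    rw [show -(I * (κ : ℂ)) = (-κ) * I by ring, exp_mul_I, cos_neg, sin_neg, ofReal_cos, ofReal_sin]
    ring
  rw [← exp_nat_mul, ← exp_nat_mul, hκ']
  constructor
  · rw [show ((2 : ℕ) : ℂ) * (I * (((κ - Real.pi / 2) / 2 : ℝ) : ℂ)) = I * κ - Real.pi / 2 * I by
      push_cast; ring, exp_sub, e, exp_pi_div_two_mul_I, div_eq_iff I_ne_zero]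
    linear_combination (Real.cos κ : ℂ) * I_sq
  · rw [show ((2 : ℕ) : ℂ) * -(I * (((κ - Real.pi / 2) / 2 : ℝ) : ℂ)) =
      -(I * κ) + Real.pi / 2 * I by push_cast; ring, exp_add, e', exp_pi_div_two_mul_I]
    linear_combination -(Real.sin κ : ℂ) * I_sq

theorem sin_ne_zero_of_notMem_exceptionalAngles {α : ℝ} (hα : 0 < α) (h : α ∉ exceptionalAngles) :
    Real.sin (Real.pi ^ 2 / (2 * α)) ≠ 0 := by
  intro hs
  obtain ⟨n, hn⟩ := Real.sin_eq_zero_iff.1 hs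
  have hpi := Real.pi_pos
  have h1 : (n : ℝ) * (2 * α) = Real.pi := by
    rw [eq_div_iff (by positivity)] at hn
    have : Real.pi * (n * (2 * α)) = Real.pi * Real.pi := by linarith
    exact mul_left_cancel₀ hpi.ne' this
  have hn0 : 0 < n := by
    have : (0 : ℝ) < n := by
      by_contra hneg
      nlinarith
    exact_mod_cast this
  lift n to ℕ using hn0.le
  refine h ⟨n, by exact_mod_cast hn0, ?_⟩
  have : (0 : ℝ) < n := by exact_mod_cast hn0
  rw [eq_div_iff (by positivity)]
  push_cast at h1
  linarith

theorem exp_I_mul_pi_div_four_sq : exp (I * (Real.pi / 4)) ^ 2 = I := by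
  rw [← exp_nat_mul, show ((2 : ℕ) : ℂ) * (I * (Real.pi / 4)) = Real.pi / 2 * I by push_cast; ring,
    exp_pi_div_two_mul_I]

/-- Orthogonality to `XEven` and `XOdd`, in coordinates. -/
theorem apply_one_eq_of_cdot_eq_zero (h : EuclideanSpace ℂ (Fin 2)) :
    (cdot h XEven = 0 → h 1 = -I * h 0) ∧ (cdot h XOdd = 0 → h 1 = I * h 0) := by
  set G := exp (I * (Real.pi / 4)) with hG
  have hG2 : G ^ 2 = I := exp_I_mul_pi_div_four_sq
  have hinv : exp (-(I * (Real.pi / 4))) * G = 1 := by rw [hG, ← exp_add]; simp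
  have c1 : conj (exp (I * (Real.pi / 4))) = exp (-(I * (Real.pi / 4))) := by
    rw [← exp_conj, map_mul, conj_I, map_div₀, conj_ofReal, show conj (4 : ℂ) = 4 from map_ofNat _ 4,
      neg_mul]
  have c2 : conj (exp (-(I * (Real.pi / 4)))) = G := by
    rw [← c1, conj_conj]
  have hr : (1 / (Real.sqrt 2 : ℂ)) ≠ 0 := by simp
  constructor
  · intro h0
    rw [cdot, XEven] at h0
    simp only [Matrix.cons_val_zero, Matrix.cons_val_one, map_mul, map_div₀, map_one, conj_ofReal,
      c1, c2] at h0
    have h1 : h 0 * G + h 1 * exp (-(I * (Real.pi / 4))) = 0 :=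
      (mul_eq_zero.1 (show (1 / (Real.sqrt 2 : ℂ)) *
        (h 0 * G + h 1 * exp (-(I * (Real.pi / 4)))) = 0 by linear_combination h0)).resolve_left hr
    linear_combination G * h1 - h 0 * hG2 - h 1 * hinv
  · intro h0
    rw [cdot, XOdd] at h0
    simp only [Matrix.cons_val_zero, Matrix.cons_val_one, map_mul, map_div₀, map_one, conj_ofReal,
      c1, c2] at h0
    have h1 : h 0 * exp (-(I * (Real.pi / 4))) + h 1 * G = 0 :=
      (mul_eq_zero.1 (show (1 / (Real.sqrt 2 : ℂ)) *
        (h 0 * exp (-(I * (Real.pi / 4))) + h 1 * G) = 0 by linear_combination h0)).resolve_left hr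
    linear_combination (-I * G) * h1 + I * h 0 * hinv + I * h 1 * hG2 + h 1 * I_sq

theorem euclidean_ext_two {h : EuclideanSpace ℂ (Fin 2)} {x y : ℂ} (h0 : h 0 = x) (h1 : h 1 = y) :
    h = !₂[x, y] := by
  ext i
  fin_cases i
  · exact h0
  · exact h1

theorem mainTheorem10 (α : ℝ) (hα_pos : 0 < α) (hα_lt : α < Real.pi) :
    (α ∉ exceptionalAngles →
      ∃ C : ℝ, 0 < C ∧ ∃ ρ₀ : ℝ, 0 < ρ₀ ∧
        ∀ hIn : EuclideanSpace ℂ (Fin 2), ∃ (hOut : EuclideanSpace ℂ (Fin 2)) (Φ : ℂ → ℂ),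
          IsRobinSolution α Φ ∧
          RemainderBound α (remainder α hIn hOut Φ) (Real.pi / α) (C * ‖hIn‖) ρ₀ ∧
          hOut = WithLp.toLp 2 ((vertexTransfer α).mulVec hIn.ofLp)) ∧
    (∀ k : ℕ, 1 ≤ k → α = Real.pi / (2 * k) →
      ∃ C : ℝ, 0 < C ∧ ∃ ρ₀ : ℝ, 0 < ρ₀ ∧
        ∀ hIn hOut : EuclideanSpace ℂ (Fin 2),
          cdot hIn (XVec α) = 0 → cdot hOut (XPerp α) = 0 →
          ∃ Φ : ℂ → ℂ,
            IsRobinSolution α Φ ∧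
            RemainderBound α (remainder α hIn hOut Φ) (Real.pi / α)
              (C * (‖hIn‖ + ‖hOut‖)) ρ₀) := by
  obtain ⟨β, rfl⟩ : ∃ β, α = 2 * β := ⟨α / 2, by ring⟩
  have hβ : 0 < β := by linarith
  have hβ' : β < Real.pi / 2 := by linarith
  obtain ⟨hE2, hF2⟩ := exp_edgePhase_sq hβ
  obtain ⟨K, hK, H⟩ := exists_robinSolution_family hβ hβ' rfl rfl
  have hEF : exp (I * edgePhase β) * exp (-(I * edgePhase β)) = 1 := by rw [← exp_add]; simp
  have hEn : ‖exp (I * edgePhase β)‖ = 1 := by rw [mul_comm, norm_exp_ofReal_mul_I]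
  have hFn : ‖exp (-(I * edgePhase β))‖ = 1 := by rw [exp_neg, norm_inv, hEn, inv_one]
  generalize exp (I * edgePhase β) = E at hE2 H hEF hEn
  generalize exp (-(I * edgePhase β)) = F at hF2 H hEF hFn
  constructor
  · intro hα
    have hS := sin_ne_zero_of_notMem_exceptionalAngles hα_pos hα
    set κ := Real.pi ^ 2 / (2 * (2 * β)) with hκ
    have hSc : ((Real.sin κ : ℝ) : ℂ) ≠ 0 := by exact_mod_cast hS
    set S : ℂ := ((Real.sin κ : ℝ) : ℂ) with hSdef
    have hSn : 0 < ‖S‖ := norm_pos_iff.2 hSc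
    refine ⟨K * (2 / ‖S‖), by positivity, 1, one_pos, fun h => ?_⟩
    -- The solution of aF - bE = h₁, aE + bF = h₂, whose determinant is E² + F² = 2 sin κ.
    obtain ⟨Φ, h1, h2⟩ := H ((h 0 * F + h 1 * E) / (2 * S)) ((h 1 * F - h 0 * E) / (2 * S))
    refine ⟨_, Φ, h1, ?_, rfl⟩
    have eIn : h = !₂[(h 0 * F + h 1 * E) / (2 * S) * F - (h 1 * F - h 0 * E) / (2 * S) * E,
        (h 0 * F + h 1 * E) / (2 * S) * E + (h 1 * F - h 0 * E) / (2 * S) * F] := by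
      apply euclidean_ext_two
      · field_simp
        linear_combination -(h 0) * (hE2 + hF2)
      · field_simp
        linear_combination -(h 1) * (hE2 + hF2)
    have eOut : WithLp.toLp 2 ((vertexTransfer (2 * β)).mulVec h.ofLp) =
        !₂[(h 0 * F + h 1 * E) / (2 * S) * E - (h 1 * F - h 0 * E) / (2 * S) * F,
          (h 0 * F + h 1 * E) / (2 * S) * F + (h 1 * F - h 0 * E) / (2 * S) * E] := by
      apply euclidean_ext_two
      · simp only [vertexTransfer, ← hκ, Matrix.mulVec, dotProduct, Fin.sum_univ_two,
          Matrix.of_apply, Matrix.cons_val', Matrix.cons_val_zero, Matrix.cons_val_one,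
          Matrix.cons_val_fin_one, ofReal_div, ofReal_one, ← hSdef]
        field_simp
        linear_combination -2 * h 0 * hEF - h 1 * (hE2 - hF2)
      · simp only [vertexTransfer, ← hκ, Matrix.mulVec, dotProduct, Fin.sum_univ_two,
          Matrix.of_apply, Matrix.cons_val', Matrix.cons_val_zero, Matrix.cons_val_one,
          Matrix.cons_val_fin_one, ofReal_div, ofReal_one, ← hSdef]
        field_simp
        linear_combination -2 * h 1 * hEF + h 0 * (hE2 - hF2)
    rw [← eIn, ← eOut] at h2
    refine h2.mono ?_
    rw [mul_assoc]
    refine mul_le_mul_of_nonneg_left ?_ hK.le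
    have m0 : ‖h 0‖ ≤ ‖h‖ := PiLp.norm_apply_le h 0
    have m1 : ‖h 1‖ ≤ ‖h‖ := PiLp.norm_apply_le h 1
    have n1 : ‖h 0 * F + h 1 * E‖ ≤ 2 * ‖h‖ := by
      refine (norm_add_le _ _).trans ?_
      rw [norm_mul, norm_mul, hEn, hFn]; linarith
    have n2 : ‖h 1 * F - h 0 * E‖ ≤ 2 * ‖h‖ := by
      refine (norm_sub_le _ _).trans ?_
      rw [norm_mul, norm_mul, hEn, hFn]; linarith
    rw [norm_div, norm_div, norm_mul, norm_ofNat, ← add_div, div_le_iff₀ (by positivity)]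
    calc _ ≤ 4 * ‖h‖ := by linarith
      _ = _ := by field_simp; ring
  · intro k hk hα
    have hk0 : (0 : ℝ) < k := by exact_mod_cast hk
    have hκ : Real.pi ^ 2 / (2 * (2 * β)) = k * Real.pi := by
      rw [hα]; have := Real.pi_pos; field_simp
    have hpar : angleParity (2 * β) = Real.cos (k * Real.pi) := by rw [angleParity, hκ]
    have hcos : Real.cos (k * Real.pi) = 1 ∨ Real.cos (k * Real.pi) = -1 := by
      rw [Real.cos_nat_mul_pi]; exact neg_one_pow_eq_or ℝ k
    rw [hκ, Real.sin_nat_mul_pi, ofReal_zero, zero_sub] at hE2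
    rw [hκ, Real.sin_nat_mul_pi, ofReal_zero, zero_add] at hF2
    set c : ℂ := ((Real.cos (k * Real.pi) : ℝ) : ℂ) with hc
    have hc2 : c ^ 2 = 1 := by
      rcases hcos with h | h <;> rw [hc, h] <;> norm_num
    have hcn : ‖c‖ = 1 := by
      rcases hcos with h | h <;> rw [hc, h] <;> norm_num
    refine ⟨K, hK, 1, one_pos, fun hIn hOut h1 h2 => ?_⟩
    -- With c = (-1)^k, these are the lines swept by the amplitudes of the family, since E² = -ic
    -- and F² = ic.
    have hrel : hIn 1 = -I * c * hIn 0 ∧ hOut 1 = I * c * hOut 0 := by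
      rcases hcos with h | h
      · rw [XVec, hpar, if_pos h] at h1
        rw [XPerp, hpar, if_pos h] at h2
        rw [hc, h, (apply_one_eq_of_cdot_eq_zero hIn).1 h1,
          (apply_one_eq_of_cdot_eq_zero hOut).2 h2]
        simp
      · have hne : ¬ Real.cos (k * Real.pi) = 1 := by rw [h]; norm_num
        rw [XVec, hpar, if_neg hne] at h1
        rw [XPerp, hpar, if_neg hne] at h2
        rw [hc, h, (apply_one_eq_of_cdot_eq_zero hIn).2 h1,
          (apply_one_eq_of_cdot_eq_zero hOut).1 h2]
        simp
    -- Obtained by solving for the first coordinates, aF - bE of h_in and aE - bF of h_out. The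
    -- determinant E² - F² = -2ic is nonzero, and the second coordinates follow from `hrel`.
    obtain ⟨Φ, g1, g2⟩ := H ((hIn 0 + I * c * hOut 0) / 2 * E) ((-I * c * hIn 0 - hOut 0) / 2 * E)
    refine ⟨Φ, g1, ?_⟩
    have eIn : hIn = !₂[(hIn 0 + I * c * hOut 0) / 2 * E * F - (-I * c * hIn 0 - hOut 0) / 2 * E * E,
        (hIn 0 + I * c * hOut 0) / 2 * E * E + (-I * c * hIn 0 - hOut 0) / 2 * E * F] := by
      apply euclidean_ext_two
      · linear_combination (-(hIn 0 + I * c * hOut 0) / 2) * hEF +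
          ((-I * c * hIn 0 - hOut 0) / 2) * hE2 + (hIn 0 / 2 * c ^ 2) * I_sq - hIn 0 / 2 * hc2
      · rw [hrel.1]
        linear_combination (-(-I * c * hIn 0 - hOut 0) / 2) * hEF -
          ((hIn 0 + I * c * hOut 0) / 2) * hE2 + (hOut 0 / 2 * c ^ 2) * I_sq - hOut 0 / 2 * hc2
    have eOut : hOut = !₂[(hIn 0 + I * c * hOut 0) / 2 * E * E - (-I * c * hIn 0 - hOut 0) / 2 * E * F,
        (hIn 0 + I * c * hOut 0) / 2 * E * F + (-I * c * hIn 0 - hOut 0) / 2 * E * E] := by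
      apply euclidean_ext_two
      · linear_combination ((-I * c * hIn 0 - hOut 0) / 2) * hEF -
          ((hIn 0 + I * c * hOut 0) / 2) * hE2 + (hOut 0 / 2 * c ^ 2) * I_sq - hOut 0 / 2 * hc2
      · rw [hrel.2]
        linear_combination (-(hIn 0 + I * c * hOut 0) / 2) * hEF -
          ((-I * c * hIn 0 - hOut 0) / 2) * hE2 - (hIn 0 / 2 * c ^ 2) * I_sq + hIn 0 / 2 * hc2
    rw [← eIn, ← eOut] at g2
    refine g2.mono (mul_le_mul_of_nonneg_left ?_ hK.le)
    have m0 : ‖hIn 0‖ ≤ ‖hIn‖ := PiLp.norm_apply_le hIn 0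
    have m1 : ‖hOut 0‖ ≤ ‖hOut‖ := PiLp.norm_apply_le hOut 0
    have n1 : ‖hIn 0 + I * c * hOut 0‖ ≤ ‖hIn‖ + ‖hOut‖ := by
      refine (norm_add_le _ _).trans ?_
      rw [norm_mul, norm_mul, norm_I, hcn]; linarith
    have n2 : ‖-I * c * hIn 0 - hOut 0‖ ≤ ‖hIn‖ + ‖hOut‖ := by
      refine (norm_sub_le _ _).trans ?_
      rw [norm_mul, norm_mul, norm_neg, norm_I, hcn]; linarith
    rw [norm_mul, norm_mul, norm_div, norm_div, hEn, norm_ofNat]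
    linarith

end Main
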